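/- Let $p>1$, let $\Sigma$ be a closed surface (a compact smooth $2$-dimensional manifold without boundary) and let $N^n\subset\mathbb{R}^m$ be a closed (compact, without boundary) smooth embedded $n$-dimensional submanifold with the induced metric $h$. Let $W^{2,2p}(\Sigma,\mathbb{R}^m)$ be the Banach space of maps whose weak derivatives up to order two are in $L^{2p}$ in coordinates; since $2p>2$, its elements are $C^1$. Set $$\mathcal{M}=W^{2,2p}_{imm}(\Sigma,N^n):=\{\Phi\in W^{2,2p}(\Sigma,\mathbb{R}^m)\ ;\ \Phi(x)\in N^n \text{ and } \operatorname{rank}(d\Phi_x)=2\ \text{ for all } x\in\Sigma\},$$ a Banach submanifold of $W^{2,2p}(\Sigma,\mathbb{R}^m)$, whose tangent space at $\Phi$ is $$T_\Phi\mathcal{M}=\{v\in W^{2,2p}(\Sigma,\mathbb{R}^m)\ ;\ v(x)\in T_{\Phi(x)}N^n\ \text{ for all } x\in\Sigma\}.$$ For $\Phi\in\mathcal{M}$ let $g_\Phi$ be the metric on $\Sigma$ induced by $\Phi$, and let $\nabla$ be the connection on $(T^*\Sigma)^{\otimes j}\otimes\Phi^{-1}TN$ obtained from the Levi-Civita connections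 of $g_\Phi$ and of $(N^n,h)$. For $v\in T_\Phi\mathcal{M}$ put $$\|v\|_\Phi:=\left[\int_\Sigma\left[|\nabla^2v|^2_{g_\Phi}+|\nabla v|^2_{g_\Phi}+|v|^2\right]^p\,dvol_{g_\Phi}\right]^{1/(2p)}+\big\|\,|\nabla v|_{g_\Phi}\big\|_{L^\infty(\Sigma)} .$$ For $\Phi,\Psi\in\mathcal{M}$ let $$d(\Phi,\Psi):=\inf_\omega\int_0^1\left\|\frac{d\omega}{dt}\right\|_{\omega(t)}dt\in[0,\infty],$$ the infimum over all $C^1$ curves $\omega:[0,1]\to\mathcal{M}$ with $\omega(0)=\Phi$, $\omega(1)=\Psi$ ($d=\infty$ if there is none), be the Palais distance. Then $\mathcal{M}$ is complete for $d$: for every sequence $(\Phi_k)$ in $\mathcal{M}$ which is Cauchy for $d$ there is $\Psi\in\mathcal{M}$ with $d(\Phi_k,\Psi)\to0$. -/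

import Mathlib

open Set Filter Topology MeasureTheory
open scoped ContDiff Manifold ENNReal InnerProductSpace

noncomputable section

namespace PalaisImm

/-- The model plane of a surface. -/
abbrev Plane : Type := EuclideanSpace ℝ (Fin 2)

/-- The Euclidean space `ℝᵐ`. -/
abbrev Euc (m : ℕ) : Type := EuclideanSpace ℝ (Fin m)

/-- The `j`-th standard basis vector of the plane. -/
def e (j : Fin 2) : Plane := EuclideanSpace.single j 1

/-! ### Weak derivatives and `W^{2,q}` on open subsets of the plane -/

section Weak

variable {F : Type*} [NormedAddCommGroup F] [NormedSpace ℝ F]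

/-- `g` is the weak (distributional) partial derivative `∂_j f` on the open set `U`. -/
def IsWeakPartial (U : Set Plane) (j : Fin 2) (f g : Plane → F) : Prop :=
  LocallyIntegrableOn f U ∧ LocallyIntegrableOn g U ∧
    ∀ η : Plane → ℝ, ContDiff ℝ ∞ η → HasCompactSupport η → tsupport η ⊆ U →
      ∫ x, (fderiv ℝ η x (e j)) • f x = - ∫ x, η x • g x

open Classical in
/-- The weak partial derivative `∂_j f` on `U` (well defined up to equality almost everywhere
on `U` when it exists; `0` by convention otherwise). -/
def weakPartial (U : Set Plane) (j : Fin 2) (f : Plane → F) : Plane → F :=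
  if h : ∃ g, IsWeakPartial U j f g then h.choose else 0

/-- `f ∈ W^{1,q}(U)`. -/
def MemW1 (U : Set Plane) (q : ℝ≥0∞) (f : Plane → F) : Prop :=
  MemLp f q (volume.restrict U) ∧
    ∀ j, ∃ g, IsWeakPartial U j f g ∧ MemLp g q (volume.restrict U)

/-- `f ∈ W^{2,q}(U)`. -/
def MemW2 (U : Set Plane) (q : ℝ≥0∞) (f : Plane → F) : Prop :=
  MemLp f q (volume.restrict U) ∧
    ∀ j, ∃ g, IsWeakPartial U j f g ∧ MemW1 U q g

/-- The norm of `W^{2,q}(U)`: the sum of the `L^q(U)` norms of the weak derivatives of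
order at most two. -/
def normW2 (U : Set Plane) (q : ℝ≥0∞) (f : Plane → F) : ℝ :=
  (eLpNorm f q (volume.restrict U)).toReal
    + ∑ j, (eLpNorm (weakPartial U j f) q (volume.restrict U)).toReal
    + ∑ j, ∑ k, (eLpNorm (weakPartial U k (weakPartial U j f)) q (volume.restrict U)).toReal

variable {U : Set Plane} {q : ℝ≥0∞} {j : Fin 2} {f f' g g' : Plane → F}

theorem integrable_smul_of_locallyIntegrableOn (hf : LocallyIntegrableOn f U)
    {η : Plane → ℝ} (hη : Continuous η) (hc : HasCompactSupport η) (hs : tsupport η ⊆ U) :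
    Integrable (fun x => η x • f x) := by
  have h1 : IntegrableOn f (tsupport η) := hf.integrableOn_compact_subset hs hc
  have h2 : IntegrableOn (fun x => η x • f x) (tsupport η) :=
    h1.continuousOn_smul hη.continuousOn hc
  rw [← integrableOn_iff_integrable_of_support_subset (s := tsupport η)]
  · exact h2
  · intro x hx
    apply subset_tsupport
    intro h0
    exact hx (by simp [h0])

theorem hasCompactSupport_pd {η : Plane → ℝ} (hc : HasCompactSupport η) (v : Plane) :
    HasCompactSupport (fun x => fderiv ℝ η x v) :=
  (hc.fderiv ℝ).comp_left (g := fun L : Plane →L[ℝ] ℝ => L v) (by simp)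

theorem tsupport_pd_subset {η : Plane → ℝ} (v : Plane) :
    tsupport (fun x => fderiv ℝ η x v) ⊆ tsupport η := by
  refine closure_minimal ?_ (isClosed_tsupport _)
  intro x hx
  apply support_fderiv_subset ℝ
  intro h0
  exact hx (by simp [h0])

theorem continuous_pd {η : Plane → ℝ} (h : ContDiff ℝ ∞ η) (v : Plane) :
    Continuous (fun x => fderiv ℝ η x v) :=
  (h.continuous_fderiv (by simp)).clm_apply continuous_const

theorem locallyIntegrableOn_congr {F : Type*} [NormedAddCommGroup F] {U : Set Plane}
    {f f' : Plane → F} (h : f =ᵐ[volume.restrict U] f')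
    (hf : LocallyIntegrableOn f U) : LocallyIntegrableOn f' U := by
  intro x hx
  obtain ⟨s, hs, hi⟩ := hf x hx
  refine ⟨s ∩ U, inter_mem hs self_mem_nhdsWithin, ?_⟩
  have h1 : IntegrableOn f (s ∩ U) := hi.mono_set inter_subset_left
  exact h1.congr (ae_mono (Measure.restrict_mono inter_subset_right le_rfl) h)

theorem integral_smul_congr (hU : IsOpen U) (h : f =ᵐ[volume.restrict U] f')
    {η : Plane → ℝ} (hs : tsupport η ⊆ U) : ∫ x, η x • f x = ∫ x, η x • f' x := by
  apply integral_congr_ae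
  have h' := (ae_restrict_iff' hU.measurableSet).1 h
  filter_upwards [h'] with x hx
  by_cases hxU : x ∈ U
  · simp [hx hxU]
  · have : η x = 0 := by
      by_contra h0
      exact hxU (hs (subset_tsupport _ h0))
    simp [this]

theorem IsWeakPartial.congr (hU : IsOpen U) (h : IsWeakPartial U j f g)
    (hf : f =ᵐ[volume.restrict U] f') : IsWeakPartial U j f' g := by
  refine ⟨locallyIntegrableOn_congr hf h.1, h.2.1, fun η h1 h2 h3 => ?_⟩
  rw [← h.2.2 η h1 h2 h3]
  exact (integral_smul_congr hU hf ((tsupport_pd_subset (e j)).trans h3)).symm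

theorem IsWeakPartial.add (h : IsWeakPartial U j f g)
    (h' : IsWeakPartial U j f' g') : IsWeakPartial U j (f + f') (g + g') := by
  refine ⟨h.1.add h'.1, h.2.1.add h'.2.1, fun η h1 h2 h3 => ?_⟩
  have i1 := integrable_smul_of_locallyIntegrableOn h.1 (continuous_pd h1 (e j))
    (hasCompactSupport_pd h2 (e j)) ((tsupport_pd_subset (e j)).trans h3)
  have i2 := integrable_smul_of_locallyIntegrableOn h'.1 (continuous_pd h1 (e j))
    (hasCompactSupport_pd h2 (e j)) ((tsupport_pd_subset (e j)).trans h3)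
  have i3 := integrable_smul_of_locallyIntegrableOn h.2.1 h1.continuous h2 h3
  have i4 := integrable_smul_of_locallyIntegrableOn h'.2.1 h1.continuous h2 h3
  simp only [Pi.add_apply, smul_add]
  rw [integral_add i1 i2, integral_add i3 i4, h.2.2 η h1 h2 h3, h'.2.2 η h1 h2 h3]
  abel

theorem IsWeakPartial.smul (c : ℝ) (h : IsWeakPartial U j f g) :
    IsWeakPartial U j (c • f) (c • g) := by
  refine ⟨h.1.smul c, h.2.1.smul c, fun η h1 h2 h3 => ?_⟩
  simp only [Pi.smul_apply, smul_comm _ c]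
  rw [integral_smul, integral_smul, h.2.2 η h1 h2 h3, smul_neg]

theorem IsWeakPartial.unique [CompleteSpace F] (hU : IsOpen U) (h : IsWeakPartial U j f g)
    (h' : IsWeakPartial U j f g') : g =ᵐ[volume.restrict U] g' := by
  have key := hU.ae_eq_zero_of_integral_contDiff_smul_eq_zero (μ := volume)
    (h.2.1.sub h'.2.1) (fun η h1 h2 h3 => by
      have i3 := integrable_smul_of_locallyIntegrableOn h.2.1 h1.continuous h2 h3
      have i4 := integrable_smul_of_locallyIntegrableOn h'.2.1 h1.continuous h2 h3
      simp only [Pi.sub_apply, smul_sub]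
      rw [integral_sub i3 i4]
      have a := h.2.2 η h1 h2 h3
      have b := h'.2.2 η h1 h2 h3
      rw [a] at b
      rw [neg_inj.1 b, sub_self])
  refine (ae_restrict_iff' hU.measurableSet).2 ?_
  filter_upwards [key] with x hx hxU
  exact sub_eq_zero.1 (hx hxU)

theorem IsWeakPartial.weakPartial (h : IsWeakPartial U j f g) :
    IsWeakPartial U j f (weakPartial U j f) := by
  have hex : ∃ g, IsWeakPartial U j f g := ⟨g, h⟩
  unfold PalaisImm.weakPartial
  rw [dif_pos hex]
  exact hex.choose_spec

theorem IsWeakPartial.ae_eq [CompleteSpace F] (hU : IsOpen U) (h : IsWeakPartial U j f g) :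
    PalaisImm.weakPartial U j f =ᵐ[volume.restrict U] g :=
  h.weakPartial.unique hU h

theorem MemW1.congr (hU : IsOpen U) (h : MemW1 U q f) (hf : f =ᵐ[volume.restrict U] f') :
    MemW1 U q f' :=
  ⟨h.1.ae_eq hf, fun j => by
    obtain ⟨g, h1, h2⟩ := h.2 j
    exact ⟨g, h1.congr hU hf, h2⟩⟩

theorem MemW1.add (h : MemW1 U q f) (h' : MemW1 U q f') :
    MemW1 U q (f + f') :=
  ⟨h.1.add h'.1, fun j => by
    obtain ⟨g, h1, h2⟩ := h.2 j
    obtain ⟨g', h1', h2'⟩ := h'.2 j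
    exact ⟨g + g', h1.add h1', h2.add h2'⟩⟩

theorem MemW1.smul (c : ℝ) (h : MemW1 U q f) : MemW1 U q (c • f) :=
  ⟨h.1.const_smul c, fun j => by
    obtain ⟨g, h1, h2⟩ := h.2 j
    exact ⟨c • g, h1.smul c, h2.const_smul c⟩⟩

theorem MemW2.add (h : MemW2 U q f) (h' : MemW2 U q f') :
    MemW2 U q (f + f') :=
  ⟨h.1.add h'.1, fun j => by
    obtain ⟨g, h1, h2⟩ := h.2 j
    obtain ⟨g', h1', h2'⟩ := h'.2 j
    exact ⟨g + g', h1.add h1', h2.add h2'⟩⟩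

theorem MemW2.smul (c : ℝ) (h : MemW2 U q f) : MemW2 U q (c • f) :=
  ⟨h.1.const_smul c, fun j => by
    obtain ⟨g, h1, h2⟩ := h.2 j
    exact ⟨c • g, h1.smul c, h2.smul c⟩⟩

theorem memW2_zero : MemW2 U q (0 : Plane → F) := by
  have h0 : ∀ j, IsWeakPartial U j (0 : Plane → F) 0 := fun j =>
    ⟨locallyIntegrableOn_zero, locallyIntegrableOn_zero, fun η _ _ _ => by simp⟩
  have hz : MemLp (0 : Plane → F) q (volume.restrict U) := MemLp.zero
  exact ⟨hz, fun j => ⟨0, h0 j, hz, fun k => ⟨0, h0 k, hz⟩⟩⟩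

/-- The weak derivatives of a `W^{2,q}` function, in terms of `weakPartial`. -/
theorem MemW2.spec [CompleteSpace F] (hU : IsOpen U) (h : MemW2 U q f) (j k : Fin 2) :
    IsWeakPartial U j f (PalaisImm.weakPartial U j f) ∧
    IsWeakPartial U k (PalaisImm.weakPartial U j f)
      (PalaisImm.weakPartial U k (PalaisImm.weakPartial U j f)) ∧
    MemLp (PalaisImm.weakPartial U j f) q (volume.restrict U) ∧
    MemLp (PalaisImm.weakPartial U k (PalaisImm.weakPartial U j f)) q (volume.restrict U) := by
  obtain ⟨g, h1, h2⟩ := h.2 j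
  have h2' := h2.congr hU (h1.ae_eq hU).symm
  obtain ⟨g', h3, h4⟩ := h2'.2 k
  exact ⟨h1.weakPartial, h3.weakPartial, h2'.1, h4.ae_eq (h3.ae_eq hU).symm⟩

theorem normW2_nonneg : 0 ≤ normW2 U q f := by
  unfold normW2
  positivity

theorem normW2_add_le [CompleteSpace F] (hU : IsOpen U) (hq : 1 ≤ q) (h : MemW2 U q f)
    (h' : MemW2 U q f') : normW2 U q (f + f') ≤ normW2 U q f + normW2 U q f' := by
  have tri : ∀ {a b c : Plane → F}, MemLp a q (volume.restrict U) →
      MemLp b q (volume.restrict U) → c =ᵐ[volume.restrict U] a + b →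
      (eLpNorm c q (volume.restrict U)).toReal ≤
        (eLpNorm a q (volume.restrict U)).toReal + (eLpNorm b q (volume.restrict U)).toReal := by
    intro a b c ha hb hc
    rw [eLpNorm_congr_ae hc, ← ENNReal.toReal_add ha.2.ne hb.2.ne]
    exact ENNReal.toReal_mono (ENNReal.add_ne_top.2 ⟨ha.2.ne, hb.2.ne⟩)
      (eLpNorm_add_le ha.1 hb.1 hq)
  have d1 : ∀ j, PalaisImm.weakPartial U j (f + f') =ᵐ[volume.restrict U]
      PalaisImm.weakPartial U j f + PalaisImm.weakPartial U j f' := fun j =>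
    ((h.spec hU j j).1.add (h'.spec hU j j).1).ae_eq hU
  have d2 : ∀ j k, PalaisImm.weakPartial U k (PalaisImm.weakPartial U j (f + f'))
      =ᵐ[volume.restrict U] PalaisImm.weakPartial U k (PalaisImm.weakPartial U j f)
        + PalaisImm.weakPartial U k (PalaisImm.weakPartial U j f') := fun j k =>
    ((((h.spec hU j k).2.1.add (h'.spec hU j k).2.1)).congr hU (d1 j).symm).ae_eq hU
  have s1 := tri h.1 h'.1 (EventuallyEq.refl _ (f + f'))
  have s2 : ∀ j, _ := fun j => tri (h.spec hU j j).2.2.1 (h'.spec hU j j).2.2.1 (d1 j)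
  have s3 : ∀ j k, _ := fun j k =>
    tri (h.spec hU j k).2.2.2 (h'.spec hU j k).2.2.2 (d2 j k)
  have s2' := Finset.sum_le_sum (s := Finset.univ) fun j _ => s2 j
  have s3' := Finset.sum_le_sum (s := Finset.univ) fun j _ =>
    Finset.sum_le_sum (s := Finset.univ) fun k _ => s3 j k
  rw [Finset.sum_add_distrib] at s2'
  simp only [Finset.sum_add_distrib] at s3'
  unfold normW2
  linarith

theorem normW2_smul [CompleteSpace F] (hU : IsOpen U) (c : ℝ) (h : MemW2 U q f) :
    normW2 U q (c • f) = |c| * normW2 U q f := by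
  have hom : ∀ {a b : Plane → F}, b =ᵐ[volume.restrict U] c • a →
      (eLpNorm b q (volume.restrict U)).toReal
        = |c| * (eLpNorm a q (volume.restrict U)).toReal := by
    intro a b hb
    rw [eLpNorm_congr_ae hb, eLpNorm_const_smul, ENNReal.toReal_mul]
    simp
  have d1 : ∀ j, PalaisImm.weakPartial U j (c • f) =ᵐ[volume.restrict U]
      c • PalaisImm.weakPartial U j f := fun j => ((h.spec hU j j).1.smul c).ae_eq hU
  have d2 : ∀ j k, PalaisImm.weakPartial U k (PalaisImm.weakPartial U j (c • f))
      =ᵐ[volume.restrict U] c • PalaisImm.weakPartial U k (PalaisImm.weakPartial U j f) :=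
    fun j k => (((h.spec hU j k).2.1.smul c).congr hU (d1 j).symm).ae_eq hU
  unfold normW2
  rw [hom (EventuallyEq.refl _ (c • f))]
  simp only [fun j => hom (d1 j), fun j k => hom (d2 j k), ← Finset.mul_sum, mul_add]

theorem ae_eq_zero_of_normW2_eq_zero (hq : 1 ≤ q) (h : MemW2 U q f) (h0 : normW2 U q f = 0) :
    f =ᵐ[volume.restrict U] 0 := by
  have h1 : (eLpNorm f q (volume.restrict U)).toReal = 0 := by
    refine le_antisymm ?_ ENNReal.toReal_nonneg
    rw [← h0]
    unfold normW2
    have a := Finset.sum_nonneg (s := Finset.univ) fun (j : Fin 2) _ =>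
      ENNReal.toReal_nonneg (a := eLpNorm (weakPartial U j f) q (volume.restrict U))
    have b := Finset.sum_nonneg (s := Finset.univ) fun (j : Fin 2) _ =>
      Finset.sum_nonneg (s := Finset.univ) fun (k : Fin 2) _ =>
        ENNReal.toReal_nonneg
          (a := eLpNorm (weakPartial U k (weakPartial U j f)) q (volume.restrict U))
    linarith
  rcases (ENNReal.toReal_eq_zero_iff _).1 h1 with h2 | h2
  · exact (eLpNorm_eq_zero_iff h.1.1 (by
      rintro rfl
      simp at hq)).1 h2
  · exact absurd h2 h.1.2.ne

end Weak

/-! ### Finite families of coordinate discs covering a closed surface -/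

/-- A finite family of smooth charts of the surface `S` and, in each of them, a disc whose closure
lies in the range of the chart, such that the discs cover `S`. It serves to write Sobolev norms
and integrals over `S` in coordinates. -/
structure DiscCover (S : Type*) [TopologicalSpace S] [ChartedSpace Plane S]
    [IsManifold (𝓡 2) ∞ S] where
  /-- the number of discs -/
  card : ℕ
  /-- the charts -/
  chart : Fin card → OpenPartialHomeomorph S Plane
  chart_mem : ∀ i, chart i ∈ IsManifold.maximalAtlas (𝓡 2) ∞ S
  /-- the centres of the discs -/
  center : Fin card → Plane
  /-- the radii of the discs -/
  radius : Fin card → ℝ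
  closedBall_subset : ∀ i, Metric.closedBall (center i) (radius i) ⊆ (chart i).target
  covers : ∀ x : S, ∃ i, x ∈ (chart i).source ∧ chart i x ∈ Metric.ball (center i) (radius i)

section Surface

variable {S : Type*} [TopologicalSpace S] [ChartedSpace Plane S] [IsManifold (𝓡 2) ∞ S]

/-- Every closed surface has such a family. -/
theorem nonempty_discCover [CompactSpace S] : Nonempty (DiscCover S) := by
  have hr : ∀ x : S, ∃ r > 0, Metric.closedBall (chartAt Plane x x) r
      ⊆ (chartAt Plane x).target := fun x =>
    Metric.nhds_basis_closedBall.mem_iff.1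
      ((chartAt Plane x).open_target.mem_nhds (mem_chart_target Plane x))
  choose r hr0 hr using hr
  obtain ⟨t, ht⟩ := isCompact_univ.elim_finite_subcover
    (fun x : S => (chartAt Plane x).source ∩
      (chartAt Plane x) ⁻¹' Metric.ball (chartAt Plane x x) (r x))
    (fun x => (chartAt Plane x).isOpen_inter_preimage Metric.isOpen_ball)
    (fun x _ => mem_iUnion.2 ⟨x, mem_chart_source Plane x, Metric.mem_ball_self (hr0 x)⟩)
  let φ := t.equivFin.symm
  refine ⟨⟨t.card, fun i => chartAt Plane (φ i : S), fun i =>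
    IsManifold.chart_mem_maximalAtlas _, fun i => chartAt Plane (φ i : S) (φ i : S),
    fun i => r (φ i), fun i => hr _, fun x => ?_⟩⟩
  obtain ⟨y, hy, hx⟩ := mem_iUnion₂.1 (ht (mem_univ x))
  refine ⟨t.equivFin ⟨y, hy⟩, ?_⟩
  simpa [φ] using hx

namespace DiscCover

variable (𝔄 : DiscCover S)

/-- The `i`-th open disc, a subset of the plane. -/
def disc (i : Fin 𝔄.card) : Set Plane := Metric.ball (𝔄.center i) (𝔄.radius i)

/-- The `i`-th open disc, as a subset of the surface. -/
def nbhd (i : Fin 𝔄.card) : Set S := (𝔄.chart i).source ∩ (𝔄.chart i) ⁻¹' 𝔄.disc i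

/-- The part of the `i`-th disc that is not covered by the previous discs. These pieces,
transported to `S`, form a partition of `S`. -/
def piece (i : Fin 𝔄.card) : Set Plane :=
  {y ∈ 𝔄.disc i | ∀ j < i, (𝔄.chart i).symm y ∉ 𝔄.nbhd j}

/-- The expression of a map in the `i`-th chart. -/
def loc {F : Type*} (i : Fin 𝔄.card) (f : S → F) : Plane → F := f ∘ (𝔄.chart i).symm

theorem disc_subset (i : Fin 𝔄.card) : 𝔄.disc i ⊆ (𝔄.chart i).target :=
  Metric.ball_subset_closedBall.trans (𝔄.closedBall_subset i)

theorem isOpen_disc (i : Fin 𝔄.card) : IsOpen (𝔄.disc i) := Metric.isOpen_ball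

end DiscCover

/-! ### The Banach space `W^{2,2p}(S, ℝᵐ)` -/

/-- The set `W^{2,2p}(S, ℝᵐ)`, `p > 1`, as a linear subspace of the space of all maps: the maps whose coordinate expressions have weak
derivatives up to order two in `L^{2p}`. By the Sobolev embedding theorem each class of such maps
has a unique `C¹` representative, and the elements of the space are these representatives. -/
def sobolevSubmodule (𝔄 : DiscCover S) (m : ℕ) (p : ℝ) : Submodule ℝ (S → Euc m) where
  carrier := {f | ContMDiff (𝓡 2) 𝓘(ℝ, Euc m) 1 f ∧
    ∀ i, MemW2 (𝔄.disc i) (ENNReal.ofReal (2 * p)) (𝔄.loc i f)}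
  zero_mem' := ⟨contMDiff_const, fun _ => memW2_zero⟩
  add_mem' := fun ha hb => ⟨ha.1.add hb.1, fun i => (ha.2 i).add (hb.2 i)⟩
  smul_mem' := fun c _ ha => ⟨(contDiff_const_smul c).contMDiff.comp ha.1,
    fun i => (ha.2 i).smul c⟩

/-- The space `W^{2,2p}(S, ℝᵐ)`, as a type of its own: its topology is that of the
`W^{2,2p}` norm below. -/
def Sobolev (𝔄 : DiscCover S) (m : ℕ) (p : ℝ) : Type _ := sobolevSubmodule 𝔄 m p

variable {𝔄 : DiscCover S} {m : ℕ} {p : ℝ}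

instance : AddCommGroup (Sobolev 𝔄 m p) :=
  inferInstanceAs (AddCommGroup (sobolevSubmodule 𝔄 m p))

instance : Module ℝ (Sobolev 𝔄 m p) :=
  inferInstanceAs (Module ℝ (sobolevSubmodule 𝔄 m p))

/-- The `W^{2,2p}` norm. -/
instance : Norm (Sobolev 𝔄 m p) :=
  ⟨fun f => ∑ i, normW2 (𝔄.disc i) (ENNReal.ofReal (2 * p)) (𝔄.loc i f.1)⟩

theorem Sobolev.norm_def (f : Sobolev 𝔄 m p) :
    ‖f‖ = ∑ i, normW2 (𝔄.disc i) (ENNReal.ofReal (2 * p)) (𝔄.loc i f.1) := rfl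

theorem one_le_ofReal (hp : 1 < p) : 1 ≤ ENNReal.ofReal (2 * p) := by
  rw [ENNReal.one_le_ofReal]
  linarith

theorem Sobolev.core (hp : 1 < p) : NormedSpace.Core ℝ (Sobolev 𝔄 m p) where
  norm_nonneg f := by
    rw [Sobolev.norm_def]
    exact Finset.sum_nonneg fun _ _ => normW2_nonneg
  norm_smul c f := by
    rw [Sobolev.norm_def, Sobolev.norm_def, Finset.mul_sum]
    exact Finset.sum_congr rfl fun i _ => normW2_smul (𝔄.isOpen_disc i) c (f.2.2 i)
  norm_triangle f g := by
    rw [Sobolev.norm_def, Sobolev.norm_def, Sobolev.norm_def, ← Finset.sum_add_distrib]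
    exact Finset.sum_le_sum fun i _ =>
      normW2_add_le (𝔄.isOpen_disc i) (one_le_ofReal hp) (f.2.2 i) (g.2.2 i)
  norm_eq_zero_iff f := by
    constructor
    · intro h
      rw [Sobolev.norm_def] at h
      have h1 := (Finset.sum_eq_zero_iff_of_nonneg fun i _ => normW2_nonneg).1 h
      refine Subtype.ext (funext fun x => ?_)
      obtain ⟨i, hx, hxi⟩ := 𝔄.covers x
      have h2 := ae_eq_zero_of_normW2_eq_zero (one_le_ofReal hp) (f.2.2 i) (h1 i (Finset.mem_univ i))
      have hc : ContinuousOn (𝔄.loc i f.1) (𝔄.disc i) :=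
        f.2.1.continuous.comp_continuousOn
          ((𝔄.chart i).continuousOn_symm.mono (𝔄.disc_subset i))
      have h3 := Measure.eqOn_open_of_ae_eq h2 (𝔄.isOpen_disc i) hc continuousOn_const
      have h4 := h3 hxi
      have h5 : f.1 x = 0 := by simpa [DiscCover.loc, hx] using h4
      exact h5
    · rintro rfl
      have := fun i => normW2_smul (𝔄.isOpen_disc i) 0
        (memW2_zero (U := 𝔄.disc i) (q := ENNReal.ofReal (2 * p)) (F := Euc m))
      rw [Sobolev.norm_def]
      refine Finset.sum_eq_zero fun i _ => ?_
      have h := this i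
      simp only [abs_zero, zero_mul, zero_smul] at h
      exact h

instance [Fact (1 < p)] : NormedAddCommGroup (Sobolev 𝔄 m p) :=
  NormedAddCommGroup.ofCore (Sobolev.core Fact.out)

instance [Fact (1 < p)] : NormedSpace ℝ (Sobolev 𝔄 m p) :=
  NormedSpace.ofCore (Sobolev.core Fact.out)

end Surface

/-! ### The target -/

/-- `N` is a closed (compact, without boundary) smooth embedded `n`-dimensional submanifold
of `ℝᵐ`: it is compact and near each of its points it is the zero set of a smooth submersion
to `ℝᵏ`, where `n + k = m`. -/
def IsClosedSubmanifold {m : ℕ} (n : ℕ) (N : Set (Euc m)) : Prop :=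
  IsCompact N ∧ ∃ k, n + k = m ∧ ∀ z ∈ N, ∃ U : Set (Euc m), IsOpen U ∧ z ∈ U ∧
    ∃ G : Euc m → Euc k, ContDiffOn ℝ ∞ G U ∧
      (∀ y ∈ U, Function.Surjective (fderiv ℝ G y)) ∧ N ∩ U = {y ∈ U | G y = 0}

/-- The tangent space `T_z N`, spanned by the velocities at `z` of the curves in `N`. -/
def tangentAt {m : ℕ} (N : Set (Euc m)) (z : Euc m) : Submodule ℝ (Euc m) :=
  Submodule.span ℝ {w | ∃ γ : ℝ → Euc m, γ 0 = z ∧ (∀ᶠ t in 𝓝 0, γ t ∈ N) ∧ HasDerivAt γ w 0}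

/-- The orthogonal projection of `ℝᵐ` onto `T_z N`. -/
def tangentProj {m : ℕ} (N : Set (Euc m)) (z : Euc m) : Euc m →L[ℝ] Euc m :=
  (tangentAt N z).starProjection

/-! ### The geometry of an immersion in coordinates

Here `u` and `v` are the expressions in a chart of an immersion `Φ` and of a vector field along it,
and `U` is the domain of the plane on which they are considered. -/

section Local

variable {m : ℕ}

/-- The classical partial derivative. -/
def pd (j : Fin 2) (u : Plane → Euc m) (y : Plane) : Euc m := fderiv ℝ u y (e j)

/-- The coefficients of the first fundamental form, `g_{ij} = ⟨∂_i Φ, ∂_j Φ⟩`. -/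
def gram (u : Plane → Euc m) (y : Plane) : Matrix (Fin 2) (Fin 2) ℝ :=
  Matrix.of fun i j => ⟪pd i u y, pd j u y⟫_ℝ

/-- The Christoffel symbols of the Levi-Civita connection of `g`,
`Γ^k_{ij} = ½ g^{kl} (∂_i g_{jl} + ∂_j g_{il} - ∂_l g_{ij})`. -/
def christoffel (U : Set Plane) (u : Plane → Euc m) (k i j : Fin 2) (y : Plane) : ℝ :=
  (1 / 2) * ∑ l, (gram u y)⁻¹ k l *
    (weakPartial U i (fun z => gram u z j l) y + weakPartial U j (fun z => gram u z i l) y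
      - weakPartial U l (fun z => gram u z i j) y)

/-- The covariant derivative `∇_j v` for the pulled-back Levi-Civita connection of `N`: the
tangential part of `∂_j v`. -/
def cov (N : Set (Euc m)) (u v : Plane → Euc m) (j : Fin 2) (y : Plane) : Euc m :=
  tangentProj N (u y) (pd j v y)

/-- The second covariant derivative `∇²_{ij} v = ∇_i (∇_j v) - Γ^k_{ij} ∇_k v`. -/
def cov2 (N : Set (Euc m)) (U : Set Plane) (u v : Plane → Euc m) (i j : Fin 2) (y : Plane) :
    Euc m :=
  tangentProj N (u y) (weakPartial U i (cov N u v j) y)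
    - ∑ k, christoffel U u k i j y • cov N u v k y

/-- `|∇v|²_g = g^{ij} ⟨∇_i v, ∇_j v⟩`. -/
def covNormSq (N : Set (Euc m)) (u v : Plane → Euc m) (y : Plane) : ℝ :=
  ∑ i, ∑ j, (gram u y)⁻¹ i j * ⟪cov N u v i y, cov N u v j y⟫_ℝ

/-- `|∇²v|²_g = g^{ij} g^{kl} ⟨∇²_{ik} v, ∇²_{jl} v⟩`. -/
def cov2NormSq (N : Set (Euc m)) (U : Set Plane) (u v : Plane → Euc m) (y : Plane) : ℝ :=
  ∑ i, ∑ j, ∑ k, ∑ l, (gram u y)⁻¹ i j * (gram u y)⁻¹ k l *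
    ⟪cov2 N U u v i k y, cov2 N U u v j l y⟫_ℝ

/-- The density of the volume of `g` with respect to the Lebesgue measure. -/
def volDensity (u : Plane → Euc m) (y : Plane) : ℝ := √(gram u y).det

end Local

/-! ### The manifold of immersions, its Finsler structure and the Palais distance -/

section Finsler

variable {S : Type*} [TopologicalSpace S] [ChartedSpace Plane S] [IsManifold (𝓡 2) ∞ S]
variable (𝔄 : DiscCover S) {m : ℕ} (p : ℝ) (N : Set (Euc m))

/-- The set `W^{2,2p}_imm(S, N)` of the `W^{2,2p}` immersions of `S` into `N`. -/
def immersions : Set (Sobolev 𝔄 m p) :=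
  {Φ | (∀ x, Φ.1 x ∈ N) ∧
    ∀ x, Function.Injective (mfderiv (𝓡 2) 𝓘(ℝ, Euc m) Φ.1 x)}

variable {p}

/-- The Finsler norm
`(∫ (|∇²v|² + |∇v|² + |v|²)^p dvol)^{1/2p} + ‖|∇v|‖_{L^∞}`, all with respect to the metric induced
by `Φ`, of a `W^{2,2p}` vector field `v` along the immersion `Φ`. The integral over `S` is
the sum of the integrals over the pieces of a partition of `S`; since `|∇v|` is a continuous function,
its `L^∞` norm is its supremum. -/
def finslerNorm (Φ v : Sobolev 𝔄 m p) : ℝ≥0∞ :=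
  (∑ i, ∫⁻ y in 𝔄.piece i, ENNReal.ofReal
      ((cov2NormSq N (𝔄.disc i) (𝔄.loc i Φ.1) (𝔄.loc i v.1) y
          + covNormSq N (𝔄.loc i Φ.1) (𝔄.loc i v.1) y + ‖𝔄.loc i v.1 y‖ ^ 2) ^ p
        * volDensity (𝔄.loc i Φ.1) y)) ^ (1 / (2 * p))
    + ⨆ i, ⨆ y ∈ 𝔄.disc i, ENNReal.ofReal √(covNormSq N (𝔄.loc i Φ.1) (𝔄.loc i v.1) y)

/-- The length of a curve `γ : [0,1] → W^{2,2p}(S, ℝᵐ)` in the Finsler structure. -/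
def finslerLength [Fact (1 < p)] (γ : ℝ → Sobolev 𝔄 m p) : ℝ≥0∞ :=
  ∫⁻ t in Icc (0 : ℝ) 1, finslerNorm 𝔄 N (γ t) (derivWithin γ (Icc 0 1) t)

/-- The `C¹` curves `[0,1] → W^{2,2p}_imm(S, N)` from `Φ` to `Ψ`. The manifold of immersions is
a submanifold of the Banach space `W^{2,2p}(S, ℝᵐ)`, so that its `C¹` curves are the `C¹`
curves of that space with values in it. -/
def curves [Fact (1 < p)] (Φ Ψ : Sobolev 𝔄 m p) : Set (ℝ → Sobolev 𝔄 m p) :=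
  {γ | ContDiffOn ℝ 1 γ (Icc 0 1) ∧ (∀ t ∈ Icc (0 : ℝ) 1, γ t ∈ immersions 𝔄 p N) ∧
    γ 0 = Φ ∧ γ 1 = Ψ}

/-- The Palais distance: the infimum of the lengths of the `C¹` curves from `Φ` to `Ψ` (it is `∞`
when there is none). -/
def palaisDist [Fact (1 < p)] (Φ Ψ : Sobolev 𝔄 m p) : ℝ≥0∞ :=
  ⨅ γ ∈ curves 𝔄 N Φ Ψ, finslerLength 𝔄 N γ

end Finsler

end PalaisImm

end

/-!
The manifold of immersions is not complete for the Sobolev norm, since the rank of the differential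
may drop in a limit. Completeness for the Palais distance rests on two properties of the
Finsler norm.

* The term `‖|∇v|‖_{L^∞}` is the logarithmic derivative of the metric: along a curve `γ` of
  immersions, `|d/dt |dγ(X)|²| ≤ 2 ‖γ'‖_γ |dγ(X)|²`. Hence the first fundamental form stays between
  fixed positive bounds along curves of bounded length (`gramBound_of_finslerLength_le`).
* Under such bounds the Finsler norm controls the Sobolev norm, `‖v‖ ≤ C (1 + ‖Φ‖) ‖v‖_Φ`
  (`exists_ofReal_norm_le`). The value and the first derivatives of `v` are bounded by the Gronwall
  inequality (`exists_bound_C1`). For the second derivatives, the relation `Q(Φ) v = v`, where `Q` is a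
  smooth extension of the field of tangential projections of `N`, is differentiated twice in the weak
  sense: normal parts are of lower order, and tangential parts are `∇²v` up to terms of lower order
  (`second_derivative_eq`). The integrals in the Finsler norm extend over a partition of the surface
  and those in the Sobolev norm over overlapping discs, whence the changes of charts. A Gronwall
  argument then bounds `‖γ‖` along curves of bounded length, so that the Sobolev length of such curves
  is bounded by a multiple of their Finsler length (`exists_curve_bound`).

A Cauchy sequence for the Palais distance is therefore Cauchy in the Banach space `W^{2,2p}`, whose
completeness comes from that of `L^{2p}` and from an interior Morrey estimate (`morrey`), which makes
convergence locally `C¹`. Its limit `Ψ` takes values in `N` and its first fundamental form is bounded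
below, so that it is an immersion (`mem_immersions_of_tendsto`).

The convergence `d(Φ_k, Ψ) → 0` needs a curve from `Φ_k` to `Ψ` within the immersions. Local charts
of the manifold of immersions are not needed for that: short curves joining the terms of a rapidly
Cauchy subsequence are parametrised by arc length, slowed down at their ends and run through one after
the other in the intervals `[1 - 2⁻ⁱ, 1 - 2⁻ⁱ⁻¹]`. Their speeds tend to zero, and the resulting
curve is `C¹` up to its end `Ψ` (`exists_concatenation`). It consists of immersions, as `Ψ` is one, and
its length is at most the sum of the lengths of the pieces.

The weak derivatives are handled through mollification: weak derivatives of continuous functions are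
limits of derivatives of smooth functions (`exists_smooth_approx`), which gives the product rule
(`IsWeakPartial.bilin`), the chain rule (`IsWeakPartial.comp_left`) and the change of variables
(`isWeakPartial_comp_right`).
-/

namespace PalaisImm

open scoped Convolution

/-! ### Calculus of weak derivatives -/

section WeakCalculus

variable {F : Type*} [NormedAddCommGroup F] [NormedSpace ℝ F]
variable {U V : Set Plane} {j : Fin 2} {f g : Plane → F}

theorem IsWeakPartial.mono (hVU : V ⊆ U) (h : IsWeakPartial U j f g) : IsWeakPartial V j f g :=
  ⟨h.1.mono_set hVU, h.2.1.mono_set hVU, fun η h1 h2 h3 => h.2.2 η h1 h2 (h3.trans hVU)⟩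

theorem IsWeakPartial.congr_right (hU : IsOpen U) {g' : Plane → F} (h : IsWeakPartial U j f g)
    (hg : g =ᵐ[volume.restrict U] g') : IsWeakPartial U j f g' := by
  refine ⟨h.1, locallyIntegrableOn_congr hg h.2.1, fun η h1 h2 h3 => ?_⟩
  rw [h.2.2 η h1 h2 h3, integral_smul_congr hU hg h3]

/-- A `C¹` function has its classical partial derivatives as weak partial derivatives. -/
theorem isWeakPartial_of_contDiffOn (hU : IsOpen U) (hf : ContDiffOn ℝ 1 f U) (j : Fin 2) :
    IsWeakPartial U j f (fun y => fderiv ℝ f y (e j)) := by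
  have hd : ContinuousOn (fun y => fderiv ℝ f y (e j)) U :=
    (hf.continuousOn_fderiv_of_isOpen hU le_rfl).clm_apply continuousOn_const
  have l1 := hf.continuousOn.locallyIntegrableOn (μ := volume) hU.measurableSet
  have l2 := hd.locallyIntegrableOn (μ := volume) hU.measurableSet
  refine ⟨l1, l2, fun η h1 h2 h3 => ?_⟩
  rw [integral_smul_fderiv_eq_neg_fderiv_smul_of_integrable, neg_neg]
  · exact integrable_smul_of_locallyIntegrableOn l1 (continuous_pd h1 (e j))
      (hasCompactSupport_pd h2 (e j)) ((tsupport_pd_subset (e j)).trans h3)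
  · exact integrable_smul_of_locallyIntegrableOn l2 h1.continuous h2 h3
  · exact integrable_smul_of_locallyIntegrableOn l1 h1.continuous h2 h3
  · exact fun x _ => (h1.differentiable (by simp)).differentiableAt
  · exact fun x hx => (hf.contDiffAt (hU.mem_nhds (h3 hx))).differentiableAt (by simp)

theorem exists_cutoff {K : Set Plane} (hK : IsCompact K) (hU : IsOpen U) (hKU : K ⊆ U) :
    ∃ χ : Plane → ℝ, ContDiff ℝ ∞ χ ∧ HasCompactSupport χ ∧ tsupport χ ⊆ U ∧
      ∀ x ∈ K, χ =ᶠ[𝓝 x] fun _ => 1 := by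
  obtain ⟨L, hL, hKL, hLU⟩ := exists_compact_between hK hU hKU
  obtain ⟨χ, h1, h2, -⟩ := exists_contMDiffMap_one_nhds_of_subset_interior (𝓘(ℝ, Plane))
    (n := ⊤) hK.isClosed hKL
  have hs : tsupport χ ⊆ L := closure_minimal
    (fun x hx => by_contra fun h => hx (h2 x h)) hL.isClosed
  exact ⟨χ, χ.contMDiff.contDiff, HasCompactSupport.of_support_subset_isCompact hL
    ((subset_tsupport _).trans hs), hs.trans hLU, fun x hx => eventually_nhdsSet_iff_forall.1 h1 x hx⟩

/-- Multiplication by a cutoff function makes a weak derivative global. -/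
theorem IsWeakPartial.cutoff (h : IsWeakPartial U j f g) {χ : Plane → ℝ} (hχ : ContDiff ℝ ∞ χ)
    (hc : HasCompactSupport χ) (hs : tsupport χ ⊆ U) :
    IsWeakPartial univ j (fun x => χ x • f x)
      (fun x => χ x • g x + fderiv ℝ χ x (e j) • f x) := by
  have i1 := integrable_smul_of_locallyIntegrableOn h.1 hχ.continuous hc hs
  have i2 := integrable_smul_of_locallyIntegrableOn h.2.1 hχ.continuous hc hs
  have i3 := integrable_smul_of_locallyIntegrableOn h.1 (continuous_pd hχ (e j))
    (hasCompactSupport_pd hc (e j)) ((tsupport_pd_subset (e j)).trans hs)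
  refine ⟨i1.integrableOn.locallyIntegrableOn, (i2.add i3).integrableOn.locallyIntegrableOn, fun η h1 h2 h3 => ?_⟩
  have key := h.2.2 (fun x => η x * χ x) (h1.mul hχ) h2.mul_right
    ((tsupport_mul_subset_right).trans hs)
  have hder : ∀ x, fderiv ℝ (fun x => η x * χ x) x (e j)
      = η x * fderiv ℝ χ x (e j) + fderiv ℝ η x (e j) * χ x := fun x => by
    rw [fderiv_fun_mul (h1.differentiable (by simp)).differentiableAt
      (hχ.differentiable (by simp)).differentiableAt]
    simp [mul_comm]
  have j1 : Integrable (fun x => (η x * fderiv ℝ χ x (e j)) • f x) :=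
    integrable_smul_of_locallyIntegrableOn h.1 (h1.continuous.mul (continuous_pd hχ (e j)))
      h2.mul_right ((tsupport_mul_subset_right).trans ((tsupport_pd_subset (e j)).trans hs))
  have j2 : Integrable (fun x => (fderiv ℝ η x (e j) * χ x) • f x) :=
    integrable_smul_of_locallyIntegrableOn h.1 ((continuous_pd h1 (e j)).mul hχ.continuous)
      hc.mul_left ((tsupport_mul_subset_right).trans hs)
  have j3 : Integrable (fun x => (η x * χ x) • g x) :=
    integrable_smul_of_locallyIntegrableOn h.2.1 (h1.continuous.mul hχ.continuous)
      hc.mul_left ((tsupport_mul_subset_right).trans hs)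
  simp only [hder, add_smul] at key
  rw [integral_add j1 j2] at key
  simp only [smul_add, smul_smul]
  rw [integral_add j3 j1, neg_add, ← key]
  abel

/-! ### Mollification -/

theorem lintegral_enorm_convolution_le {φ : Plane → ℝ} (hφ : Continuous φ)
    (h0 : ∀ x, 0 ≤ φ x) (h1 : ∫ x, φ x = 1) (hc : HasCompactSupport φ)
    {g : Plane → F} (hg : Integrable g) :
    ∫⁻ x, ‖(φ ⋆[ContinuousLinearMap.lsmul ℝ ℝ, volume] g) x‖ₑ ≤ ∫⁻ x, ‖g x‖ₑ := by
  have hφi : Integrable φ := hφ.integrable_of_hasCompactSupport hc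
  calc ∫⁻ x, ‖(φ ⋆[ContinuousLinearMap.lsmul ℝ ℝ, volume] g) x‖ₑ
      ≤ ∫⁻ x, ∫⁻ t, ‖φ t • g (x - t)‖ₑ := by
        refine lintegral_mono fun x => ?_
        rw [convolution_lsmul]
        exact enorm_integral_le_lintegral_enorm _
    _ = ∫⁻ t, ∫⁻ x, ‖φ t • g (x - t)‖ₑ := by
        refine lintegral_lintegral_swap ?_
        exact ((hφi.convolution_integrand (ContinuousLinearMap.lsmul ℝ ℝ) hg).aestronglyMeasurable).enorm
    _ = ∫⁻ t, ‖φ t‖ₑ * ∫⁻ x, ‖g x‖ₑ := by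
        refine lintegral_congr fun t => ?_
        simp only [enorm_smul]
        rw [lintegral_const_mul' _ _ enorm_ne_top,
          lintegral_sub_right_eq_self (fun x => ‖g x‖ₑ) t]
    _ = ∫⁻ x, ‖g x‖ₑ := by
        rw [lintegral_mul_const'' _ hφ.aestronglyMeasurable.enorm]
        have : ∫⁻ t, ‖φ t‖ₑ = 1 := by
          have h2 : ∀ t, ‖φ t‖ₑ = ENNReal.ofReal (φ t) := fun t => by
            rw [Real.enorm_eq_ofReal (h0 t)]
          simp only [h2]
          rw [← ofReal_integral_eq_lintegral_ofReal hφi (Eventually.of_forall h0), h1,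
            ENNReal.ofReal_one]
        rw [this, one_mul]

/-- A sequence of smooth bump functions whose supports shrink to the origin. -/
theorem exists_bump_seq : ∃ φ : ℕ → ContDiffBump (0 : Plane),
    (∀ n, (φ n).rOut ≤ 1) ∧ Tendsto (fun n => (φ n).rOut) atTop (𝓝 0) := by
  refine ⟨fun n => ⟨1 / (2 * ((n : ℝ) + 1)), 1 / ((n : ℝ) + 1), by positivity, ?_⟩, fun n => ?_, ?_⟩
  · have : (0:ℝ) ≤ n := by positivity
    exact one_div_lt_one_div_of_lt (by positivity) (by linarith)
  · change 1 / ((n : ℝ) + 1) ≤ 1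
    rw [div_le_one (by positivity)]
    have : (0:ℝ) ≤ n := by positivity
    linarith
  · exact tendsto_one_div_add_atTop_nhds_zero_nat

/-- Mollifications of a compactly supported continuous function converge uniformly. -/
theorem exists_forall_dist_convolution_le [CompleteSpace F] {φ : ℕ → ContDiffBump (0 : Plane)}
    (hφ : Tendsto (fun n => (φ n).rOut) atTop (𝓝 0)) {f : Plane → F} (hf : Continuous f)
    (hc : HasCompactSupport f) {ε : ℝ} (hε : 0 < ε) : ∀ᶠ n in atTop, ∀ x,
      dist (((φ n).normed volume ⋆[ContinuousLinearMap.lsmul ℝ ℝ, volume] f) x) (f x) ≤ ε := by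
  obtain ⟨δ, hδ, h⟩ := Metric.uniformContinuous_iff.1 (hc.uniformContinuous_of_continuous hf) ε hε
  filter_upwards [hφ.eventually (gt_mem_nhds hδ)] with n hn x
  exact ContDiffBump.dist_normed_convolution_le hf.aestronglyMeasurable
    fun y hy => (h (lt_trans hy hn)).le

/-- Mollifications of an integrable function converge in `L¹`. -/
theorem tendsto_lintegral_convolution_sub [CompleteSpace F] {φ : ℕ → ContDiffBump (0 : Plane)}
    (hφ1 : ∀ n, (φ n).rOut ≤ 1) (hφ : Tendsto (fun n => (φ n).rOut) atTop (𝓝 0))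
    {g : Plane → F} (hg : Integrable g) :
    Tendsto (fun n => ∫⁻ x, ‖((φ n).normed volume ⋆[ContinuousLinearMap.lsmul ℝ ℝ, volume] g) x
      - g x‖ₑ) atTop (𝓝 0) := by
  rw [ENNReal.tendsto_nhds_zero]
  intro ε hε
  obtain ⟨δ, hδ, hδε⟩ : ∃ δ : ℝ≥0∞, δ ≠ 0 ∧ δ + (δ + δ) ≤ ε := by
    refine ⟨ε / 3, (ENNReal.div_pos hε.ne' (by simp)).ne', ?_⟩
    rw [← add_assoc, ENNReal.add_thirds]
  obtain ⟨h, hhc, hh1, hh2, hh3⟩ := hg.exists_hasCompactSupport_lintegral_sub_le hδ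
  -- the supports of `h` and of its mollifications lie in a fixed compact set
  obtain ⟨R, hR⟩ := hhc.isCompact.isBounded.subset_closedBall (0 : Plane)
  set B : Set Plane := Metric.closedBall 0 (R + 1) with hB
  have hBv : volume B ≠ ⊤ := (isCompact_closedBall _ _).measure_ne_top
  obtain ⟨κ, hκ, hκB⟩ : ∃ κ : ℝ, 0 < κ ∧ ENNReal.ofReal κ * volume B ≤ δ := by
    rcases eq_or_ne δ ⊤ with rfl | hδt
    · exact ⟨1, one_pos, le_top⟩
    have hv : volume B + 1 ≠ ⊤ := by simp [hBv]
    refine ⟨(δ / (volume B + 1)).toReal, ENNReal.toReal_pos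
      (ENNReal.div_pos hδ hv).ne' (ENNReal.div_lt_top hδt (by simp)).ne, ?_⟩
    rw [ENNReal.ofReal_toReal (ENNReal.div_lt_top hδt (by simp)).ne]
    calc δ / (volume B + 1) * volume B ≤ δ / (volume B + 1) * (volume B + 1) := by
          gcongr; exact le_self_add
      _ = δ := ENNReal.div_mul_cancel (by simp) hv
  filter_upwards [exists_forall_dist_convolution_le hφ hh2 hhc hκ] with n hn
  set ψ := (φ n).normed volume with hψ
  have cψ : Continuous ψ := (φ n).continuous_normed
  have e0 : ∀ x, x ∉ B → (ψ ⋆[ContinuousLinearMap.lsmul ℝ ℝ, volume] h) x = h x := by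
    intro x hx
    rw [hB, Metric.mem_closedBall, dist_zero_right, not_le] at hx
    refine ContDiffBump.normed_convolution_eq_right fun y hy => ?_
    have hz : ∀ z : Plane, R < ‖z‖ → h z = 0 := fun z hz => by
      by_contra h0
      have := hR (subset_tsupport _ h0)
      rw [Metric.mem_closedBall, dist_zero_right] at this
      linarith
    rw [hz x (by linarith), hz y]
    rw [Metric.mem_ball, dist_eq_norm] at hy
    have := norm_sub_norm_le x y
    rw [norm_sub_rev] at this
    linarith [hφ1 n]
  have m1 : ∫⁻ x, ‖(ψ ⋆[ContinuousLinearMap.lsmul ℝ ℝ, volume] h) x - h x‖ₑ ≤ δ := by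
    calc ∫⁻ x, ‖(ψ ⋆[ContinuousLinearMap.lsmul ℝ ℝ, volume] h) x - h x‖ₑ
        ≤ ∫⁻ x, B.indicator (fun _ => ENNReal.ofReal κ) x := by
          refine lintegral_mono fun x => ?_
          by_cases hx : x ∈ B
          · rw [indicator_of_mem hx, ← ofReal_norm, ← dist_eq_norm]
            exact ENNReal.ofReal_le_ofReal (hn x)
          · simp [e0 x hx]
      _ = ENNReal.ofReal κ * volume B := lintegral_indicator_const
          Metric.isClosed_closedBall.measurableSet _
      _ ≤ δ := hκB
  have hgi := hg.sub hh3
  have conv_sub : ∀ x, (ψ ⋆[ContinuousLinearMap.lsmul ℝ ℝ, volume] g) x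
      = (ψ ⋆[ContinuousLinearMap.lsmul ℝ ℝ, volume] h) x
        + (ψ ⋆[ContinuousLinearMap.lsmul ℝ ℝ, volume] (g - h)) x := fun x => by
    have ex : ∀ k : Plane → F, Integrable k →
        ConvolutionExistsAt ψ k x (ContinuousLinearMap.lsmul ℝ ℝ) volume := fun k hk =>
      (φ n).hasCompactSupport_normed.convolutionExists_left _ cψ hk.locallyIntegrable x
    rw [← (ex h hh3).distrib_add (ex _ hgi), add_sub_cancel]
  have m2 := lintegral_enorm_convolution_le cψ (fun x => (φ n).nonneg_normed x)
    (φ n).integral_normed (φ n).hasCompactSupport_normed hgi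
  calc ∫⁻ x, ‖(ψ ⋆[ContinuousLinearMap.lsmul ℝ ℝ, volume] g) x - g x‖ₑ
      ≤ ∫⁻ x, (‖(ψ ⋆[ContinuousLinearMap.lsmul ℝ ℝ, volume] h) x - h x‖ₑ
        + (‖(ψ ⋆[ContinuousLinearMap.lsmul ℝ ℝ, volume] (g - h)) x‖ₑ + ‖g x - h x‖ₑ)) := by
        refine lintegral_mono fun x => ?_
        have : (ψ ⋆[ContinuousLinearMap.lsmul ℝ ℝ, volume] g) x - g x
            = ((ψ ⋆[ContinuousLinearMap.lsmul ℝ ℝ, volume] h) x - h x)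
              + ((ψ ⋆[ContinuousLinearMap.lsmul ℝ ℝ, volume] (g - h)) x - (g x - h x)) := by
          rw [conv_sub]; abel
        rw [this]
        exact (enorm_add_le _ _).trans (add_le_add le_rfl enorm_sub_le)
    _ = _ + (_ + _) := by
        have c1 : Continuous (ψ ⋆[ContinuousLinearMap.lsmul ℝ ℝ, volume] h) :=
          (φ n).hasCompactSupport_normed.continuous_convolution_left _ cψ hh3.locallyIntegrable
        have c2 : Continuous (ψ ⋆[ContinuousLinearMap.lsmul ℝ ℝ, volume] (g - h)) :=
          (φ n).hasCompactSupport_normed.continuous_convolution_left _ cψ hgi.locallyIntegrable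
        have a1 := (c1.sub hh2).aestronglyMeasurable (μ := volume).enorm
        have a2 := c2.aestronglyMeasurable (μ := volume).enorm
        simp only [Pi.sub_apply] at a1
        rw [lintegral_add_left' a1, lintegral_add_left' a2]
    _ ≤ δ + (δ + δ) := add_le_add m1 (add_le_add (m2.trans hh1) hh1)
    _ ≤ ε := hδε

/-- A compactly supported mollifier turns a weak derivative into a classical one. -/
theorem fderiv_convolution_of_isWeakPartial [CompleteSpace F] {ψ : Plane → ℝ}
    (hψ : ContDiff ℝ ∞ ψ) (hc : HasCompactSupport ψ) (h : IsWeakPartial univ j f g) (x : Plane) :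
    fderiv ℝ (ψ ⋆[ContinuousLinearMap.lsmul ℝ ℝ, volume] f) x (e j)
      = (ψ ⋆[ContinuousLinearMap.lsmul ℝ ℝ, volume] g) x := by
  have lf : LocallyIntegrable f := locallyIntegrableOn_univ.1 h.1
  have h1 := hc.hasFDerivAt_convolution_left (ContinuousLinearMap.lsmul ℝ ℝ) (hψ.of_le (by simp)) lf x
  rw [h1.fderiv, convolution_eq_swap, convolution_eq_swap,
    ContinuousLinearMap.integral_apply]
  · have key := h.2.2 (fun y => ψ (x - y)) (hψ.comp (contDiff_const.sub contDiff_id))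
      (hc.comp_homeomorph (Homeomorph.subLeft x)) (subset_univ _)
    have hd : ∀ y, fderiv ℝ (fun y => ψ (x - y)) y (e j) = - fderiv ℝ ψ (x - y) (e j) := fun y => by
      have h2 : HasFDerivAt (fun y => ψ (x - y)) ((fderiv ℝ ψ (x - y)).comp
          (-ContinuousLinearMap.id ℝ Plane)) y :=
        ((hψ.differentiable (by simp)) (x - y)).hasFDerivAt.comp y ((hasFDerivAt_id y).const_sub x)
      rw [h2.fderiv]; simp
    simp only [hd, neg_smul, integral_neg, neg_inj] at key
    simpa [ContinuousLinearMap.precompL_apply] using key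
  · have := (hc.fderiv ℝ).convolutionExists_left
      ((ContinuousLinearMap.lsmul ℝ ℝ : ℝ →L[ℝ] F →L[ℝ] F).precompL Plane)
      (hψ.continuous_fderiv (by simp)) lf x
    exact this.integrable_swap

/-- A continuous function with weak derivatives is, near a compact set, the uniform limit of
smooth functions whose derivatives converge in `L¹` to the weak derivatives. -/
theorem exists_smooth_approx [CompleteSpace F] (hU : IsOpen U) (hf : ContinuousOn f U)
    {K : Set Plane} (hK : IsCompact K) (hKU : K ⊆ U) :
    ∃ fn : ℕ → Plane → F, (∀ n, ContDiff ℝ ∞ (fn n)) ∧ TendstoUniformlyOn fn f atTop K ∧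
      ∀ j g, IsWeakPartial U j f g →
        Tendsto (fun n => ∫⁻ x in K, ‖fderiv ℝ (fn n) x (e j) - g x‖ₑ) atTop (𝓝 0) := by
  obtain ⟨χ, hχ, hχc, hχU, hχ1⟩ := exists_cutoff hK hU hKU
  obtain ⟨φ, hφ1, hφ⟩ := exists_bump_seq
  set f' : Plane → F := fun x => χ x • f x with hf'
  have cf' : Continuous f' := by
    rw [continuous_iff_continuousAt]
    intro x
    by_cases hx : x ∈ tsupport χ
    · exact hχ.continuous.continuousAt.smul (hf.continuousAt (hU.mem_nhds (hχU hx)))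
    · have : f' =ᶠ[𝓝 x] fun _ => 0 := by
        filter_upwards [(isClosed_tsupport χ).isOpen_compl.mem_nhds hx] with y hy
        simp [hf', image_eq_zero_of_notMem_tsupport hy]
      exact this.continuousAt
  have sf' : HasCompactSupport f' := hχc.smul_right
  refine ⟨fun n => (φ n).normed volume ⋆[ContinuousLinearMap.lsmul ℝ ℝ, volume] f', fun n => ?_, ?_,
    fun j g hg => ?_⟩
  · exact (φ n).hasCompactSupport_normed.contDiff_convolution_left _ (φ n).contDiff_normed
      cf'.locallyIntegrable
  · rw [Metric.tendstoUniformlyOn_iff]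
    intro ε hε
    filter_upwards [exists_forall_dist_convolution_le hφ cf' sf' (half_pos hε)] with n hn x hx
    have : f' x = f x := by simp [hf', (hχ1 x hx).eq_of_nhds]
    rw [← this, dist_comm]
    exact (hn x).trans_lt (half_lt_self hε)
  · have hw := hg.cutoff hχ hχc hχU
    have i2 := integrable_smul_of_locallyIntegrableOn hg.2.1 hχ.continuous hχc hχU
    have i3 := integrable_smul_of_locallyIntegrableOn hg.1 (continuous_pd hχ (e j))
      (hasCompactSupport_pd hχc (e j)) ((tsupport_pd_subset (e j)).trans hχU)
    refine tendsto_of_tendsto_of_tendsto_of_le_of_le tendsto_const_nhds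
      (tendsto_lintegral_convolution_sub hφ1 hφ (i2.add i3)) (fun _ => bot_le) fun n => ?_
    refine le_trans ?_ (setLIntegral_le_lintegral K _)
    refine setLIntegral_mono_ae' hK.measurableSet (Eventually.of_forall fun x hx => ?_)
    rw [fderiv_convolution_of_isWeakPartial (φ n).contDiff_normed (φ n).hasCompactSupport_normed hw]
    have e1 : χ x = 1 := (hχ1 x hx).eq_of_nhds
    have e2 : fderiv ℝ χ x = 0 := by rw [(hχ1 x hx).fderiv_eq]; simp
    apply le_of_eq
    congr 2
    simp [e1, e2]

end WeakCalculus


/-! ### Chain rules for weak derivatives -/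

section ChainRule

set_option linter.unusedSectionVars false

variable {F : Type*} [NormedAddCommGroup F] [NormedSpace ℝ F]
variable {F' : Type*} [NormedAddCommGroup F'] [NormedSpace ℝ F']
variable {U W : Set Plane} {j : Fin 2} {f g : Plane → F}

theorem tendsto_integral_smul_of_lintegral {K : Set Plane} {fn : ℕ → Plane → F}
    (hfn : ∀ n, LocallyIntegrableOn (fn n) U) (hf : LocallyIntegrableOn f U)
    {a : Plane → ℝ} (ha : Continuous a) (hc : HasCompactSupport a) (hs : tsupport a ⊆ U)
    (hK : tsupport a ⊆ K)
    (h : Tendsto (fun n => ∫⁻ x in K, ‖fn n x - f x‖ₑ) atTop (𝓝 0)) :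
    Tendsto (fun n => ∫ x, a x • fn n x) atTop (𝓝 (∫ x, a x • f x)) := by
  obtain ⟨M, hM⟩ := ha.bounded_above_of_compact_support hc
  refine tendsto_integral_of_L1 _ (integrable_smul_of_locallyIntegrableOn hf ha hc hs).aestronglyMeasurable
    (Eventually.of_forall fun n => integrable_smul_of_locallyIntegrableOn (hfn n) ha hc hs) ?_
  have h' : Tendsto (fun n => ENNReal.ofReal M * ∫⁻ x in K, ‖fn n x - f x‖ₑ) atTop (𝓝 0) := by
    simpa using ENNReal.Tendsto.const_mul h (Or.inr ENNReal.ofReal_ne_top)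
  refine tendsto_of_tendsto_of_tendsto_of_le_of_le tendsto_const_nhds h' (fun _ => bot_le) fun n => ?_
  dsimp only
  rw [← lintegral_const_mul' _ _ ENNReal.ofReal_ne_top]
  have hsub : Function.support (fun x => ‖a x • fn n x - a x • f x‖ₑ) ⊆ K := fun x hx => by
    apply hK
    apply subset_tsupport
    intro h0
    exact hx (by simp [h0])
  rw [← setLIntegral_eq_of_support_subset hsub]
  refine lintegral_mono fun x => ?_
  rw [← smul_sub, enorm_smul]
  gcongr
  rw [← ofReal_norm]
  exact ENNReal.ofReal_le_ofReal (hM x)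

/-- Weak derivatives are stable under convergence in `L¹_loc`. -/
theorem IsWeakPartial.of_approx (hf : LocallyIntegrableOn f U) (hg : LocallyIntegrableOn g U)
    (h : ∀ K ⊆ U, IsCompact K → ∃ fn gn : ℕ → Plane → F, (∀ n, IsWeakPartial U j (fn n) (gn n)) ∧
      Tendsto (fun n => ∫⁻ x in K, ‖fn n x - f x‖ₑ) atTop (𝓝 0) ∧
      Tendsto (fun n => ∫⁻ x in K, ‖gn n x - g x‖ₑ) atTop (𝓝 0)) :
    IsWeakPartial U j f g := by
  refine ⟨hf, hg, fun η h1 h2 h3 => ?_⟩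
  obtain ⟨fn, gn, hw, lf, lg⟩ := h (tsupport η) h3 h2
  have t1 := tendsto_integral_smul_of_lintegral (fun n => (hw n).1) hf (continuous_pd h1 (e j))
    (hasCompactSupport_pd h2 (e j)) ((tsupport_pd_subset (e j)).trans h3) (tsupport_pd_subset (e j)) lf
  have t2 := tendsto_integral_smul_of_lintegral (fun n => (hw n).2.1) hg h1.continuous h2 h3
    subset_rfl lg
  refine tendsto_nhds_unique t1 ?_
  simp only [fun n => (hw n).2.2 η h1 h2 h3]
  exact t2.neg

theorem tendsto_setLIntegral_of_tendstoUniformlyOn {K : Set Plane} (hK : IsCompact K)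
    {fn : ℕ → Plane → F} (h : TendstoUniformlyOn fn f atTop K) :
    Tendsto (fun n => ∫⁻ x in K, ‖fn n x - f x‖ₑ) atTop (𝓝 0) := by
  have hv : volume K ≠ ⊤ := hK.measure_ne_top
  rw [ENNReal.tendsto_nhds_zero]
  intro ε hε
  obtain ⟨κ, hκ, hκε⟩ : ∃ κ : ℝ, 0 < κ ∧ ENNReal.ofReal κ * volume K ≤ ε := by
    have ht : Tendsto (fun κ : ℝ => ENNReal.ofReal κ * volume K) (𝓝[>] 0) (𝓝 0) := by
      have : Tendsto (fun κ : ℝ => ENNReal.ofReal κ * volume K) (𝓝 0)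
          (𝓝 (ENNReal.ofReal 0 * volume K)) :=
        ENNReal.Tendsto.mul_const (ENNReal.tendsto_ofReal tendsto_id) (Or.inr hv)
      simp only [ENNReal.ofReal_zero, zero_mul] at this
      exact this.mono_left nhdsWithin_le_nhds
    have := (ht.eventually (ge_mem_nhds hε)).and self_mem_nhdsWithin
    obtain ⟨κ, h1, h2⟩ := this.exists
    exact ⟨κ, h2, h1⟩
  filter_upwards [Metric.tendstoUniformlyOn_iff.1 h κ hκ] with n hn
  calc ∫⁻ x in K, ‖fn n x - f x‖ₑ ≤ ∫⁻ x in K, ENNReal.ofReal κ := by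
        refine setLIntegral_mono_ae' hK.measurableSet (Eventually.of_forall fun x hx => ?_)
        rw [← ofReal_norm, ← dist_eq_norm, dist_comm]
        exact ENNReal.ofReal_le_ofReal (hn x hx).le
    _ ≤ ε := by rwa [setLIntegral_const]

theorem tendstoUniformlyOn_comp_of_continuous {X Y Z : Type*} [TopologicalSpace X]
    [PseudoMetricSpace Y] [PseudoMetricSpace Z] {K : Set X} (hK : IsCompact K) {fn : ℕ → X → Y}
    {f : X → Y} (hf : ContinuousOn f K)
    (h : TendstoUniformlyOn fn f atTop K) {Φ : Y → Z} (hΦ : Continuous Φ) :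
    TendstoUniformlyOn (fun n => Φ ∘ fn n) (Φ ∘ f) atTop K := by
  rw [Metric.tendstoUniformlyOn_iff] at h ⊢
  intro ε hε
  have h1 := (hK.image_of_continuousOn hf).uniformContinuousAt_of_continuousAt Φ
    (fun a _ => hΦ.continuousAt) (Metric.dist_mem_uniformity hε)
  obtain ⟨δ, hδ, hδ'⟩ := Metric.mem_uniformity_dist.1 h1
  filter_upwards [h δ hδ] with n hn x hx
  exact hδ' (hn x hx) (mem_image_of_mem f hx)

theorem locallyIntegrableOn_clm_apply (hU : IsOpen U) {L : Plane → F →L[ℝ] F'}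
    (hL : ContinuousOn L U) (hg : LocallyIntegrableOn g U) :
    LocallyIntegrableOn (fun x => L x (g x)) U := by
  rw [locallyIntegrableOn_iff hU.isLocallyClosed] at hg ⊢
  intro K hKU hK
  have hi := hg K hKU hK
  obtain ⟨M, hM⟩ := hK.exists_bound_of_continuousOn (hL.mono hKU)
  refine Integrable.mono' (hi.norm.const_mul M) ?_ ?_
  · exact (isBoundedBilinearMap_apply).continuous.comp_aestronglyMeasurable
      (((hL.mono hKU).aestronglyMeasurable hK.measurableSet).prodMk hi.aestronglyMeasurable)
  · refine (ae_restrict_iff' hK.measurableSet).2 (Eventually.of_forall fun x hx => ?_)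
    exact (L x).le_of_opNorm_le (hM x hx) _

/-- Chain rule for a smooth function of a continuous weakly differentiable map. -/
theorem IsWeakPartial.comp_left [CompleteSpace F] (hU : IsOpen U) (hf : ContinuousOn f U)
    (h : IsWeakPartial U j f g) {Φ : F → F'} (hΦ : ContDiff ℝ 1 Φ) :
    IsWeakPartial U j (fun x => Φ (f x)) (fun x => fderiv ℝ Φ (f x) (g x)) := by
  have cdΦ : Continuous (fderiv ℝ Φ) := hΦ.continuous_fderiv (by simp)
  refine IsWeakPartial.of_approx
    ((hΦ.continuous.comp_continuousOn hf).locallyIntegrableOn hU.measurableSet)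
    (locallyIntegrableOn_clm_apply hU (cdΦ.comp_continuousOn hf) h.2.1) fun K hKU hK => ?_
  obtain ⟨fn, hfn, hun, hder⟩ := exists_smooth_approx hU hf hK hKU
  have hfK := hf.mono hKU
  refine ⟨fun n x => Φ (fn n x), fun n x => fderiv ℝ Φ (fn n x) (fderiv ℝ (fn n) x (e j)),
    fun n => ?_, tendsto_setLIntegral_of_tendstoUniformlyOn hK
      (tendstoUniformlyOn_comp_of_continuous hK hfK hun hΦ.continuous), ?_⟩
  · have h1 : ContDiff ℝ 1 (fun x => Φ (fn n x)) := hΦ.comp ((hfn n).of_le (by simp))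
    convert isWeakPartial_of_contDiffOn hU h1.contDiffOn j using 2 with x
    have := ((hΦ.differentiable (by simp)) (fn n x)).hasFDerivAt.comp x
      (((hfn n).differentiable (by simp)) x).hasFDerivAt
    rw [show (fun x => Φ (fn n x)) = Φ ∘ fn n from rfl, this.fderiv]
    rfl
  · -- split `DΦ(fₙ) ∂fₙ - DΦ(f) g` as `DΦ(fₙ) (∂fₙ - g) + (DΦ(fₙ) - DΦ(f)) g`
    have hunD := tendstoUniformlyOn_comp_of_continuous hK hfK hun cdΦ
    obtain ⟨M, hM⟩ := hK.exists_bound_of_continuousOn (cdΦ.comp_continuousOn hfK)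
    have hgK : IntegrableOn g K := h.2.1.integrableOn_compact_subset hKU hK
    set I := ∫⁻ x in K, ‖g x‖ₑ with hI
    have hIt : I ≠ ⊤ := hgK.2.ne
    have lim1 : Tendsto (fun n => ENNReal.ofReal (M + 1) *
        ∫⁻ x in K, ‖fderiv ℝ (fn n) x (e j) - g x‖ₑ) atTop (𝓝 0) := by
      simpa using ENNReal.Tendsto.const_mul (hder j g h) (Or.inr ENNReal.ofReal_ne_top)
    rw [ENNReal.tendsto_nhds_zero] at lim1 ⊢
    intro ε hε
    have hε2 : 0 < ε / 2 := ENNReal.half_pos hε.ne'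
    obtain ⟨κ, hκ, hκ1, hκε⟩ : ∃ κ : ℝ, 0 < κ ∧ κ ≤ 1 ∧ ENNReal.ofReal κ * I ≤ ε / 2 := by
      have ht : Tendsto (fun κ : ℝ => ENNReal.ofReal κ * I) (𝓝[>] 0) (𝓝 0) := by
        have : Tendsto (fun κ : ℝ => ENNReal.ofReal κ * I) (𝓝 0)
            (𝓝 (ENNReal.ofReal 0 * I)) :=
          ENNReal.Tendsto.mul_const (ENNReal.tendsto_ofReal tendsto_id) (Or.inr hIt)
        simp only [ENNReal.ofReal_zero, zero_mul] at this
        exact this.mono_left nhdsWithin_le_nhds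
      have := ((ht.eventually (ge_mem_nhds hε2)).and self_mem_nhdsWithin).and
        (nhdsWithin_le_nhds (ge_mem_nhds (zero_lt_one (α := ℝ))))
      obtain ⟨κ, ⟨h1, h2⟩, h3⟩ := this.exists
      exact ⟨κ, h2, h3, h1⟩
    filter_upwards [lim1 (ε / 2) hε2, Metric.tendstoUniformlyOn_iff.1 hunD κ hκ] with n hn1 hn2
    have cd1 : Continuous (fun x => fderiv ℝ (fn n) x (e j)) :=
      ((hfn n).continuous_fderiv (by simp)).clm_apply continuous_const
    calc ∫⁻ x in K, ‖fderiv ℝ Φ (fn n x) (fderiv ℝ (fn n) x (e j)) - fderiv ℝ Φ (f x) (g x)‖ₑ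
        ≤ ∫⁻ x in K, (ENNReal.ofReal (M + 1) * ‖fderiv ℝ (fn n) x (e j) - g x‖ₑ
            + ENNReal.ofReal κ * ‖g x‖ₑ) := by
          refine setLIntegral_mono_ae' hK.measurableSet (Eventually.of_forall fun x hx => ?_)
          have d := hn2 x hx
          simp only [Function.comp_apply] at d
          rw [dist_comm, dist_eq_norm] at d
          have hM' : ‖fderiv ℝ Φ (f x)‖ ≤ M := hM x hx
          have b : ‖fderiv ℝ Φ (fn n x)‖ ≤ M + 1 := by
            have := norm_le_norm_add_norm_sub' (fderiv ℝ Φ (fn n x)) (fderiv ℝ Φ (f x))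
            linarith
          have e1 : fderiv ℝ Φ (fn n x) (fderiv ℝ (fn n) x (e j)) - fderiv ℝ Φ (f x) (g x)
              = fderiv ℝ Φ (fn n x) (fderiv ℝ (fn n) x (e j) - g x)
                + (fderiv ℝ Φ (fn n x) - fderiv ℝ Φ (f x)) (g x) := by
            rw [map_sub, sub_apply]; abel
          rw [e1]
          refine (enorm_add_le _ _).trans (add_le_add ?_ ?_)
          · rw [← ofReal_norm, ← ofReal_norm, ← ENNReal.ofReal_mul (by linarith [norm_nonneg (fderiv ℝ Φ (fn n x))])]
            exact ENNReal.ofReal_le_ofReal (ContinuousLinearMap.le_of_opNorm_le _ b _)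
          · rw [← ofReal_norm, ← ofReal_norm, ← ENNReal.ofReal_mul hκ.le]
            exact ENNReal.ofReal_le_ofReal (ContinuousLinearMap.le_of_opNorm_le _ d.le _)
      _ = ENNReal.ofReal (M + 1) * (∫⁻ x in K, ‖fderiv ℝ (fn n) x (e j) - g x‖ₑ)
            + ENNReal.ofReal κ * I := by
          rw [lintegral_add_right' _ (hgK.aestronglyMeasurable.enorm.const_mul _),
            lintegral_const_mul' _ _ ENNReal.ofReal_ne_top,
            lintegral_const_mul' _ _ ENNReal.ofReal_ne_top]
      _ ≤ ε / 2 + ε / 2 := add_le_add hn1 hκε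
      _ = ε := ENNReal.add_halves ε

theorem IsWeakPartial.prodMk [CompleteSpace F] [CompleteSpace F'] (h : IsWeakPartial U j f g)
    {f' g' : Plane → F'} (h' : IsWeakPartial U j f' g') :
    IsWeakPartial U j (fun x => (f x, f' x)) (fun x => (g x, g' x)) := by
  have li : ∀ {a : Plane → F} {b : Plane → F'}, LocallyIntegrableOn a U →
      LocallyIntegrableOn b U → LocallyIntegrableOn (fun x => (a x, b x)) U := fun ha hb x hx => by
    obtain ⟨s, hs, hsi⟩ := ha x hx
    obtain ⟨t, ht, hti⟩ := hb x hx
    exact ⟨s ∩ t, inter_mem hs ht, (hsi.mono_set inter_subset_left).prodMk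
      (hti.mono_set inter_subset_right)⟩
  refine ⟨li h.1 h'.1, li h.2.1 h'.2.1, fun η h1 h2 h3 => ?_⟩
  have i1 := integrable_smul_of_locallyIntegrableOn h.1 (continuous_pd h1 (e j))
    (hasCompactSupport_pd h2 (e j)) ((tsupport_pd_subset (e j)).trans h3)
  have i2 := integrable_smul_of_locallyIntegrableOn h'.1 (continuous_pd h1 (e j))
    (hasCompactSupport_pd h2 (e j)) ((tsupport_pd_subset (e j)).trans h3)
  have i3 := integrable_smul_of_locallyIntegrableOn h.2.1 h1.continuous h2 h3
  have i4 := integrable_smul_of_locallyIntegrableOn h'.2.1 h1.continuous h2 h3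
  simp only [Prod.smul_mk]
  rw [integral_pair i1 i2, integral_pair i3 i4, h.2.2 η h1 h2 h3, h'.2.2 η h1 h2 h3]
  rfl

/-- Leibniz rule for a bilinear expression in two continuous weakly differentiable maps. -/
theorem IsWeakPartial.bilin {F'' : Type*} [NormedAddCommGroup F''] [NormedSpace ℝ F'']
    [CompleteSpace F] [CompleteSpace F'] (hU : IsOpen U) (B : F →L[ℝ] F' →L[ℝ] F'')
    (hf : ContinuousOn f U) (h : IsWeakPartial U j f g)
    {f' g' : Plane → F'} (hf' : ContinuousOn f' U) (h' : IsWeakPartial U j f' g') :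
    IsWeakPartial U j (fun x => B (f x) (f' x)) (fun x => B (f x) (g' x) + B (g x) (f' x)) := by
  have := (h.prodMk h').comp_left hU (hf.prodMk hf') (Φ := fun z : F × F' => B z.1 z.2)
    B.isBoundedBilinearMap.contDiff
  convert this using 2 with x
  rw [(B.isBoundedBilinearMap.hasFDerivAt (f x, f' x)).fderiv]
  simp

theorem plane_eq_sum (v : Plane) : v = ∑ l, v l • e l := by
  ext i
  fin_cases i <;> simp [e]

/-- Chain rule for the composition of a continuous weakly differentiable map with a `C¹`
diffeomorphism of plane domains. -/
theorem isWeakPartial_comp_right [CompleteSpace F] (hU : IsOpen U) (hW : IsOpen W)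
    (hf : ContinuousOn f U) {g : Fin 2 → Plane → F} (h : ∀ l, IsWeakPartial U l f (g l))
    {τ : Plane → Plane} (hτ : ContDiffOn ℝ 1 τ W) (hmaps : MapsTo τ W U) (hinj : InjOn τ W)
    (hdet : ∀ y ∈ W, (fderiv ℝ τ y).det ≠ 0) (j : Fin 2) :
    IsWeakPartial W j (fun y => f (τ y)) (fun y => ∑ l, (fderiv ℝ τ y (e j)) l • g l (τ y)) := by
  have cD : ContinuousOn (fderiv ℝ τ) W := hτ.continuousOn_fderiv_of_isOpen hW le_rfl
  have cdet : ContinuousOn (fun y => |(fderiv ℝ τ y).det|) W :=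
    (ContinuousLinearMap.continuous_det.comp_continuousOn cD).abs
  have hd : ∀ y ∈ W, HasFDerivAt τ (fderiv ℝ τ y) y := fun y hy =>
    ((hτ.contDiffAt (hW.mem_nhds hy)).differentiableAt (by simp)).hasFDerivAt
  have cl : ∀ l, ContinuousOn (fun y => (fderiv ℝ τ y (e j)) l) W := fun l =>
    (EuclideanSpace.proj (𝕜 := ℝ) l).continuous.comp_continuousOn (cD.clm_apply continuousOn_const)
  have ligτ : ∀ l, LocallyIntegrableOn (fun y => g l (τ y)) W := by
    intro l
    rw [locallyIntegrableOn_iff hW.isLocallyClosed]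
    intro K hKW hK
    have i1 : IntegrableOn (g l) (τ '' K) := (h l).2.1.integrableOn_compact_subset
      ((hmaps.mono_left hKW).image_subset) (hK.image_of_continuousOn (hτ.continuousOn.mono hKW))
    have i2 := (integrableOn_image_iff_integrableOn_abs_det_fderiv_smul volume hK.measurableSet
      (fun y hy => (hd y (hKW hy)).hasFDerivWithinAt) (hinj.mono hKW) (g l)).1 i1
    have i3 := i2.continuousOn_smul
      ((cdet.mono hKW).inv₀ fun y hy => abs_ne_zero.2 (hdet y (hKW hy))) hK
    refine i3.congr_fun (fun y hy => ?_) hK.measurableSet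
    simp only [Pi.inv_apply]
    rw [smul_smul, inv_mul_cancel₀ (abs_ne_zero.2 (hdet y (hKW hy))), one_smul]
  have lisum : LocallyIntegrableOn (fun y => ∑ l, (fderiv ℝ τ y (e j)) l • g l (τ y)) W := by
    simp only [Fin.sum_univ_two]
    exact ((ligτ 0).continuousOn_smul hW.isLocallyClosed (cl 0)).add
      ((ligτ 1).continuousOn_smul hW.isLocallyClosed (cl 1))
  refine IsWeakPartial.of_approx ((hf.comp hτ.continuousOn hmaps).locallyIntegrableOn
    hW.measurableSet) lisum fun K hKW hK => ?_
  have hτK : IsCompact (τ '' K) := hK.image_of_continuousOn (hτ.continuousOn.mono hKW)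
  obtain ⟨fn, hfn, hun, hder⟩ := exists_smooth_approx hU hf hτK (hmaps.mono_left hKW).image_subset
  refine ⟨fun n y => fn n (τ y), fun n y => ∑ l, (fderiv ℝ τ y (e j)) l • fderiv ℝ (fn n) (τ y) (e l),
    fun n => ?_, tendsto_setLIntegral_of_tendstoUniformlyOn hK ?_, ?_⟩
  · have h1 : ContDiffOn ℝ 1 (fun y => fn n (τ y)) W :=
      ((hfn n).of_le (by simp)).comp_contDiffOn hτ
    have h2 := isWeakPartial_of_contDiffOn hW h1 j
    refine h2.congr_right hW ((ae_restrict_iff' hW.measurableSet).2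
      (Eventually.of_forall fun y hy => ?_))
    have := (((hfn n).differentiable (by simp)) (τ y)).hasFDerivAt.comp y (hd y hy)
    rw [show (fun y => fn n (τ y)) = fn n ∘ τ from rfl]
    dsimp only
    rw [this.fderiv, ContinuousLinearMap.comp_apply]
    conv_lhs => rw [plane_eq_sum (fderiv ℝ τ y (e j))]
    simp
  · rw [Metric.tendstoUniformlyOn_iff] at hun ⊢
    intro ε hε
    filter_upwards [hun ε hε] with n hn y hy using hn (τ y) (mem_image_of_mem τ hy)
  · -- bound everything by the integrals over `τ '' K`
    obtain ⟨M, hM⟩ := hK.exists_bound_of_continuousOn (cD.mono hKW)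
    obtain ⟨M', hM'⟩ := hK.exists_bound_of_continuousOn
      (((cdet.mono hKW).inv₀ fun y hy => abs_ne_zero.2 (hdet y (hKW hy))))
    have hlim : Tendsto (fun n => ∑ l, ENNReal.ofReal (M * M') *
        ∫⁻ x in τ '' K, ‖fderiv ℝ (fn n) x (e l) - g l x‖ₑ) atTop (𝓝 0) := by
      have : Tendsto (fun n => ∑ l, ENNReal.ofReal (M * M') *
        ∫⁻ x in τ '' K, ‖fderiv ℝ (fn n) x (e l) - g l x‖ₑ) atTop
          (𝓝 (∑ l : Fin 2, ENNReal.ofReal (M * M') * 0)) :=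
        tendsto_finsetSum _ fun l _ => ENNReal.Tendsto.const_mul (hder l (g l) (h l))
          (Or.inr ENNReal.ofReal_ne_top)
      simpa using this
    refine tendsto_of_tendsto_of_tendsto_of_le_of_le tendsto_const_nhds hlim (fun _ => bot_le)
      fun n => ?_
    have pt : ∀ y ∈ K, ‖(∑ l, (fderiv ℝ τ y (e j)) l • fderiv ℝ (fn n) (τ y) (e l))
        - ∑ l, (fderiv ℝ τ y (e j)) l • g l (τ y)‖ₑ ≤ ∑ l, ENNReal.ofReal (M * M') *
          (ENNReal.ofReal |(fderiv ℝ τ y).det| * ‖fderiv ℝ (fn n) (τ y) (e l) - g l (τ y)‖ₑ) := by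
      intro y hy
      rw [← Finset.sum_sub_distrib]
      refine (enorm_sum_le _ _).trans (Finset.sum_le_sum fun l _ => ?_)
      rw [← smul_sub, enorm_smul, ← mul_assoc]
      gcongr
      have hM0 : 0 ≤ M := (norm_nonneg _).trans (hM y hy)
      have hM0' : 0 ≤ M' := (norm_nonneg _).trans (hM' y hy)
      rw [← ENNReal.ofReal_mul (by positivity), ← ofReal_norm]
      apply ENNReal.ofReal_le_ofReal
      have a1 : ‖(fderiv ℝ τ y (e j)) l‖ ≤ M := by
        refine (PiLp.norm_apply_le _ l).trans ?_
        refine (ContinuousLinearMap.le_of_opNorm_le _ (hM y hy) _).trans ?_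
        simp [e]
      have a2 : 1 ≤ M' * |(fderiv ℝ τ y).det| := by
        have h0 : 0 < |(fderiv ℝ τ y).det| := abs_pos.2 (hdet y (hKW hy))
        have := hM' y hy
        rw [Pi.inv_apply, Real.norm_of_nonneg (inv_nonneg.2 h0.le)] at this
        rwa [inv_le_iff_one_le_mul₀ h0] at this
      calc ‖(fderiv ℝ τ y (e j)) l‖ ≤ M * 1 := by rwa [mul_one]
        _ ≤ M * (M' * |(fderiv ℝ τ y).det|) := by gcongr
        _ = _ := by ring
    calc _ ≤ ∫⁻ y in K, ∑ l, ENNReal.ofReal (M * M') *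
          (ENNReal.ofReal |(fderiv ℝ τ y).det| * ‖fderiv ℝ (fn n) (τ y) (e l) - g l (τ y)‖ₑ) :=
        setLIntegral_mono_ae' hK.measurableSet (Eventually.of_forall pt)
      _ = ∑ l, ENNReal.ofReal (M * M') * ∫⁻ y in K,
          (ENNReal.ofReal |(fderiv ℝ τ y).det| * ‖fderiv ℝ (fn n) (τ y) (e l) - g l (τ y)‖ₑ) := by
        rw [lintegral_finsetSum']
        · simp only [lintegral_const_mul' _ _ ENNReal.ofReal_ne_top]
        · intro l _
          refine AEMeasurable.const_mul (f := fun y => _ * _) (AEMeasurable.fun_mul ?_ ?_) _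
          · exact ((cdet.mono hKW).aemeasurable hK.measurableSet).ennreal_ofReal
          · have m1 : ContinuousOn (fun y => fderiv ℝ (fn n) (τ y) (e l)) K :=
              (((hfn n).continuous_fderiv (by simp)).clm_apply
                continuous_const).comp_continuousOn (hτ.continuousOn.mono hKW)
            exact ((m1.aestronglyMeasurable hK.measurableSet).sub
              ((ligτ l).integrableOn_compact_subset hKW hK).aestronglyMeasurable).enorm
      _ = _ := by
        refine Finset.sum_congr rfl fun l _ => ?_
        rw [lintegral_image_eq_lintegral_abs_det_fderiv_mul volume hK.measurableSet
          (fun y hy => (hd y (hKW hy)).hasFDerivWithinAt) (hinj.mono hKW)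
          (fun x => ‖fderiv ℝ (fn n) x (e l) - g l x‖ₑ)]

end ChainRule


/-! ### An interior Morrey inequality -/

/-- A smooth step from `0` (on `x ≤ -1`) to `1` (on `1 ≤ x`). -/
noncomputable def step (x : ℝ) : ℝ := Real.smoothTransition ((x + 1) / 2)

theorem contDiff_step : ContDiff ℝ ∞ step :=
  Real.smoothTransition.contDiff.comp ((contDiff_id.add contDiff_const).div_const 2)

theorem step_of_le {x : ℝ} (h : x ≤ -1) : step x = 0 :=
  Real.smoothTransition.zero_of_nonpos (by linarith)

theorem step_of_ge {x : ℝ} (h : 1 ≤ x) : step x = 1 :=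
  Real.smoothTransition.one_of_one_le (by linarith)

theorem contDiff_deriv_step : ContDiff ℝ ∞ (deriv step) :=
  (contDiff_infty_iff_deriv.1 contDiff_step).2

theorem deriv_step_of_lt {x : ℝ} (h : 1 < |x|) : deriv step x = 0 := by
  rcases lt_abs.1 h with h | h
  · have : step =ᶠ[𝓝 x] fun _ => 1 := by
      filter_upwards [lt_mem_nhds h] with y hy using step_of_ge hy.le
    rw [this.deriv_eq]; simp
  · have : step =ᶠ[𝓝 x] fun _ => 0 := by
      filter_upwards [gt_mem_nhds (show x < -1 by linarith)] with y hy using step_of_le hy.le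
    rw [this.deriv_eq]; simp

theorem integral_deriv_step : ∫ x, deriv step x = 1 := by
  have hc : HasCompactSupport (deriv step) :=
    HasCompactSupport.of_support_subset_isCompact (isCompact_Icc (a := (-1 : ℝ)) (b := 1))
      fun x hx => by
        by_contra h
        rw [mem_Icc, ← abs_le, not_le] at h
        exact hx (deriv_step_of_lt h)
  have h1 : Tendsto step atBot (𝓝 0) :=
    tendsto_const_nhds.congr' (by
      filter_upwards [eventually_le_atBot (-1)] with x hx using (step_of_le hx).symm)
  have h2 : Tendsto step atTop (𝓝 1) :=
    tendsto_const_nhds.congr' (by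
      filter_upwards [eventually_ge_atTop 1] with x hx using (step_of_ge hx).symm)
  have := integral_of_hasDerivAt_of_tendsto
    (fun x => ((contDiff_step.differentiable (by simp)) x).hasDerivAt)
    (contDiff_deriv_step.continuous.integrable_of_hasCompactSupport hc) h1 h2
  simpa using this

/-- A smooth averaging kernel `ψ` on the plane, of total mass one, whose rescaling by the factor
`2` differs from `ψ` by the divergence of a compactly supported smooth vector field `η`. -/
theorem exists_averaging_kernel : ∃ (ψ : Plane → ℝ) (η : Fin 2 → Plane → ℝ),
    ContDiff ℝ ∞ ψ ∧ (∀ j, ContDiff ℝ ∞ (η j)) ∧ (∀ z, 3 / 2 < ‖z‖ → ψ z = 0) ∧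
    (∀ j z, 3 / 2 < ‖z‖ → η j z = 0) ∧ ∫ z, ψ z = 1 ∧
    ∀ z, 4 * ψ ((2 : ℝ) • z) - ψ z = ∑ j, fderiv ℝ (η j) z (e j) := by
  -- `ψ = a ⊗ a` for the bump `a = step'`; the primitive `step (2x) - step x` of
  -- `2a(2x) - a(x)` has compact support because the two bumps have the same integral
  let a := deriv step
  let b : ℝ → ℝ := fun x => step (2 * x) - step x
  have ca : ContDiff ℝ ∞ a := contDiff_deriv_step
  have cb : ContDiff ℝ ∞ b :=
    (contDiff_step.comp (contDiff_const.mul contDiff_id)).sub contDiff_step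
  have hb : ∀ x, HasDerivAt b (2 * a (2 * x) - a x) x := fun x => by
    have h1 : ∀ x, HasDerivAt step (a x) x := fun x =>
      ((contDiff_step.differentiable (by simp)) x).hasDerivAt
    have h2 : HasDerivAt (fun x : ℝ => 2 * x) 2 x := by
      simpa using (hasDerivAt_id x).const_mul (2 : ℝ)
    have h3 := ((h1 (2 * x)).comp x h2).sub (h1 x)
    rw [mul_comm 2 (a (2 * x))]
    exact h3
  have p : ∀ i, ContDiff ℝ ∞ (fun z : Plane => z i) := fun i =>
    (EuclideanSpace.proj (𝕜 := ℝ) i).contDiff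
  have a0 : ∀ {x : ℝ}, 1 < |x| → a x = 0 := fun h => deriv_step_of_lt h
  have b0 : ∀ {x : ℝ}, 1 < |x| → b x = 0 := fun {x} h => by
    rcases lt_abs.1 h with h | h
    · simp [b, step_of_ge h.le, step_of_ge (show 1 ≤ 2 * x by linarith)]
    · simp [b, step_of_le (show x ≤ -1 by linarith), step_of_le (show 2 * x ≤ -1 by linarith)]
  have big : ∀ z : Plane, 3 / 2 < ‖z‖ → 1 < |z 0| ∨ 1 < |z 1| := by
    intro z hz
    by_contra! h
    have h1 : ‖z‖ ^ 2 = z 0 ^ 2 + z 1 ^ 2 := by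
      rw [EuclideanSpace.norm_sq_eq]; simp
    have h2 : z 0 ^ 2 ≤ 1 := by rw [← sq_abs]; nlinarith [h.1, abs_nonneg (z 0)]
    have h3 : z 1 ^ 2 ≤ 1 := by rw [← sq_abs]; nlinarith [h.2, abs_nonneg (z 1)]
    nlinarith
  refine ⟨fun z => a (z 0) * a (z 1), ![fun z => b (z 0) * (2 * a (2 * z 1)),
    fun z => a (z 0) * b (z 1)], (ca.comp (p 0)).mul (ca.comp (p 1)), fun j => ?_, fun z hz => ?_,
    fun j z hz => ?_, ?_, fun z => ?_⟩
  · fin_cases j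
    · exact (cb.comp (p 0)).mul (contDiff_const.mul (ca.comp (contDiff_const.mul (p 1))))
    · exact (ca.comp (p 0)).mul (cb.comp (p 1))
  · rcases big z hz with h | h <;> simp [a0 h]
  · have two : ∀ {x : ℝ}, 1 < |x| → 1 < |2 * x| := fun {x} h => by
      rw [abs_mul, abs_two]; linarith
    fin_cases j
    · rcases big z hz with h | h
      · simp [b0 h]
      · simp [a0 (two h)]
    · rcases big z hz with h | h
      · simp [a0 h]
      · simp [b0 h]
  · have h1 := (EuclideanSpace.volume_preserving_symm_measurableEquiv_toLp (Fin 2)).integral_comp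
      (MeasurableEquiv.measurableEmbedding _) (fun z : Fin 2 → ℝ => a (z 0) * a (z 1))
    have h2 := integral_fintype_prod_volume_eq_prod (ι := Fin 2) (E := fun _ => ℝ)
      (fun _ => a)
    simp only [Fin.prod_univ_two] at h2
    have h3 : ∫ x, a x = 1 := integral_deriv_step
    rw [h2, h3, mul_one] at h1
    exact h1
  · have hp : ∀ i : Fin 2, HasFDerivAt (fun z : Plane => z i)
        (EuclideanSpace.proj (𝕜 := ℝ) i : Plane →L[ℝ] ℝ) z :=
      fun i => (EuclideanSpace.proj (𝕜 := ℝ) i : Plane →L[ℝ] ℝ).hasFDerivAt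
    have ha : ∀ x, HasDerivAt a (deriv a x) x := fun x =>
      ((ca.differentiable (by simp)) x).hasDerivAt
    have f0 : HasFDerivAt (fun z : Plane => b (z 0)) ((2 * a (2 * z 0) - a (z 0)) •
      (EuclideanSpace.proj (𝕜 := ℝ) 0 : Plane →L[ℝ] ℝ)) z := by
      have := (hb (z 0)).comp_hasFDerivAt z (hp 0)
      exact this
    have f1 : HasFDerivAt (fun z : Plane => b (z 1)) ((2 * a (2 * z 1) - a (z 1)) •
      (EuclideanSpace.proj (𝕜 := ℝ) 1 : Plane →L[ℝ] ℝ)) z := by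
      have := (hb (z 1)).comp_hasFDerivAt z (hp 1)
      exact this
    have f2 : HasFDerivAt (fun z : Plane => a (z 0)) (deriv a (z 0) •
      (EuclideanSpace.proj (𝕜 := ℝ) 0 : Plane →L[ℝ] ℝ)) z := by
      have := (ha (z 0)).comp_hasFDerivAt z (hp 0)
      exact this
    have f3 : HasFDerivAt (fun z : Plane => 2 * a (2 * z 1)) ((2 : ℝ) • deriv a (2 * z 1) •
      (2 : ℝ) • (EuclideanSpace.proj (𝕜 := ℝ) 1 : Plane →L[ℝ] ℝ)) z := by
      have := ((ha (2 * z 1)).comp_hasFDerivAt z ((hp 1).const_mul 2)).const_mul 2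
      exact this
    rw [Fin.sum_univ_two]
    simp only [Matrix.cons_val_zero, Matrix.cons_val_one]
    rw [(f0.fun_mul f3).fderiv, (f2.fun_mul f1).fderiv]
    simp [e]
    ring

theorem setIntegral_norm_ball_le {F : Type*} [NormedAddCommGroup F] {D : Set Plane} {q : ℝ}
    (hq : 2 < q) {g : Plane → F} (hg : MemLp g (ENNReal.ofReal q) (volume.restrict D)) {y : Plane}
    {r : ℝ} (hr : 0 < r) (hD : Metric.ball y r ⊆ D) :
    ∫ x in Metric.ball y r, ‖g x‖ ≤ (eLpNorm g (ENNReal.ofReal q) (volume.restrict D)).toReal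
      * (r ^ 2 * (volume (Metric.ball (0 : Plane) 1)).toReal) ^ (1 - 1 / q) := by
  have hB : MemLp g (ENNReal.ofReal q) (volume.restrict (Metric.ball y r)) :=
    hg.mono_measure (Measure.restrict_mono hD le_rfl)
  have h1 : (1 : ℝ≥0∞) ≤ ENNReal.ofReal q := by
    rw [ENNReal.one_le_ofReal]; linarith
  have key := eLpNorm_le_eLpNorm_mul_rpow_measure_univ h1 hB.1
  rw [Measure.restrict_apply_univ, ENNReal.toReal_one, ENNReal.toReal_ofReal (by linarith),
    eLpNorm_one_eq_lintegral_enorm, div_one] at key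
  have e1 : 0 ≤ 1 - 1 / q := by
    rw [sub_nonneg, div_le_one (by linarith)]; linarith
  have hv : volume (Metric.ball y r) = ENNReal.ofReal (r ^ 2) * volume (Metric.ball (0 : Plane) 1) := by
    rw [Measure.addHaar_ball _ _ hr.le]; simp
  have hv1 : volume (Metric.ball (0 : Plane) 1) ≠ ⊤ := measure_ball_lt_top.ne
  rw [integral_norm_eq_lintegral_enorm hB.1]
  calc _ ≤ (eLpNorm g (ENNReal.ofReal q) (volume.restrict D) *
        (volume (Metric.ball y r)) ^ (1 - 1 / q)).toReal := by
        refine ENNReal.toReal_mono (ENNReal.mul_ne_top hg.2.ne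
          (ENNReal.rpow_ne_top_of_nonneg e1 measure_ball_lt_top.ne)) (key.trans ?_)
        gcongr
    _ = _ := by
        rw [ENNReal.toReal_mul, hv, ← ENNReal.toReal_rpow, ENNReal.toReal_mul,
          ENNReal.toReal_ofReal (by positivity)]

/-- Interior Morrey inequality: for `q > 2` a continuous function with weak derivatives in `L^q` is
bounded at `y` by its `W^{1,q}` norm, with a constant depending only on the distance of `y` to the
boundary. The averages of `h` at the scales `ρ 2⁻ᵏ` form a sequence whose increments are
controlled by the weak derivatives, and decay geometrically since `q > 2`. -/
theorem morrey {F : Type*} [NormedAddCommGroup F] [NormedSpace ℝ F] [CompleteSpace F] {q ρ : ℝ} (hq : 2 < q)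
    (hρ : 0 < ρ) : ∃ C : ℝ, 0 ≤ C ∧ ∀ (D : Set Plane) (h : Plane → F) (g : Fin 2 → Plane → F) (y : Plane),
      IsOpen D → ContinuousOn h D → (∀ j, IsWeakPartial D j h (g j)) →
      MemLp h (ENNReal.ofReal q) (volume.restrict D) →
      (∀ j, MemLp (g j) (ENNReal.ofReal q) (volume.restrict D)) → Metric.ball y (2 * ρ) ⊆ D →
      ‖h y‖ ≤ C * ((eLpNorm h (ENNReal.ofReal q) (volume.restrict D)).toReal
        + ∑ j, (eLpNorm (g j) (ENNReal.ofReal q) (volume.restrict D)).toReal) := by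
  obtain ⟨ψ, η, cψ, cη, sψ, sη, iψ, hdiv⟩ := exists_averaging_kernel
  have compψ : HasCompactSupport ψ := HasCompactSupport.of_support_subset_isCompact
    (isCompact_closedBall (0 : Plane) (3 / 2)) fun z hz => by
      by_contra h; rw [Metric.mem_closedBall, dist_zero_right, not_le] at h; exact hz (sψ z h)
  have compη : ∀ j, HasCompactSupport (η j) := fun j =>
    HasCompactSupport.of_support_subset_isCompact
    (isCompact_closedBall (0 : Plane) (3 / 2)) fun z hz => by
      by_contra h; rw [Metric.mem_closedBall, dist_zero_right, not_le] at h; exact hz (sη j z h)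
  obtain ⟨M₀, hM₀⟩ := cψ.continuous.bounded_above_of_compact_support compψ
  obtain ⟨M₁, hM₁⟩ := (cη 0).continuous.bounded_above_of_compact_support (compη 0)
  obtain ⟨M₂, hM₂⟩ := (cη 1).continuous.bounded_above_of_compact_support (compη 1)
  set M := max M₀ (max M₁ M₂) with hMdef
  have hψM : ∀ z, ‖ψ z‖ ≤ M := fun z => (hM₀ z).trans (le_max_left _ _)
  have hηM : ∀ j z, ‖η j z‖ ≤ M := fun j z => by
    fin_cases j
    · exact (hM₁ z).trans ((le_max_left _ _).trans (le_max_right _ _))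
    · exact (hM₂ z).trans ((le_max_right _ _).trans (le_max_right _ _))
  have hM0 : 0 ≤ M := (norm_nonneg _).trans (hψM 0)
  set V := (volume (Metric.ball (0 : Plane) 1)).toReal with hV
  have hV0 : 0 ≤ V := ENNReal.toReal_nonneg
  set θ : ℝ := 1 - 1 / q with hθ
  set α : ℝ := 1 - 2 / q with hα
  have hα0 : 0 < α := by
    rw [hα, sub_pos, div_lt_one (by linarith)]; exact hq
  set κ : ℝ := (2 : ℝ)⁻¹ ^ α with hκ
  have hκ0 : 0 ≤ κ := by positivity
  have hκ1 : κ < 1 := Real.rpow_lt_one (by norm_num) (by norm_num) hα0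
  have hsum : Summable fun k : ℕ => κ ^ k := summable_geometric_of_lt_one hκ0 hκ1
  set T := M * (4 * V) ^ θ * ρ ^ α with hT
  have hT0 : 0 ≤ T := by positivity
  set C₀ := ρ⁻¹ ^ 2 * (M * ((2 * ρ) ^ 2 * V) ^ θ) with hC₀
  have hC₀0 : 0 ≤ C₀ := by positivity
  refine ⟨C₀ + T * ∑' k, κ ^ k, by positivity, fun D h g y hD ch hw mh mg hB => ?_⟩
  set Nh := (eLpNorm h (ENNReal.ofReal q) (volume.restrict D)).toReal with hNh
  set Ng : Fin 2 → ℝ := fun j => (eLpNorm (g j) (ENNReal.ofReal q) (volume.restrict D)).toReal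
    with hNg
  have hNh0 : 0 ≤ Nh := ENNReal.toReal_nonneg
  have hNg0 : ∀ j, 0 ≤ Ng j := fun j => ENNReal.toReal_nonneg
  -- rescaled test functions
  have resc : ∀ {φ : Plane → ℝ} {s : ℝ}, ContDiff ℝ ∞ φ → (∀ z, 3 / 2 < ‖z‖ → φ z = 0) →
      0 < s → s ≤ ρ → ContDiff ℝ ∞ (fun x => φ (s⁻¹ • (x - y))) ∧
        HasCompactSupport (fun x => φ (s⁻¹ • (x - y))) ∧
        tsupport (fun x => φ (s⁻¹ • (x - y))) ⊆ Metric.ball y (2 * s) ∧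
        Metric.ball y (2 * s) ⊆ D := by
    intro φ s hφ sφ hs hsρ
    have hsub : tsupport (fun x => φ (s⁻¹ • (x - y))) ⊆ Metric.closedBall y (3 / 2 * s) := by
      refine closure_minimal (fun x hx => ?_) Metric.isClosed_closedBall
      by_contra h
      rw [Metric.mem_closedBall, dist_eq_norm, not_le] at h
      refine hx (sφ _ ?_)
      rw [norm_smul, Real.norm_of_nonneg (inv_nonneg.2 hs.le), inv_mul_eq_div, lt_div_iff₀ hs]
      exact h
    exact ⟨hφ.comp ((contDiff_id.sub contDiff_const).const_smul _),
      HasCompactSupport.of_support_subset_isCompact (isCompact_closedBall _ _)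
        ((subset_tsupport _).trans hsub),
      hsub.trans (Metric.closedBall_subset_ball (by linarith)),
      (Metric.ball_subset_ball (by linarith)).trans hB⟩
  let J : ℝ → F := fun s => s⁻¹ ^ 2 • ∫ x, ψ (s⁻¹ • (x - y)) • h x
  have bound : ∀ {φ : Plane → ℝ} {u : Plane → F} {s : ℝ}, ContDiff ℝ ∞ φ → (∀ z, 3 / 2 < ‖z‖ → φ z = 0) →
      0 < s → s ≤ ρ → (∀ z, ‖φ z‖ ≤ M) → LocallyIntegrableOn u D →
      MemLp u (ENNReal.ofReal q) (volume.restrict D) → ‖∫ x, φ (s⁻¹ • (x - y)) • u x‖ ≤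
        M * ((eLpNorm u (ENNReal.ofReal q) (volume.restrict D)).toReal * ((2 * s) ^ 2 * V) ^ θ) := by
    intro φ u s hφ sφ hs hsρ hb lu mu
    obtain ⟨c1, c2, c3, c4⟩ := resc hφ sφ hs hsρ
    have hsup : Function.support (fun x => φ (s⁻¹ • (x - y)) • u x) ⊆ Metric.ball y (2 * s) :=
      fun x hx => c3 (subset_tsupport _ fun h0 => hx (by simp [h0]))
    rw [← setIntegral_eq_integral_of_forall_compl_eq_zero (s := Metric.ball y (2 * s))
      (fun x hx => by by_contra h0; exact hx (hsup h0))]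
    have iu : IntegrableOn u (Metric.ball y (2 * s)) := by
      have : MemLp u (ENNReal.ofReal q) (volume.restrict (Metric.ball y (2 * s))) :=
        mu.mono_measure (Measure.restrict_mono c4 le_rfl)
      have : IsFiniteMeasure (volume.restrict (Metric.ball y (2 * s))) :=
        ⟨by rw [Measure.restrict_apply_univ]; exact measure_ball_lt_top⟩
      exact ‹MemLp u _ (volume.restrict (Metric.ball y (2 * s)))›.integrable
        (by rw [ENNReal.one_le_ofReal]; linarith)
    calc ‖∫ x in Metric.ball y (2 * s), φ (s⁻¹ • (x - y)) • u x‖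
        ≤ ∫ x in Metric.ball y (2 * s), M * ‖u x‖ := by
          refine norm_integral_le_of_norm_le (iu.norm.const_mul M) (Eventually.of_forall fun x => ?_)
          rw [norm_smul]
          exact mul_le_mul_of_nonneg_right (hb _) (norm_nonneg _)
      _ = M * ∫ x in Metric.ball y (2 * s), ‖u x‖ := integral_const_mul _ _
      _ ≤ _ := by
          gcongr
          exact setIntegral_norm_ball_le hq mu (by positivity) c4
  have scale : ∀ {φ : Plane → ℝ} {s : ℝ}, 0 < s →
      s⁻¹ ^ 2 * ∫ x, φ (s⁻¹ • (x - y)) = ∫ z, φ z := by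
    intro φ s hs
    rw [integral_sub_right_eq_self (fun x => φ (s⁻¹ • x)) y, Measure.integral_comp_smul]
    simp only [finrank_euclideanSpace, Fintype.card_fin, smul_eq_mul]
    rw [abs_of_nonneg (by positivity), ← mul_assoc, inv_pow, inv_inv,
      inv_mul_cancel₀ (by positivity), one_mul]
  -- the increments of the averages between consecutive dyadic scales
  have incr : ∀ s, 0 < s → s ≤ ρ → ‖J (s / 2) - J s‖ ≤ M * (4 * V) ^ θ * s ^ α * ∑ j, Ng j := by
    intro s hs hsρ
    have hs2 : 0 < s / 2 := by linarith
    obtain ⟨a1, a2, a3, a4⟩ := resc cψ sψ hs hsρ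
    obtain ⟨b1, b2, b3, b4⟩ := resc cψ sψ hs2 (by linarith)
    have i1 := integrable_smul_of_locallyIntegrableOn (hw 0).1 a1.continuous a2 (a3.trans a4)
    have i2 := integrable_smul_of_locallyIntegrableOn (hw 0).1 b1.continuous b2 (b3.trans b4)
    have harg : ∀ x, (s / 2)⁻¹ • (x - y) = (2 : ℝ) • s⁻¹ • (x - y) := fun x => by
      rw [smul_smul]
      congr 1
      field_simp
    have e1 : J (s / 2) - J s
        = s⁻¹ ^ 2 • ∫ x, (∑ j, fderiv ℝ (η j) (s⁻¹ • (x - y)) (e j)) • h x := by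
      have : J (s / 2) = s⁻¹ ^ 2 • ∫ x, (4 * ψ ((2 : ℝ) • s⁻¹ • (x - y))) • h x := by
        simp only [J, mul_smul (4 : ℝ), integral_smul]
        rw [smul_smul]
        congr 1
        · field_simp; norm_num
        · simp only [harg]
      rw [this, ← smul_sub, ← integral_sub]
      · congr 1
        refine integral_congr_ae (Eventually.of_forall fun x => ?_)
        dsimp only
        rw [← sub_smul, ← hdiv]
      · simp only [harg] at i2
        simp only [mul_smul (4 : ℝ)]
        exact i2.smul (4 : ℝ)
      · exact i1
    have e2 : ∀ j, ∫ x, (fderiv ℝ (η j) (s⁻¹ • (x - y)) (e j)) • h x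
        = - (s • ∫ x, η j (s⁻¹ • (x - y)) • g j x) := by
      intro j
      obtain ⟨d1, d2, d3, d4⟩ := resc (cη j) (sη j) hs hsρ
      have key := (hw j).2.2 _ d1 d2 (d3.trans d4)
      rw [← smul_neg, ← key, ← integral_smul]
      refine integral_congr_ae (Eventually.of_forall fun x => ?_)
      have h1 : HasFDerivAt (fun x => η j (s⁻¹ • (x - y)))
          ((fderiv ℝ (η j) (s⁻¹ • (x - y))).comp (s⁻¹ • ContinuousLinearMap.id ℝ Plane)) x :=
        (((cη j).differentiable (by simp)) (s⁻¹ • (x - y))).hasFDerivAt.comp x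
          (((hasFDerivAt_id x).sub_const y).const_smul s⁻¹)
      dsimp only
      rw [h1.fderiv]
      simp [smul_smul, hs.ne']
    have e3 : ‖∫ x, (∑ j, fderiv ℝ (η j) (s⁻¹ • (x - y)) (e j)) • h x‖
        ≤ ∑ j, s * (M * (Ng j * ((2 * s) ^ 2 * V) ^ θ)) := by
      simp only [Finset.sum_smul]
      rw [integral_finsetSum]
      · simp only [e2]
        refine (norm_sum_le _ _).trans (Finset.sum_le_sum fun j _ => ?_)
        rw [norm_neg, norm_smul, Real.norm_of_nonneg hs.le]
        gcongr
        exact bound (cη j) (sη j) hs hsρ (hηM j) (hw j).2.1 (mg j)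
      · intro j _
        obtain ⟨d1, d2, d3, d4⟩ := resc (φ := fun z => fderiv ℝ (η j) z (e j)) (s := s)
          (((cη j).fderiv_right (m := ∞) (by simp)).clm_apply contDiff_const)
          (fun z hz => by
            have : η j =ᶠ[𝓝 z] fun _ => 0 := by
              filter_upwards [(isOpen_lt continuous_const continuous_norm).mem_nhds hz] with w hw
              exact sη j w hw
            rw [this.fderiv_eq]; simp) hs hsρ
        exact integrable_smul_of_locallyIntegrableOn (hw j).1 d1.continuous d2 (d3.trans d4)
    rw [e1, norm_smul, Real.norm_of_nonneg (by positivity)]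
    refine (mul_le_mul_of_nonneg_left e3 (by positivity)).trans (le_of_eq ?_)
    have e4 : ((2 * s) ^ 2 * V) ^ θ = (4 * V) ^ θ * s ^ α * s := by
      have : (2 * s) ^ 2 * V = 4 * V * (s * s) := by ring
      rw [this, Real.mul_rpow (by positivity) (by positivity), Real.mul_rpow hs.le hs.le,
        ← Real.rpow_add hs, mul_assoc]
      congr 1
      conv_rhs => rw [← Real.rpow_one s, ← Real.rpow_mul hs.le, one_mul, ← Real.rpow_add hs]
      congr 1
      rw [hθ, hα]; ring
    rw [e4, ← Finset.mul_sum, ← Finset.mul_sum, ← Finset.sum_mul]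
    field_simp
  -- the averages converge to the value of `h` at `y`
  have lim : Tendsto (fun k : ℕ => J (ρ * 2⁻¹ ^ k)) atTop (𝓝 (h y)) := by
    rw [Metric.tendsto_atTop']
    intro ε hε
    have hC : 0 < M * (4 * V) + 1 := by positivity
    have hyD : y ∈ D := hB (Metric.mem_ball_self (by linarith))
    obtain ⟨δ, hδ, hδ'⟩ := Metric.continuousAt_iff.1 (ch.continuousAt (hD.mem_nhds hyD))
      (ε / (M * (4 * V) + 1)) (by positivity)
    have ht : Tendsto (fun k : ℕ => 2 * (ρ * (2⁻¹ : ℝ) ^ k)) atTop (𝓝 (2 * (ρ * 0))) :=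
      ((tendsto_pow_atTop_nhds_zero_of_lt_one (by norm_num) (by norm_num)).const_mul _).const_mul _
    rw [mul_zero, mul_zero] at ht
    obtain ⟨K, hK⟩ := (ht.eventually (gt_mem_nhds hδ)).exists_forall_of_atTop
    refine ⟨K, fun k hk => ?_⟩
    have hkδ := hK k hk.le
    set s := ρ * (2⁻¹ : ℝ) ^ k with hs'
    have hs : 0 < s := by positivity
    have hsρ : s ≤ ρ := by
      rw [hs']
      exact mul_le_of_le_one_right hρ.le (pow_le_one₀ (by norm_num) (by norm_num))
    obtain ⟨a1, a2, a3, a4⟩ := resc cψ sψ hs hsρ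
    have i1 := integrable_smul_of_locallyIntegrableOn (hw 0).1 a1.continuous a2 (a3.trans a4)
    have i2 : Integrable fun x => ψ (s⁻¹ • (x - y)) • h y :=
      (a1.continuous.integrable_of_hasCompactSupport a2).smul_const _
    have e1 : J s - h y = s⁻¹ ^ 2 • ∫ x, ψ (s⁻¹ • (x - y)) • (h x - h y) := by
      simp only [fun x => smul_sub (ψ (s⁻¹ • (x - y))) (h x) (h y)]
      rw [integral_sub i1 i2, integral_smul_const, smul_sub, smul_smul, scale hs, iψ, one_smul]
    have hv : (volume (Metric.ball y (2 * s))).toReal = (2 * s) ^ 2 * V := by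
      rw [Measure.addHaar_ball _ _ (by positivity), ENNReal.toReal_mul,
        ENNReal.toReal_ofReal (by positivity)]
      simp [hV]
    have e2 : ‖∫ x, ψ (s⁻¹ • (x - y)) • (h x - h y)‖
        ≤ M * (ε / (M * (4 * V) + 1)) * ((2 * s) ^ 2 * V) := by
      have hsup : ∀ x, x ∉ Metric.ball y (2 * s) → ψ (s⁻¹ • (x - y)) • (h x - h y) = 0 :=
        fun x hx => by
          have : ψ (s⁻¹ • (x - y)) = 0 := by
            by_contra h0
            exact hx (a3 (subset_tsupport _ h0))
          rw [this, zero_smul]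
      rw [← setIntegral_eq_integral_of_forall_compl_eq_zero hsup, ← hv]
      refine norm_setIntegral_le_of_norm_le_const measure_ball_lt_top fun x hx => ?_
      rw [norm_smul]
      have hd : dist x y < δ := lt_trans hx hkδ
      have := hδ' hd
      rw [dist_eq_norm] at this
      exact mul_le_mul (hψM _) this.le (norm_nonneg _) hM0
    rw [dist_eq_norm, e1, norm_smul, Real.norm_of_nonneg (by positivity)]
    calc s⁻¹ ^ 2 * _ ≤ s⁻¹ ^ 2 * (M * (ε / (M * (4 * V) + 1)) * ((2 * s) ^ 2 * V)) :=
          mul_le_mul_of_nonneg_left e2 (by positivity)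
      _ = ε * ((M * (4 * V)) / (M * (4 * V) + 1)) := by field_simp; ring
      _ < ε * 1 := by
          refine mul_lt_mul_of_pos_left ?_ hε
          rw [div_lt_one hC]; linarith
      _ = ε := mul_one ε
  have step_le : ∀ k : ℕ, dist (J (ρ * 2⁻¹ ^ k)) (J (ρ * 2⁻¹ ^ (k + 1)))
      ≤ T * (∑ j, Ng j) * κ ^ k := by
    intro k
    have hs : 0 < ρ * (2⁻¹ : ℝ) ^ k := by positivity
    have hsρ : ρ * (2⁻¹ : ℝ) ^ k ≤ ρ :=
      mul_le_of_le_one_right hρ.le (pow_le_one₀ (by norm_num) (by norm_num))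
    have := incr _ hs hsρ
    rw [dist_comm, dist_eq_norm]
    rw [show ρ * (2⁻¹ : ℝ) ^ (k + 1) = ρ * 2⁻¹ ^ k / 2 by rw [pow_succ]; ring]
    refine this.trans (le_of_eq ?_)
    rw [Real.mul_rpow hρ.le (by positivity), ← Real.rpow_natCast, ← Real.rpow_mul (by norm_num),
      mul_comm (k : ℝ) α, Real.rpow_mul (by norm_num), Real.rpow_natCast, hT]
    ring
  have hsum' : Summable fun k : ℕ => T * (∑ j, Ng j) * κ ^ k := hsum.mul_left _
  have fin := dist_le_tsum_of_dist_le_of_tendsto₀ _ step_le hsum' lim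
  have J0 : ‖J ρ‖ ≤ C₀ * Nh := by
    simp only [J]
    rw [norm_smul, Real.norm_of_nonneg (by positivity)]
    have := bound cψ sψ hρ le_rfl hψM (hw 0).1 mh
    calc ρ⁻¹ ^ 2 * _ ≤ ρ⁻¹ ^ 2 * (M * (Nh * ((2 * ρ) ^ 2 * V) ^ θ)) :=
          mul_le_mul_of_nonneg_left this (by positivity)
      _ = C₀ * Nh := by rw [hC₀]; ring
  rw [tsum_mul_left] at fin
  simp only [pow_zero, mul_one] at fin
  have hNs : 0 ≤ ∑ j, Ng j := Finset.sum_nonneg fun j _ => hNg0 j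
  have hts : 0 ≤ ∑' k, κ ^ k := tsum_nonneg fun k => by positivity
  calc ‖h y‖ ≤ ‖J ρ‖ + dist (J ρ) (h y) := by
        rw [dist_comm, dist_eq_norm]
        exact norm_le_norm_add_norm_sub' _ _
    _ ≤ C₀ * Nh + T * (∑ j, Ng j) * ∑' k, κ ^ k := add_le_add J0 fin
    _ ≤ (C₀ + T * ∑' k, κ ^ k) * (Nh + ∑ j, Ng j) := by
        have := mul_nonneg hC₀0 hNs
        have := mul_nonneg (mul_nonneg hT0 hts) hNh0
        nlinarith


/-! ### Point evaluations on the Sobolev space -/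

section SobolevSpace

variable {S : Type*} [TopologicalSpace S] [ChartedSpace Plane S] [IsManifold (𝓡 2) ∞ S]
variable {𝔄 : DiscCover S} {m : ℕ} {p : ℝ}

/-- The second weak derivative `∂_k ∂_j` of the coordinate expression of `f` in the `i`-th disc. -/
noncomputable def weak2 (i : Fin 𝔄.card) (k j : Fin 2) (f : Sobolev 𝔄 m p) : Plane → Euc m :=
  weakPartial (𝔄.disc i) k (weakPartial (𝔄.disc i) j (𝔄.loc i f.1))

theorem contDiffOn_loc_of_contMDiff {f : S → Euc m} (hf : ContMDiff (𝓡 2) 𝓘(ℝ, Euc m) 1 f)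
    (i : Fin 𝔄.card) : ContDiffOn ℝ 1 (𝔄.loc i f) (𝔄.chart i).target := by
  have h := (contMDiffOn_symm_of_mem_maximalAtlas (𝔄.chart_mem i)).of_le
    (m := 1) (by exact_mod_cast le_top)
  exact contMDiffOn_iff_contDiffOn.1 (hf.comp_contMDiffOn h)

theorem contDiffOn_loc (f : Sobolev 𝔄 m p) (i : Fin 𝔄.card) :
    ContDiffOn ℝ 1 (𝔄.loc i f.1) (𝔄.chart i).target :=
  contDiffOn_loc_of_contMDiff f.2.1 i

theorem contDiffOn_loc_disc (f : Sobolev 𝔄 m p) (i : Fin 𝔄.card) :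
    ContDiffOn ℝ 1 (𝔄.loc i f.1) (𝔄.disc i) :=
  (contDiffOn_loc f i).mono (𝔄.disc_subset i)

theorem differentiableAt_loc (f : Sobolev 𝔄 m p) {i : Fin 𝔄.card} {y : Plane} (hy : y ∈ 𝔄.disc i) :
    DifferentiableAt ℝ (𝔄.loc i f.1) y :=
  ((contDiffOn_loc_disc f i).contDiffAt ((𝔄.isOpen_disc i).mem_nhds hy)).differentiableAt (by simp)

theorem continuousOn_pd_loc (f : Sobolev 𝔄 m p) (i : Fin 𝔄.card) (j : Fin 2) :
    ContinuousOn (pd j (𝔄.loc i f.1)) (𝔄.disc i) :=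
  ((contDiffOn_loc_disc f i).continuousOn_fderiv_of_isOpen (𝔄.isOpen_disc i) le_rfl).clm_apply
    continuousOn_const

theorem isWeakPartial_loc (f : Sobolev 𝔄 m p) (i : Fin 𝔄.card) (j : Fin 2) :
    IsWeakPartial (𝔄.disc i) j (𝔄.loc i f.1) (pd j (𝔄.loc i f.1)) :=
  isWeakPartial_of_contDiffOn (𝔄.isOpen_disc i) (contDiffOn_loc_disc f i) j

theorem weakPartial_loc_ae_eq (f : Sobolev 𝔄 m p) (i : Fin 𝔄.card) (j : Fin 2) :
    weakPartial (𝔄.disc i) j (𝔄.loc i f.1) =ᵐ[volume.restrict (𝔄.disc i)] pd j (𝔄.loc i f.1) :=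
  (isWeakPartial_loc f i j).ae_eq (𝔄.isOpen_disc i)

theorem isWeakPartial_pd (f : Sobolev 𝔄 m p) (i : Fin 𝔄.card) (k j : Fin 2) :
    IsWeakPartial (𝔄.disc i) k (pd j (𝔄.loc i f.1)) (weak2 i k j f) :=
  ((f.2.2 i).spec (𝔄.isOpen_disc i) j k).2.1.congr (𝔄.isOpen_disc i) (weakPartial_loc_ae_eq f i j)

theorem memLp_loc (f : Sobolev 𝔄 m p) (i : Fin 𝔄.card) :
    MemLp (𝔄.loc i f.1) (ENNReal.ofReal (2 * p)) (volume.restrict (𝔄.disc i)) := (f.2.2 i).1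

theorem memLp_pd (f : Sobolev 𝔄 m p) (i : Fin 𝔄.card) (j : Fin 2) :
    MemLp (pd j (𝔄.loc i f.1)) (ENNReal.ofReal (2 * p)) (volume.restrict (𝔄.disc i)) :=
  ((f.2.2 i).spec (𝔄.isOpen_disc i) j j).2.2.1.ae_eq (weakPartial_loc_ae_eq f i j)

theorem memLp_weak2 (f : Sobolev 𝔄 m p) (i : Fin 𝔄.card) (k j : Fin 2) :
    MemLp (weak2 i k j f) (ENNReal.ofReal (2 * p)) (volume.restrict (𝔄.disc i)) :=
  ((f.2.2 i).spec (𝔄.isOpen_disc i) j k).2.2.2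

/-- The Sobolev norm in terms of the classical first derivatives and `weak2`. -/
theorem norm_eq_sum (f : Sobolev 𝔄 m p) : ‖f‖ = ∑ i,
    ((eLpNorm (𝔄.loc i f.1) (ENNReal.ofReal (2 * p)) (volume.restrict (𝔄.disc i))).toReal
    + ∑ j, (eLpNorm (pd j (𝔄.loc i f.1)) (ENNReal.ofReal (2 * p))
        (volume.restrict (𝔄.disc i))).toReal
    + ∑ j, ∑ k, (eLpNorm (weak2 i k j f) (ENNReal.ofReal (2 * p))
        (volume.restrict (𝔄.disc i))).toReal) := by
  rw [Sobolev.norm_def]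
  refine Finset.sum_congr rfl fun i _ => ?_
  unfold normW2
  simp only [fun j => eLpNorm_congr_ae (p := ENNReal.ofReal (2 * p)) (weakPartial_loc_ae_eq f i j)]
  rfl

theorem eLpNorm_le_norm (f : Sobolev 𝔄 m p) (i : Fin 𝔄.card) :
    (eLpNorm (𝔄.loc i f.1) (ENNReal.ofReal (2 * p)) (volume.restrict (𝔄.disc i))).toReal
    + ∑ j, (eLpNorm (pd j (𝔄.loc i f.1)) (ENNReal.ofReal (2 * p))
        (volume.restrict (𝔄.disc i))).toReal
    + ∑ j, ∑ k, (eLpNorm (weak2 i k j f) (ENNReal.ofReal (2 * p))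
        (volume.restrict (𝔄.disc i))).toReal ≤ ‖f‖ := by
  rw [norm_eq_sum]
  refine Finset.single_le_sum (f := fun i =>
    (eLpNorm (𝔄.loc i f.1) (ENNReal.ofReal (2 * p)) (volume.restrict (𝔄.disc i))).toReal
    + ∑ j, (eLpNorm (pd j (𝔄.loc i f.1)) (ENNReal.ofReal (2 * p))
        (volume.restrict (𝔄.disc i))).toReal
    + ∑ j, ∑ k, (eLpNorm (weak2 i k j f) (ENNReal.ofReal (2 * p))
        (volume.restrict (𝔄.disc i))).toReal) (fun i _ => by positivity) (Finset.mem_univ i)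

theorem eLpNorm_loc_le_norm (f : Sobolev 𝔄 m p) (i : Fin 𝔄.card) :
    (eLpNorm (𝔄.loc i f.1) (ENNReal.ofReal (2 * p)) (volume.restrict (𝔄.disc i))).toReal ≤ ‖f‖ := by
  have h := eLpNorm_le_norm f i
  generalize ‖f‖ = A at h ⊢
  refine le_trans ?_ h
  rw [add_assoc]
  exact le_add_of_nonneg_right (by positivity)

theorem eLpNorm_pd_le_norm (f : Sobolev 𝔄 m p) (i : Fin 𝔄.card) (j : Fin 2) :
    (eLpNorm (pd j (𝔄.loc i f.1)) (ENNReal.ofReal (2 * p))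
      (volume.restrict (𝔄.disc i))).toReal ≤ ‖f‖ := by
  have h := eLpNorm_le_norm f i
  generalize ‖f‖ = A at h ⊢
  have h1 : 0 ≤ ∑ j, ∑ k, (eLpNorm (weak2 i k j f) (ENNReal.ofReal (2 * p))
        (volume.restrict (𝔄.disc i))).toReal := by positivity
  have h2 : 0 ≤ (eLpNorm (𝔄.loc i f.1) (ENNReal.ofReal (2 * p))
      (volume.restrict (𝔄.disc i))).toReal := ENNReal.toReal_nonneg
  have h3 := Finset.single_le_sum (f := fun j => (eLpNorm (pd j (𝔄.loc i f.1))
      (ENNReal.ofReal (2 * p)) (volume.restrict (𝔄.disc i))).toReal)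
      (fun j _ => ENNReal.toReal_nonneg) (Finset.mem_univ j)
  linarith

theorem eLpNorm_weak2_le_norm (f : Sobolev 𝔄 m p) (i : Fin 𝔄.card) (k j : Fin 2) :
    (eLpNorm (weak2 i k j f) (ENNReal.ofReal (2 * p))
      (volume.restrict (𝔄.disc i))).toReal ≤ ‖f‖ := by
  have h := eLpNorm_le_norm f i
  generalize ‖f‖ = A at h ⊢
  have h1 : 0 ≤ ∑ j, (eLpNorm (pd j (𝔄.loc i f.1)) (ENNReal.ofReal (2 * p))
        (volume.restrict (𝔄.disc i))).toReal := by positivity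
  have h2 : 0 ≤ (eLpNorm (𝔄.loc i f.1) (ENNReal.ofReal (2 * p))
      (volume.restrict (𝔄.disc i))).toReal := ENNReal.toReal_nonneg
  have h3 := Finset.single_le_sum (f := fun j => ∑ k, (eLpNorm (weak2 i k j f)
      (ENNReal.ofReal (2 * p)) (volume.restrict (𝔄.disc i))).toReal)
      (fun j _ => Finset.sum_nonneg fun _ _ => ENNReal.toReal_nonneg) (Finset.mem_univ j)
  have h4 := Finset.single_le_sum (f := fun k => (eLpNorm (weak2 i k j f) (ENNReal.ofReal (2 * p))
      (volume.restrict (𝔄.disc i))).toReal) (fun _ _ => ENNReal.toReal_nonneg) (Finset.mem_univ k)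
  linarith

theorem Sobolev.zero_le_norm (f : Sobolev 𝔄 m p) : 0 ≤ ‖f‖ :=
  Sobolev.norm_def f ▸ Finset.sum_nonneg fun _ _ => normW2_nonneg

/-- Interior `C¹` bound by the Sobolev norm. -/
theorem exists_C1_bound (𝔄 : DiscCover S) (m : ℕ) (hp : 1 < p) {ρ : ℝ} (hρ : 0 < ρ) :
    ∃ C : ℝ, 0 ≤ C ∧ ∀ (i : Fin 𝔄.card) (y : Plane), Metric.ball y (2 * ρ) ⊆ 𝔄.disc i →
      ∀ f : Sobolev 𝔄 m p, ‖𝔄.loc i f.1 y‖ ≤ C * ‖f‖ ∧ ‖fderiv ℝ (𝔄.loc i f.1) y‖ ≤ C * ‖f‖ := by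
  obtain ⟨C, hC, h⟩ := morrey (F := Euc m) (q := 2 * p) (by linarith) hρ
  refine ⟨2 * C, by positivity, fun i y hy f => ⟨?_, ?_⟩⟩
  · refine (h _ _ _ y (𝔄.isOpen_disc i) (contDiffOn_loc_disc f i).continuousOn
      (isWeakPartial_loc f i) (memLp_loc f i) (memLp_pd f i) hy).trans ?_
    have h1 := eLpNorm_le_norm f i
    have h2 : 0 ≤ ∑ j, ∑ k, (eLpNorm (weak2 i k j f) (ENNReal.ofReal (2 * p))
        (volume.restrict (𝔄.disc i))).toReal := by positivity
    have h3 := Sobolev.zero_le_norm f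
    generalize ‖f‖ = A at h1 h3 ⊢
    calc _ ≤ C * A := mul_le_mul_of_nonneg_left (by linarith) hC
      _ ≤ 2 * C * A := by nlinarith
  · have key : ∀ j, ‖pd j (𝔄.loc i f.1) y‖ ≤ C * ((eLpNorm (pd j (𝔄.loc i f.1))
        (ENNReal.ofReal (2 * p)) (volume.restrict (𝔄.disc i))).toReal + ∑ k, (eLpNorm (weak2 i k j f)
          (ENNReal.ofReal (2 * p)) (volume.restrict (𝔄.disc i))).toReal) := fun j =>
      h (𝔄.disc i) (pd j (𝔄.loc i f.1)) (fun k => weak2 i k j f) y (𝔄.isOpen_disc i)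
        (continuousOn_pd_loc f i j)
        (fun k => isWeakPartial_pd f i k j) (memLp_pd f i j) (fun k => memLp_weak2 f i k j) hy
    have h1 := eLpNorm_le_norm f i
    have h2 : 0 ≤ (eLpNorm (𝔄.loc i f.1) (ENNReal.ofReal (2 * p))
      (volume.restrict (𝔄.disc i))).toReal := ENNReal.toReal_nonneg
    have h3 := Sobolev.zero_le_norm f
    generalize ‖f‖ = A at h1 h3 ⊢
    refine ContinuousLinearMap.opNorm_le_bound _ (by positivity) fun v => ?_
    have hv : ∀ l, ‖v l‖ ≤ ‖v‖ := fun l => PiLp.norm_apply_le v l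
    calc ‖fderiv ℝ (𝔄.loc i f.1) y v‖ = ‖∑ l, v l • fderiv ℝ (𝔄.loc i f.1) y (e l)‖ := by
          conv_lhs => rw [plane_eq_sum v]
          simp
      _ ≤ ∑ l, ‖v‖ * ‖fderiv ℝ (𝔄.loc i f.1) y (e l)‖ := by
          refine (norm_sum_le _ _).trans (Finset.sum_le_sum fun l _ => ?_)
          rw [norm_smul]
          exact mul_le_mul_of_nonneg_right (hv l) (norm_nonneg _)
      _ = ‖v‖ * ∑ l, ‖fderiv ℝ (𝔄.loc i f.1) y (e l)‖ := (Finset.mul_sum _ _ _).symm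
      _ ≤ ‖v‖ * (2 * C * A) := by
          gcongr
          refine (Finset.sum_le_sum fun l _ => key l).trans ?_
          rw [← Finset.mul_sum, Finset.sum_add_distrib]
          calc _ ≤ C * A := mul_le_mul_of_nonneg_left (by linarith) hC
            _ ≤ 2 * C * A := by nlinarith
      _ = _ := by ring

theorem exists_ball_subset_disc {i : Fin 𝔄.card} {y : Plane} (hy : y ∈ 𝔄.disc i) :
    ∃ ρ > 0, ∀ z ∈ Metric.ball y ρ, Metric.ball z (2 * ρ) ⊆ 𝔄.disc i := by
  obtain ⟨r, hr, h⟩ := Metric.isOpen_iff.1 (𝔄.isOpen_disc i) y hy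
  refine ⟨r / 3, by positivity, fun z hz w hw => h ?_⟩
  rw [Metric.mem_ball] at *
  linarith [dist_triangle w z y]

variable [Fact (1 < p)]

/-- Evaluation at a point of a disc, as a continuous linear map. -/
noncomputable def evalCLM (𝔄 : DiscCover S) (m : ℕ) (p : ℝ) [Fact (1 < p)] {i : Fin 𝔄.card} {y : Plane}
    (hy : y ∈ 𝔄.disc i) : Sobolev 𝔄 m p →L[ℝ] Euc m :=
  LinearMap.mkContinuousOfExistsBound
    { toFun := fun f => 𝔄.loc i f.1 y
      map_add' := fun _ _ => rfl
      map_smul' := fun _ _ => rfl } (by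
    obtain ⟨ρ, hρ, h⟩ := exists_ball_subset_disc hy
    obtain ⟨C, -, hC⟩ := exists_C1_bound (p := p) 𝔄 m Fact.out hρ
    exact ⟨C, fun f => (hC i y (h y (Metric.mem_ball_self hρ)) f).1⟩)

/-- Evaluation of the derivative at a point of a disc, as a continuous linear map. -/
noncomputable def fderivCLM (𝔄 : DiscCover S) (m : ℕ) (p : ℝ) [Fact (1 < p)] {i : Fin 𝔄.card} {y : Plane}
    (hy : y ∈ 𝔄.disc i) : Sobolev 𝔄 m p →L[ℝ] Plane →L[ℝ] Euc m :=
  LinearMap.mkContinuousOfExistsBound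
    { toFun := fun f => fderiv ℝ (𝔄.loc i f.1) y
      map_add' := fun f g => fderiv_add (differentiableAt_loc f hy) (differentiableAt_loc g hy)
      map_smul' := fun c f => fderiv_const_smul (differentiableAt_loc f hy) c } (by
    obtain ⟨ρ, hρ, h⟩ := exists_ball_subset_disc hy
    obtain ⟨C, -, hC⟩ := exists_C1_bound (p := p) 𝔄 m Fact.out hρ
    exact ⟨C, fun f => (hC i y (h y (Metric.mem_ball_self hρ)) f).2⟩)

@[simp] theorem evalCLM_apply {i : Fin 𝔄.card} {y : Plane} (hy : y ∈ 𝔄.disc i)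
    (f : Sobolev 𝔄 m p) : evalCLM 𝔄 m p hy f = 𝔄.loc i f.1 y := rfl

@[simp] theorem fderivCLM_apply {i : Fin 𝔄.card} {y : Plane} (hy : y ∈ 𝔄.disc i)
    (f : Sobolev 𝔄 m p) : fderivCLM 𝔄 m p hy f = fderiv ℝ (𝔄.loc i f.1) y := rfl

theorem pd_sub (f g : Sobolev 𝔄 m p) {i : Fin 𝔄.card} {y : Plane} (hy : y ∈ 𝔄.disc i) (j : Fin 2) :
    pd j (𝔄.loc i (f - g).1) y = pd j (𝔄.loc i f.1) y - pd j (𝔄.loc i g.1) y := by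
  have := (fderivCLM 𝔄 m p hy).map_sub f g
  simp only [fderivCLM_apply] at this
  simp only [pd]
  rw [this]
  rfl

theorem weak2_sub_ae (f g : Sobolev 𝔄 m p) (i : Fin 𝔄.card) (k j : Fin 2) :
    weak2 i k j (f - g) =ᵐ[volume.restrict (𝔄.disc i)] weak2 i k j f - weak2 i k j g := by
  have h1 := (isWeakPartial_pd f i k j).add ((isWeakPartial_pd g i k j).smul (-1))
  rw [show weak2 i k j f + (-1 : ℝ) • weak2 i k j g = weak2 i k j f - weak2 i k j g by
    rw [neg_one_smul, sub_eq_add_neg]] at h1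
  refine (isWeakPartial_pd (f - g) i k j).unique (𝔄.isOpen_disc i) (h1.congr (𝔄.isOpen_disc i) ?_)
  refine (ae_restrict_iff' (𝔄.isOpen_disc i).measurableSet).2 (Eventually.of_forall fun y hy => ?_)
  rw [pd_sub f g hy]
  simp [sub_eq_add_neg]

/-! ### Completeness of the Sobolev space -/

theorem eLpNorm_pd_sub_le (f g : Sobolev 𝔄 m p) (i : Fin 𝔄.card) (j : Fin 2) :
    (eLpNorm (pd j (𝔄.loc i f.1) - pd j (𝔄.loc i g.1)) (ENNReal.ofReal (2 * p))
      (volume.restrict (𝔄.disc i))).toReal ≤ ‖f - g‖ := by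
  refine le_trans (le_of_eq ?_) (eLpNorm_pd_le_norm (f - g) i j)
  refine congrArg _ (eLpNorm_congr_ae ((ae_restrict_iff' (𝔄.isOpen_disc i).measurableSet).2
    (Eventually.of_forall fun y hy => ?_)))
  rw [pd_sub f g hy]; rfl

theorem eLpNorm_weak2_sub_le (f g : Sobolev 𝔄 m p) (i : Fin 𝔄.card) (k j : Fin 2) :
    (eLpNorm (weak2 i k j f - weak2 i k j g) (ENNReal.ofReal (2 * p))
      (volume.restrict (𝔄.disc i))).toReal ≤ ‖f - g‖ := by
  refine le_trans (le_of_eq ?_) (eLpNorm_weak2_le_norm (f - g) i k j)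
  exact congrArg _ (eLpNorm_congr_ae (weak2_sub_ae f g i k j).symm)

theorem tendsto_setLIntegral_of_tendsto_eLpNorm {F : Type*} [NormedAddCommGroup F]
    {q : ℝ≥0∞} (hq : 1 ≤ q) {D K : Set Plane} (hK : IsCompact K) (hKD : K ⊆ D)
    {h : ℕ → Plane → F} {g : Plane → F} (hh : ∀ n, MemLp (h n) q (volume.restrict D))
    (hg : MemLp g q (volume.restrict D))
    (hl : Tendsto (fun n => eLpNorm (h n - g) q (volume.restrict D)) atTop (𝓝 0)) :
    Tendsto (fun n => ∫⁻ x in K, ‖h n x - g x‖ₑ) atTop (𝓝 0) := by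
  have hv : (volume.restrict K) univ ≠ ⊤ := by
    rw [Measure.restrict_apply_univ]; exact hK.measure_ne_top
  set c := (volume.restrict K) univ ^ (1 / (1 : ℝ≥0∞).toReal - 1 / q.toReal) with hc
  have hct : c ≠ ⊤ := by
    refine ENNReal.rpow_ne_top_of_nonneg ?_ hv
    rcases eq_or_ne q ⊤ with rfl | hq'
    · simp
    · rw [ENNReal.toReal_one, div_one, sub_nonneg]
      refine div_le_one_of_le₀ ?_ ENNReal.toReal_nonneg
      rw [← ENNReal.toReal_one]
      exact ENNReal.toReal_mono hq' hq
  have h2 : Tendsto (fun n => eLpNorm (h n - g) q (volume.restrict D) * c) atTop (𝓝 0) := by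
    simpa using ENNReal.Tendsto.mul_const hl (Or.inr hct)
  refine tendsto_of_tendsto_of_tendsto_of_le_of_le tendsto_const_nhds h2 (fun _ => bot_le) fun n => ?_
  have hm : volume.restrict K ≤ volume.restrict D := Measure.restrict_mono hKD le_rfl
  have := eLpNorm_le_eLpNorm_mul_rpow_measure_univ hq (((hh n).sub hg).1.mono_measure hm)
  rw [eLpNorm_one_eq_lintegral_enorm] at this
  refine this.trans ?_
  gcongr

theorem tendsto_eLpNorm_of_pointwise {F : Type*} [NormedAddCommGroup F]
    [CompleteSpace F] {q : ℝ≥0∞} (hq : 1 ≤ q) {D : Set Plane} (hD : MeasurableSet D)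
    {h : ℕ → Plane → F} {h' : Plane → F} (hh : ∀ n, MemLp (h n) q (volume.restrict D))
    {B : ℕ → ℝ≥0∞} (hB : ∑' n, B n ≠ ⊤)
    (hc : ∀ N n k, N ≤ n → N ≤ k → eLpNorm (h n - h k) q (volume.restrict D) < B N)
    (hp : ∀ y ∈ D, Tendsto (fun n => h n y) atTop (𝓝 (h' y))) :
    MemLp h' q (volume.restrict D) ∧
      Tendsto (fun n => eLpNorm (h n - h') q (volume.restrict D)) atTop (𝓝 0) := by
  obtain ⟨g, hg, hl⟩ := Lp.cauchy_complete_eLpNorm hq hh hB hc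
  obtain ⟨ns, hns, hae⟩ := (tendstoInMeasure_of_tendsto_eLpNorm
    (by rintro rfl; simp at hq) (fun n => (hh n).1) hg.1 hl).exists_seq_tendsto_ae
  have e1 : g =ᵐ[volume.restrict D] h' := by
    filter_upwards [hae, ae_restrict_mem hD] with y hy hyD
    exact tendsto_nhds_unique hy ((hp y hyD).comp hns.tendsto_atTop)
  refine ⟨hg.ae_eq e1, hl.congr fun n => eLpNorm_congr_ae (EventuallyEq.rfl.sub e1)⟩

instance : CompleteSpace (Sobolev 𝔄 m p) := by
  have hp : 1 < p := Fact.out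
  have hq := one_le_ofReal hp
  refine Metric.complete_of_convergent_controlled_sequences (fun n => (1 / 2 : ℝ) ^ n)
    (fun n => by positivity) fun u hu => ?_
  have hcau : CauchySeq u := by
    refine Metric.cauchySeq_iff.2 fun ε hε => ?_
    obtain ⟨N, hN⟩ := exists_pow_lt_of_lt_one hε (show (1 / 2 : ℝ) < 1 by norm_num)
    exact ⟨N, fun n hn k hk => (hu N n k hn hk).trans hN⟩
  set B : ℕ → ℝ≥0∞ := fun n => ENNReal.ofReal ((1 / 2 : ℝ) ^ n) with hBdef
  have hB : ∑' n, B n ≠ ⊤ := by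
    rw [hBdef, ← ENNReal.ofReal_tsum_of_nonneg (fun n => by positivity)
      (summable_geometric_of_lt_one (by norm_num) (by norm_num))]
    exact ENNReal.ofReal_ne_top
  have toB : ∀ {a : ℝ≥0∞} {N n k : ℕ}, a ≠ ⊤ → N ≤ n → N ≤ k → a.toReal ≤ ‖u n - u k‖ → a < B N := by
    intro a N n k ha hn hk h
    rw [ENNReal.lt_ofReal_iff_toReal_lt ha]
    exact h.trans_lt ((dist_eq_norm (u n) (u k)) ▸ hu N n k hn hk)
  -- the pointwise limit
  have hex : ∀ x : S, ∃ z, Tendsto (fun n => (u n).1 x) atTop (𝓝 z) := fun x => by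
    obtain ⟨i, hx, hxi⟩ := 𝔄.covers x
    have := hcau.map (evalCLM 𝔄 m p (show 𝔄.chart i x ∈ 𝔄.disc i from hxi)).uniformContinuous
    obtain ⟨z, hz⟩ := cauchySeq_tendsto_of_complete this
    refine ⟨z, hz.congr fun n => ?_⟩
    simp [DiscCover.loc, hx]
  choose Ψ hΨ using hex
  have hloc : ∀ i, ∀ y, Tendsto (fun n => 𝔄.loc i (u n).1 y) atTop (𝓝 (𝔄.loc i Ψ y)) :=
    fun i y => hΨ _
  have hexD : ∀ i, ∀ y : Plane, ∃ L : Plane →L[ℝ] Euc m, y ∈ 𝔄.disc i →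
      Tendsto (fun n => fderiv ℝ (𝔄.loc i (u n).1) y) atTop (𝓝 L) := fun i y => by
    by_cases hy : y ∈ 𝔄.disc i
    · obtain ⟨L, hL⟩ := cauchySeq_tendsto_of_complete
        ((fderivCLM 𝔄 m p hy).uniformContinuous.comp_cauchySeq hcau)
      exact ⟨L, fun _ => hL⟩
    · exact ⟨0, fun h => absurd h hy⟩
  choose L hL using hexD
  have hunif : ∀ i, TendstoLocallyUniformlyOn (fun n => fderiv ℝ (𝔄.loc i (u n).1)) (L i) atTop
      (𝔄.disc i) := fun i => by
    refine tendstoLocallyUniformlyOn_of_forall_exists_nhds fun y hy => ?_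
    obtain ⟨ρ, hρ, hb⟩ := exists_ball_subset_disc hy
    obtain ⟨C, hC0, hC⟩ := exists_C1_bound (p := p) 𝔄 m hp hρ
    refine ⟨Metric.ball y ρ ∩ 𝔄.disc i, inter_mem (nhdsWithin_le_nhds (Metric.ball_mem_nhds y hρ))
      self_mem_nhdsWithin, ?_⟩
    refine UniformCauchySeqOn.tendstoUniformlyOn_of_tendsto ?_ fun z hz => hL i z hz.2
    rw [Metric.uniformCauchySeqOn_iff]
    intro ε hε
    obtain ⟨N, hN⟩ := Metric.cauchySeq_iff.1 hcau (ε / (C + 1)) (by positivity)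
    refine ⟨N, fun a ha b hb' z hz => ?_⟩
    have h1 := (hC i z (hb z hz.1) (u a - u b)).2
    have h2 := (fderivCLM 𝔄 m p hz.2).map_sub (u a) (u b)
    simp only [fderivCLM_apply] at h2
    have h3 := hN a ha b hb'
    rw [dist_eq_norm] at h3
    rw [dist_eq_norm, ← h2]
    calc _ ≤ C * ‖u a - u b‖ := h1
      _ ≤ (C + 1) * ‖u a - u b‖ := mul_le_mul_of_nonneg_right (by linarith) (norm_nonneg _)
      _ < (C + 1) * (ε / (C + 1)) := by gcongr
      _ = ε := by field_simp
  have hder : ∀ i, ∀ y ∈ 𝔄.disc i, HasFDerivAt (𝔄.loc i Ψ) (L i y) y := fun i y hy =>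
    hasFDerivAt_of_tendstoLocallyUniformlyOn (𝔄.isOpen_disc i) (hunif i)
      (fun n z hz => (differentiableAt_loc (u n) hz).hasFDerivAt) (fun z _ => hloc i z) hy
  have hC1 : ∀ i, ContDiffOn ℝ 1 (𝔄.loc i Ψ) (𝔄.disc i) := fun i => by
    have hcL : ContinuousOn (L i) (𝔄.disc i) := (hunif i).continuousOn
      (Frequently.of_forall fun n =>
        (contDiffOn_loc_disc (u n) i).continuousOn_fderiv_of_isOpen (𝔄.isOpen_disc i) le_rfl)
    rw [show (1 : ℕ∞ω) = 0 + 1 from rfl, contDiffOn_succ_iff_fderiv_of_isOpen (𝔄.isOpen_disc i)]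
    refine ⟨fun y hy => (hder i y hy).differentiableAt.differentiableWithinAt, by simp, ?_⟩
    rw [contDiffOn_zero]
    exact hcL.congr fun y hy => (hder i y hy).fderiv
  have hΨ1 : ContMDiff (𝓡 2) 𝓘(ℝ, Euc m) 1 Ψ := fun x => by
    obtain ⟨i, hx, hxi⟩ := 𝔄.covers x
    have h1 : ContMDiffAt (𝓡 2) (𝓡 2) 1 (𝔄.chart i) x :=
      ((contMDiffOn_of_mem_maximalAtlas (𝔄.chart_mem i)).contMDiffAt
        ((𝔄.chart i).open_source.mem_nhds hx)).of_le (by exact_mod_cast le_top)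
    have h2 : ContMDiffAt (𝓡 2) 𝓘(ℝ, Euc m) 1 (𝔄.loc i Ψ) (𝔄.chart i x) :=
      ((hC1 i).contDiffAt ((𝔄.isOpen_disc i).mem_nhds hxi)).contMDiffAt
    refine (h2.comp x h1).congr_of_eventuallyEq ?_
    filter_upwards [(𝔄.chart i).open_source.mem_nhds hx] with z hz
    simp [DiscCover.loc, hz]
  -- convergence in `L^q` of the derivatives of order at most two
  have l0 : ∀ i, MemLp (𝔄.loc i Ψ) (ENNReal.ofReal (2 * p)) (volume.restrict (𝔄.disc i)) ∧
      Tendsto (fun n => eLpNorm (𝔄.loc i (u n).1 - 𝔄.loc i Ψ) (ENNReal.ofReal (2 * p))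
        (volume.restrict (𝔄.disc i))) atTop (𝓝 0) := fun i =>
    tendsto_eLpNorm_of_pointwise hq (𝔄.isOpen_disc i).measurableSet (fun n => memLp_loc (u n) i) hB
      (fun N n k hn hk => toB ((memLp_loc (u n) i).sub (memLp_loc (u k) i)).2.ne hn hk
        (eLpNorm_loc_le_norm (u n - u k) i)) (fun y _ => hloc i y)
  have l1 : ∀ i j, MemLp (pd j (𝔄.loc i Ψ)) (ENNReal.ofReal (2 * p)) (volume.restrict (𝔄.disc i)) ∧
      Tendsto (fun n => eLpNorm (pd j (𝔄.loc i (u n).1) - pd j (𝔄.loc i Ψ)) (ENNReal.ofReal (2 * p))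
        (volume.restrict (𝔄.disc i))) atTop (𝓝 0) := fun i j =>
    tendsto_eLpNorm_of_pointwise hq (𝔄.isOpen_disc i).measurableSet (fun n => memLp_pd (u n) i j) hB
      (fun N n k hn hk => toB ((memLp_pd (u n) i j).sub (memLp_pd (u k) i j)).2.ne hn hk
        (eLpNorm_pd_sub_le (u n) (u k) i j)) (fun y hy => by
        simp only [pd, (hder i y hy).fderiv]
        exact ((ContinuousLinearMap.apply ℝ (Euc m) (e j)).continuous.tendsto _).comp (hL i y hy))
  have l2 : ∀ i k j, ∃ g, MemLp g (ENNReal.ofReal (2 * p)) (volume.restrict (𝔄.disc i)) ∧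
      Tendsto (fun n => eLpNorm (weak2 i k j (u n) - g) (ENNReal.ofReal (2 * p))
        (volume.restrict (𝔄.disc i))) atTop (𝓝 0) := fun i k j =>
    Lp.cauchy_complete_eLpNorm hq (fun n => memLp_weak2 (u n) i k j) hB
      (fun N n k' hn hk => toB ((memLp_weak2 (u n) i k j).sub (memLp_weak2 (u k') i k j)).2.ne hn hk
        (eLpNorm_weak2_sub_le (u n) (u k') i k j))
  choose g hg hgl using l2
  have hw : ∀ i k j, IsWeakPartial (𝔄.disc i) k (pd j (𝔄.loc i Ψ)) (g i k j) := fun i k j => by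
    have c1 : ContinuousOn (pd j (𝔄.loc i Ψ)) (𝔄.disc i) :=
      ((hC1 i).continuousOn_fderiv_of_isOpen (𝔄.isOpen_disc i) le_rfl).clm_apply continuousOn_const
    refine IsWeakPartial.of_approx (c1.locallyIntegrableOn (𝔄.isOpen_disc i).measurableSet) ?_
      fun K hKD hK => ⟨fun n => pd j (𝔄.loc i (u n).1), fun n => weak2 i k j (u n),
        fun n => isWeakPartial_pd (u n) i k j,
        tendsto_setLIntegral_of_tendsto_eLpNorm hq hK hKD (fun n => memLp_pd (u n) i j) (l1 i j).1
          (l1 i j).2,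
        tendsto_setLIntegral_of_tendsto_eLpNorm hq hK hKD (fun n => memLp_weak2 (u n) i k j)
          (hg i k j) (hgl i k j)⟩
    rw [locallyIntegrableOn_iff (𝔄.isOpen_disc i).isLocallyClosed]
    intro K hKD hK
    have h1 : MemLp (g i k j) (ENNReal.ofReal (2 * p)) (volume.restrict K) :=
      (hg i k j).mono_measure (Measure.restrict_mono hKD le_rfl)
    have : IsFiniteMeasure (volume.restrict K) :=
      ⟨by rw [Measure.restrict_apply_univ]; exact hK.measure_lt_top⟩
    exact h1.integrable hq
  let Ψ' : Sobolev 𝔄 m p := ⟨Ψ, hΨ1, fun i => ⟨(l0 i).1, fun j => ⟨pd j (𝔄.loc i Ψ),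
    isWeakPartial_of_contDiffOn (𝔄.isOpen_disc i) (hC1 i) j, (l1 i j).1,
    fun k => ⟨g i k j, hw i k j, hg i k j⟩⟩⟩⟩
  refine ⟨Ψ', ?_⟩
  rw [tendsto_iff_norm_sub_tendsto_zero]
  have toR : ∀ {a : ℕ → ℝ≥0∞}, Tendsto a atTop (𝓝 0) →
      Tendsto (fun n => (a n).toReal) atTop (𝓝 0) := fun h => by
    exact ENNReal.toReal_zero ▸ (ENNReal.tendsto_toReal ENNReal.zero_ne_top).comp h
  have : Tendsto (fun n => ‖u n - Ψ'‖) atTop (𝓝 (∑ i : Fin 𝔄.card, ((0 : ℝ) + ∑ j : Fin 2, (0 : ℝ)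
      + ∑ j : Fin 2, ∑ k : Fin 2, (0 : ℝ)))) := by
    simp only [fun n => norm_eq_sum (u n - Ψ')]
    refine tendsto_finsetSum _ fun i _ => ((toR (l0 i).2).add (tendsto_finsetSum _ fun j _ => ?_)).add
      (tendsto_finsetSum _ fun j _ => tendsto_finsetSum _ fun k _ => ?_)
    · refine toR ((l1 i j).2.congr fun n => eLpNorm_congr_ae
        ((ae_restrict_iff' (𝔄.isOpen_disc i).measurableSet).2 (Eventually.of_forall fun y hy => ?_)))
      exact (pd_sub (u n) Ψ' hy j).symm
    · refine toR ((hgl i k j).congr fun n => eLpNorm_congr_ae ?_)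
      refine EventuallyEq.trans ?_ (weak2_sub_ae (u n) Ψ' i k j).symm
      exact EventuallyEq.rfl.sub ((hw i k j).unique (𝔄.isOpen_disc i) (isWeakPartial_pd Ψ' i k j))
  simpa using this

end SobolevSpace


/-! ### The tangent projection of the target -/

section Target

variable {m k n : ℕ}

theorem tangentAt_eq_ker {N U : Set (Euc m)} (hU : IsOpen U) {G : Euc m → Euc k}
    (hG : ContDiffOn ℝ ∞ G U) (hs : ∀ y ∈ U, Function.Surjective (fderiv ℝ G y))
    (hN : N ∩ U = {y ∈ U | G y = 0}) {z : Euc m} (hz : z ∈ N) (hzU : z ∈ U) :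
    tangentAt N z = (fderiv ℝ G z).ker := by
  have hGz : ContDiffAt ℝ ∞ G z := hG.contDiffAt (hU.mem_nhds hzU)
  have hG0 : ∀ y ∈ N, y ∈ U → G y = 0 := fun y hy hyU => (hN.subset ⟨hy, hyU⟩).2
  apply le_antisymm
  · refine Submodule.span_le.2 ?_
    rintro w ⟨γ, h0, hγ, hd⟩
    have h1 : HasDerivAt (fun t => G (γ t)) (fderiv ℝ G z w) 0 := by
      have hGd := (hGz.differentiableAt (by simp)).hasFDerivAt
      rw [← h0] at hGd
      have := hGd.comp_hasDerivAt (0 : ℝ) hd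
      rw [h0] at this
      exact this
    have h2 : (fun t => G (γ t)) =ᶠ[𝓝 0] fun _ => 0 := by
      have : ∀ᶠ t in 𝓝 (0 : ℝ), γ t ∈ U := hd.continuousAt.eventually_mem
        (by rw [h0]; exact hU.mem_nhds hzU)
      filter_upwards [hγ, this] with t ht1 ht2 using hG0 _ ht1 ht2
    exact h1.unique ((hasDerivAt_const (0 : ℝ) (0 : Euc k)).congr_of_eventuallyEq h2)
  · intro w hw
    have hst : HasStrictFDerivAt G (fderiv ℝ G z) z := hGz.hasStrictFDerivAt (by simp)
    have hr : (fderiv ℝ G z).range = ⊤ := LinearMap.range_eq_top.2 (hs z hzU)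
    set φ := hst.implicitFunction G (fderiv ℝ G z) hr with hφ
    have e0 : φ (G z) 0 = z := hst.implicitFunction_apply_image hr
    have e1 := hst.map_implicitFunction_eq hr
    have e2 : HasFDerivAt (φ (G z)) (fderiv ℝ G z).ker.subtypeL 0 :=
      (hst.to_implicitFunction hr).hasFDerivAt
    set w' : (fderiv ℝ G z).ker := ⟨w, hw⟩
    have hl : HasDerivAt (fun t : ℝ => t • w') w' 0 := by
      simpa using (hasDerivAt_id (0 : ℝ)).smul_const w'
    have hd : HasDerivAt (fun t : ℝ => φ (G z) (t • w')) w 0 := by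
      have e2' : HasFDerivAt (φ (G z)) (fderiv ℝ G z).ker.subtypeL ((0 : ℝ) • w') := by
        rwa [zero_smul]
      exact e2'.comp_hasDerivAt (0 : ℝ) hl
    refine Submodule.subset_span ⟨fun t => φ (G z) (t • w'), by simp [e0], ?_, hd⟩
    have t1 : Tendsto (fun t : ℝ => (G z, t • w')) (𝓝 0) (𝓝 (G z, 0)) := by
      refine tendsto_const_nhds.prodMk_nhds ?_
      simpa using hl.continuousAt.tendsto
    have t2 : ∀ᶠ t in 𝓝 (0 : ℝ), φ (G z) (t • w') ∈ U := hd.continuousAt.eventually_mem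
      (by simp only [zero_smul, e0]; exact hU.mem_nhds hzU)
    filter_upwards [t1.eventually e1, t2] with t ht1 ht2
    have : φ (G z) (t • w') ∈ {y ∈ U | G y = 0} := ⟨ht2, by
      rw [hφ]
      refine ht1.trans (hG0 z hz hzU)⟩
    rw [← hN] at this
    exact this.1

theorem isUnit_comp_adjoint {A : Euc m →L[ℝ] Euc k} (hA : Function.Surjective A) :
    IsUnit (A.comp (ContinuousLinearMap.adjoint A)) := by
  rw [ContinuousLinearMap.isUnit_iff_bijective]
  have hinj : Function.Injective (A.comp (ContinuousLinearMap.adjoint A)) := by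
    rw [injective_iff_map_eq_zero]
    intro x hx
    have h1 : ContinuousLinearMap.adjoint A x = 0 := by
      rw [← inner_self_eq_zero (𝕜 := ℝ), ContinuousLinearMap.adjoint_inner_left]
      rw [ContinuousLinearMap.comp_apply] at hx
      rw [hx, inner_zero_right]
    obtain ⟨y, rfl⟩ := hA x
    rw [← inner_self_eq_zero (𝕜 := ℝ), ← ContinuousLinearMap.adjoint_inner_left, h1,
      inner_zero_left]
  exact ⟨hinj, (LinearMap.injective_iff_surjective (f := (A.comp
    (ContinuousLinearMap.adjoint A)).toLinearMap)).1 hinj⟩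

/-- The orthogonal projection onto the kernel of a surjective operator `A` is
`1 - Aᵀ (A Aᵀ)⁻¹ A`. -/
theorem starProjection_ker {A : Euc m →L[ℝ] Euc k} (hA : Function.Surjective A) :
    A.ker.starProjection = ContinuousLinearMap.id ℝ (Euc m)
      - (ContinuousLinearMap.adjoint A).comp
        ((Ring.inverse (A.comp (ContinuousLinearMap.adjoint A))).comp A) := by
  ext1 w
  set B := Ring.inverse (A.comp (ContinuousLinearMap.adjoint A)) with hB
  have hAB : ∀ y, A (ContinuousLinearMap.adjoint A (B y)) = y := fun y => by
    have := Ring.mul_inverse_cancel _ (isUnit_comp_adjoint hA)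
    exact DFunLike.congr_fun this y
  refine Submodule.eq_starProjection_of_mem_orthogonal ?_ ?_
  · change A (w - ContinuousLinearMap.adjoint A (B (A w))) = 0
    rw [map_sub, hAB, sub_self]
  · change w - (w - ContinuousLinearMap.adjoint A (B (A w))) ∈ _
    rw [sub_sub_cancel, Submodule.mem_orthogonal]
    intro x hx
    rw [ContinuousLinearMap.adjoint_inner_right]
    have : A x = 0 := hx
    rw [this, inner_zero_left]

theorem contDiff_adjoint : ContDiff ℝ ∞
    (fun A : Euc m →L[ℝ] Euc k => ContinuousLinearMap.adjoint A) := by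
  let T : (Euc m →L[ℝ] Euc k) →ₗ[ℝ] (Euc k →L[ℝ] Euc m) :=
    { toFun := fun A => ContinuousLinearMap.adjoint A
      map_add' := fun A B => map_add _ A B
      map_smul' := fun c A => by simp }
  exact (LinearMap.toContinuousLinearMap T).contDiff

/-- The tangent projection of a closed submanifold extends to a smooth map on the whole Euclidean
space. -/
theorem exists_smooth_tangentProj {N : Set (Euc m)} (hN : IsClosedSubmanifold n N) :
    ∃ Q : Euc m → Euc m →L[ℝ] Euc m, ContDiff ℝ ∞ Q ∧ ∀ z ∈ N, Q z = tangentProj N z := by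
  obtain ⟨hc, k, -, hloc⟩ := hN
  obtain ⟨Q, hQ⟩ := exists_contMDiffMap_forall_mem_convex_of_local (n := ⊤) 𝓘(ℝ, Euc m)
    (F := Euc m →L[ℝ] Euc m)
    (t := fun z => {L : Euc m →L[ℝ] Euc m | z ∈ N → L = tangentProj N z}) (fun z => by
      by_cases hz : z ∈ N
      · simpa [hz] using convex_singleton (𝕜 := ℝ) (tangentProj N z)
      · simp [hz, convex_univ]) (fun z => by
      by_cases hz : z ∈ N
      · obtain ⟨U, hU, hzU, G, hG, hs, hNU⟩ := hloc z hz
        refine ⟨U, hU.mem_nhds hzU, fun y => ContinuousLinearMap.id ℝ (Euc m)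
          - (ContinuousLinearMap.adjoint (fderiv ℝ G y)).comp
          ((Ring.inverse ((fderiv ℝ G y).comp (ContinuousLinearMap.adjoint (fderiv ℝ G y)))).comp
            (fderiv ℝ G y)), ?_, fun y hy hyN => ?_⟩
        · rw [contMDiffOn_iff_contDiffOn]
          have h1 : ContDiffOn ℝ ∞ (fderiv ℝ G) U := hG.fderiv_of_isOpen hU (by simp)
          have h2 := contDiff_adjoint.comp_contDiffOn h1
          have h3 : ContDiffOn ℝ ∞ (fun y => Ring.inverse ((fderiv ℝ G y).comp
              (ContinuousLinearMap.adjoint (fderiv ℝ G y)))) U := by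
            intro y hy
            obtain ⟨u, hu⟩ := isUnit_comp_adjoint (hs y hy)
            have h4 := contDiffAt_ringInverse ℝ (n := ∞) u
            rw [hu] at h4
            exact h4.comp_contDiffWithinAt y ((h1.clm_comp h2) y hy)
          exact contDiffOn_const.sub (h2.clm_comp (h3.clm_comp h1))
        · simp only [tangentProj, tangentAt_eq_ker hU hG hs hNU hyN hy]
          exact (starProjection_ker (hs y hy)).symm
      · exact ⟨Nᶜ, hc.isClosed.isOpen_compl.mem_nhds hz, fun _ => 0, contMDiffOn_const,
          fun y hy h => absurd h hy⟩)
  exact ⟨Q, Q.contMDiff.contDiff, hQ⟩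

end Target


/-! ### Algebra of the first fundamental form -/

section Gram

variable {m : ℕ} {u v : Plane → Euc m} {y : Plane} {lam Lam : ℝ}

/-- The differential of `u` at `y` distorts squared lengths at least by the factor `lam` and at most
by the factor `Lam`. -/
def GramBound (lam Lam : ℝ) (u : Plane → Euc m) (y : Plane) : Prop :=
  ∀ X : Plane, lam * ‖X‖ ^ 2 ≤ ‖fderiv ℝ u y X‖ ^ 2 ∧ ‖fderiv ℝ u y X‖ ^ 2 ≤ Lam * ‖X‖ ^ 2

theorem norm_sq_combination {V : Type*} [NormedAddCommGroup V] [InnerProductSpace ℝ V] (s t : ℝ)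
    (a b : V) : ‖s • a + t • b‖ ^ 2 = s ^ 2 * ⟪a, a⟫_ℝ + 2 * s * t * ⟪a, b⟫_ℝ + t ^ 2 * ⟪b, b⟫_ℝ := by
  rw [norm_add_sq_real, norm_smul, norm_smul, inner_smul_left, inner_smul_right, mul_pow, mul_pow,
    real_inner_self_eq_norm_sq, real_inner_self_eq_norm_sq, Real.norm_eq_abs, Real.norm_eq_abs, sq_abs,
    sq_abs]
  simp
  ring

theorem fderiv_eq_sum (u : Plane → Euc m) (y X : Plane) :
    fderiv ℝ u y X = X 0 • pd 0 u y + X 1 • pd 1 u y := by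
  conv_lhs => rw [plane_eq_sum X]
  simp [pd]

theorem norm_fderiv_sq (u : Plane → Euc m) (y X : Plane) : ‖fderiv ℝ u y X‖ ^ 2
    = X 0 ^ 2 * gram u y 0 0 + 2 * X 0 * X 1 * gram u y 0 1 + X 1 ^ 2 * gram u y 1 1 := by
  rw [fderiv_eq_sum, norm_sq_combination]
  rfl

theorem gram_apply (u : Plane → Euc m) (y : Plane) (i j : Fin 2) :
    gram u y i j = ⟪pd i u y, pd j u y⟫_ℝ := rfl

theorem gram_symm (u : Plane → Euc m) (y : Plane) : gram u y 1 0 = gram u y 0 1 := by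
  rw [gram_apply, gram_apply, real_inner_comm]

theorem norm_sq_plane (X : Plane) : ‖X‖ ^ 2 = X 0 ^ 2 + X 1 ^ 2 := by
  rw [EuclideanSpace.norm_sq_eq]; simp

theorem norm_e (j : Fin 2) : ‖e j‖ = 1 := by simp [e]

namespace GramBound

theorem diag (h : GramBound lam Lam u y) (j : Fin 2) :
    lam ≤ gram u y j j ∧ gram u y j j ≤ Lam := by
  have := h (e j)
  rw [norm_e, one_pow, mul_one, mul_one] at this
  have e1 : gram u y j j = ‖fderiv ℝ u y (e j)‖ ^ 2 := by
    rw [gram_apply, real_inner_self_eq_norm_sq]; rfl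
  rwa [e1]

theorem norm_pd_le (h : GramBound lam Lam u y) (j : Fin 2) : ‖pd j u y‖ ≤ √Lam := by
  refine Real.le_sqrt_of_sq_le ?_
  rw [← real_inner_self_eq_norm_sq, ← gram_apply]
  exact (h.diag j).2

theorem nonneg_right (h : GramBound lam Lam u y) : 0 ≤ Lam :=
  (show 0 ≤ gram u y 0 0 from by rw [gram_apply]; exact real_inner_self_nonneg).trans (h.diag 0).2

theorem det_ge (h : GramBound lam Lam u y) (hl : 0 < lam) :
    lam ^ 2 ≤ gram u y 0 0 * gram u y 1 1 - gram u y 0 1 ^ 2 := by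
  have h1 := (h (!₂[-gram u y 0 1, gram u y 0 0])).1
  rw [norm_fderiv_sq, norm_sq_plane] at h1
  simp at h1
  have h2 := (h.diag 0).1
  set a := gram u y 0 0
  set b := gram u y 0 1
  set d := gram u y 1 1
  have h3 : a * (lam * a) ≤ a * (a * d - b ^ 2) := by nlinarith [sq_nonneg b]
  have h4 : lam * a ≤ a * d - b ^ 2 := le_of_mul_le_mul_left h3 (by linarith)
  nlinarith

theorem det_pos (h : GramBound lam Lam u y) (hl : 0 < lam) :
    0 < gram u y 0 0 * gram u y 1 1 - gram u y 0 1 ^ 2 :=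
  (by positivity : (0 : ℝ) < lam ^ 2).trans_le (h.det_ge hl)

theorem det_eq (u : Plane → Euc m) (y : Plane) :
    (gram u y).det = gram u y 0 0 * gram u y 1 1 - gram u y 0 1 ^ 2 := by
  rw [Matrix.det_fin_two, gram_symm]; ring

theorem le_volDensity (h : GramBound lam Lam u y) (hl : 0 < lam) : lam ≤ volDensity u y := by
  refine Real.le_sqrt_of_sq_le ?_
  rw [det_eq]
  exact h.det_ge hl

theorem inv_eq (u : Plane → Euc m) (y : Plane) : (gram u y)⁻¹
    = !![gram u y 1 1 / (gram u y).det, -gram u y 0 1 / (gram u y).det;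
        -gram u y 0 1 / (gram u y).det, gram u y 0 0 / (gram u y).det] := by
  rw [Matrix.inv_def, Matrix.adjugate_fin_two, Ring.inverse_eq_inv']
  ext i j
  fin_cases i <;> fin_cases j <;> simp [gram_symm, div_eq_inv_mul]

theorem abs_inv_le (h : GramBound lam Lam u y) (hl : 0 < lam) (i j : Fin 2) :
    |(gram u y)⁻¹ i j| ≤ Lam / lam ^ 2 := by
  have hd := h.det_ge hl
  have hb : |gram u y 0 1| ≤ Lam := by
    calc |gram u y 0 1| ≤ ‖pd 0 u y‖ * ‖pd 1 u y‖ := by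
          rw [gram_apply]; exact abs_real_inner_le_norm _ _
      _ ≤ √Lam * √Lam := by
          gcongr
          · exact h.norm_pd_le 0
          · exact h.norm_pd_le 1
      _ = Lam := Real.mul_self_sqrt h.nonneg_right
  have ha : ∀ j, |gram u y j j| ≤ Lam := fun j => by
    rw [abs_of_nonneg (hl.le.trans (h.diag j).1)]; exact (h.diag j).2
  have key : ∀ t : ℝ, |t| ≤ Lam → |t / (gram u y).det| ≤ Lam / lam ^ 2 := fun t ht => by
    rw [abs_div, det_eq, abs_of_pos (h.det_pos hl)]
    exact div_le_div₀ h.nonneg_right ht (by positivity) hd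
  rw [inv_eq]
  fin_cases i <;> fin_cases j
  · exact key _ (ha 1)
  · exact key _ (by rwa [abs_neg])
  · exact key _ (by rwa [abs_neg])
  · exact key _ (ha 0)

variable {V : Type*} [NormedAddCommGroup V] [InnerProductSpace ℝ V]

/-- Cauchy–Schwarz inequality for a linear form and the dual metric: for vectors `w₀`, `w₁`,
`|X⁰ w₀ + X¹ w₁|² ≤ |X|²_g g^{kl} ⟨w_k, w_l⟩`. -/
theorem norm_sq_le_mul_form (h : GramBound lam Lam u y) (hl : 0 < lam) (w : Fin 2 → V) (X : Plane) :
    ‖X 0 • w 0 + X 1 • w 1‖ ^ 2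
      ≤ ‖fderiv ℝ u y X‖ ^ 2 * ∑ k, ∑ l, (gram u y)⁻¹ k l * ⟪w k, w l⟫_ℝ := by
  have hd := h.det_pos hl
  have h0 : 0 ≤ ‖(gram u y 1 1 * X 1 + gram u y 0 1 * X 0) • w 0
    + (-(gram u y 0 0 * X 0 + gram u y 0 1 * X 1)) • w 1‖ ^ 2 / (gram u y).det := by
    rw [det_eq]; positivity
  rw [← sub_nonneg]
  refine h0.trans (le_of_eq ?_)
  rw [norm_sq_combination, norm_sq_combination, norm_fderiv_sq, inv_eq]
  simp only [Fin.sum_univ_two, Matrix.of_apply, Matrix.cons_val', Matrix.cons_val_zero,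
    Matrix.cons_val_one, Matrix.cons_val_fin_one, real_inner_comm (w 0) (w 1)]
  have hdet := det_eq u y
  have hne : (gram u y).det ≠ 0 := by rw [hdet]; exact hd.ne'
  generalize (gram u y).det = D at hdet hne ⊢
  field_simp
  rw [hdet]
  ring

theorem form_nonneg (h : GramBound lam Lam u y) (hl : 0 < lam) (w : Fin 2 → V) :
    0 ≤ ∑ k, ∑ l, (gram u y)⁻¹ k l * ⟪w k, w l⟫_ℝ := by
  have h1 := h.norm_sq_le_mul_form hl w (e 0)
  have h2 : 0 < ‖fderiv ℝ u y (e 0)‖ ^ 2 :=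
    lt_of_lt_of_le (by rw [norm_e]; simpa using hl) (h (e 0)).1
  by_contra h3
  push Not at h3
  nlinarith [sq_nonneg ‖(e 0 : Plane) 0 • w 0 + (e 0 : Plane) 1 • w 1‖]

theorem norm_sq_le_form (h : GramBound lam Lam u y) (hl : 0 < lam) (w : Fin 2 → V) (j : Fin 2) :
    ‖w j‖ ^ 2 ≤ Lam * ∑ k, ∑ l, (gram u y)⁻¹ k l * ⟪w k, w l⟫_ℝ := by
  have h1 := h.norm_sq_le_mul_form hl w (e j)
  have h2 : (e j : Plane) 0 • w 0 + (e j : Plane) 1 • w 1 = w j := by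
    fin_cases j <;> simp [e]
  rw [h2] at h1
  refine h1.trans (mul_le_mul_of_nonneg_right ?_ (h.form_nonneg hl w))
  have := (h (e j)).2
  rwa [norm_e, one_pow, mul_one] at this

theorem norm_sq_le_form₂ (h : GramBound lam Lam u y) (hl : 0 < lam) (b : Fin 2 → Fin 2 → V)
    (i k : Fin 2) : ‖b i k‖ ^ 2 ≤ Lam ^ 2 * ∑ i, ∑ j, ∑ k, ∑ l,
      (gram u y)⁻¹ i j * (gram u y)⁻¹ k l * ⟪b i k, b j l⟫_ℝ := by
  have hd := h.det_pos hl
  -- reduce to the single form, applied to the rows of `b`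
  have row : ∀ i, ∑ k, ∑ l, (gram u y)⁻¹ k l * ⟪b i k, b i l⟫_ℝ ≤ gram u y i i * ∑ i, ∑ j, ∑ k, ∑ l,
      (gram u y)⁻¹ i j * (gram u y)⁻¹ k l * ⟪b i k, b j l⟫_ℝ := by
    intro i
    have h0 := h.form_nonneg hl (fun k => (gram u y i 1) • b 0 k + (-gram u y i 0) • b 1 k)
    have h1 : 0 ≤ (∑ k, ∑ l, (gram u y)⁻¹ k l * ⟪(gram u y i 1) • b 0 k + (-gram u y i 0) • b 1 k,
      (gram u y i 1) • b 0 l + (-gram u y i 0) • b 1 l⟫_ℝ) / (gram u y).det := by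
      rw [det_eq]; exact div_nonneg h0 hd.le
    rw [← sub_nonneg]
    refine h1.trans (le_of_eq ?_)
    rw [inv_eq]
    have hdet := det_eq u y
    have hne : (gram u y).det ≠ 0 := by rw [hdet]; exact hd.ne'
    generalize (gram u y).det = D at hdet hne ⊢
    have c1 := real_inner_comm (b 0 0) (b 0 1)
    have c2 := real_inner_comm (b 0 0) (b 1 0)
    have c3 := real_inner_comm (b 0 1) (b 1 0)
    have c4 := real_inner_comm (b 0 0) (b 1 1)
    have c5 := real_inner_comm (b 0 1) (b 1 1)
    have c6 := real_inner_comm (b 1 0) (b 1 1)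
    fin_cases i <;>
    simp only [Fin.zero_eta, Fin.mk_one, gram_symm, Fin.sum_univ_two, Matrix.of_apply,
      Matrix.cons_val', Matrix.cons_val_zero, Matrix.cons_val_one, Matrix.cons_val_fin_one,
      inner_add_left, inner_add_right, inner_smul_left, inner_smul_right, conj_trivial,
      c1, c2, c3, c4, c5, c6] <;>
    field_simp <;> rw [hdet] <;> ring
  have hrow0 := h.form_nonneg hl (b i)
  have hT : 0 ≤ ∑ i, ∑ j, ∑ k, ∑ l, (gram u y)⁻¹ i j * (gram u y)⁻¹ k l * ⟪b i k, b j l⟫_ℝ := by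
    have hi := hl.trans_le (h.diag i).1
    by_contra h3
    push Not at h3
    have := row i
    nlinarith
  calc ‖b i k‖ ^ 2 ≤ Lam * ∑ k, ∑ l, (gram u y)⁻¹ k l * ⟪b i k, b i l⟫_ℝ := h.norm_sq_le_form hl (b i) k
    _ ≤ Lam * (Lam * ∑ i, ∑ j, ∑ k, ∑ l,
        (gram u y)⁻¹ i j * (gram u y)⁻¹ k l * ⟪b i k, b j l⟫_ℝ) := by
      refine mul_le_mul_of_nonneg_left ((row i).trans ?_) h.nonneg_right
      exact mul_le_mul_of_nonneg_right (h.diag i).2 hT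
    _ = _ := by ring

end GramBound

theorem norm_cov_sq_le (N : Set (Euc m)) (h : GramBound lam Lam u y) (hl : 0 < lam) (j : Fin 2) :
    ‖cov N u v j y‖ ^ 2 ≤ Lam * covNormSq N u v y :=
  h.norm_sq_le_form hl (fun k => cov N u v k y) j

theorem covNormSq_nonneg (N : Set (Euc m)) (h : GramBound lam Lam u y) (hl : 0 < lam) :
    0 ≤ covNormSq N u v y :=
  h.form_nonneg hl (fun k => cov N u v k y)

theorem norm_cov2_sq_le (N : Set (Euc m)) (U : Set Plane) (h : GramBound lam Lam u y) (hl : 0 < lam)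
    (i k : Fin 2) : ‖cov2 N U u v i k y‖ ^ 2 ≤ Lam ^ 2 * cov2NormSq N U u v y :=
  h.norm_sq_le_form₂ hl (fun i k => cov2 N U u v i k y) i k

theorem cov2NormSq_nonneg (N : Set (Euc m)) (U : Set Plane) (h : GramBound lam Lam u y)
    (hl : 0 < lam) : 0 ≤ cov2NormSq N U u v y := by
  have h1 := norm_cov2_sq_le (v := v) N U h hl 0 0
  have h2 : 0 < Lam := hl.trans_le ((h.diag 0).1.trans (h.diag 0).2)
  exact nonneg_of_mul_nonneg_right ((sq_nonneg _).trans h1) (by positivity)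

/-- `|∇_X v| ≤ |∇v|_g |X|_g`. -/
theorem norm_tangentProj_fderiv_sq_le (N : Set (Euc m)) (h : GramBound lam Lam u y) (hl : 0 < lam)
    (X : Plane) : ‖tangentProj N (u y) (fderiv ℝ v y X)‖ ^ 2
      ≤ ‖fderiv ℝ u y X‖ ^ 2 * covNormSq N u v y := by
  have := h.norm_sq_le_mul_form hl (fun k => cov N u v k y) X
  rw [fderiv_eq_sum v y X, map_add, map_smul, map_smul]
  exact this

end Gram


/-! ### Coordinate derivatives and covariant derivatives -/

section CovEstimate

variable {m : ℕ} {N : Set (Euc m)} {Q : Euc m → Euc m →L[ℝ] Euc m} {U : Set Plane}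
  {u v : Plane → Euc m} {lam Lam M B : ℝ}

theorem norm_tangentProj_le (N : Set (Euc m)) (z w : Euc m) : ‖tangentProj N z w‖ ≤ ‖w‖ :=
  Submodule.norm_starProjection_apply_le _ w

theorem tangentProj_idem (N : Set (Euc m)) (z w : Euc m) :
    tangentProj N z (tangentProj N z w) = tangentProj N z w :=
  Submodule.starProjection_eq_self_iff.2 (Submodule.starProjection_apply_mem _ w)

theorem tangentProj_of_mem {z w : Euc m} (h : w ∈ tangentAt N z) : tangentProj N z w = w :=
  Submodule.starProjection_eq_self_iff.2 h

/-- The derivative of a tangent field differs from its covariant derivative by the derivative of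
the projection applied to the field. -/
theorem fderiv_tangent (hU : IsOpen U) (hu : ContDiffOn ℝ 1 u U) (hv : ContDiffOn ℝ 1 v U)
    (huN : ∀ y ∈ U, u y ∈ N) (hQ : ContDiff ℝ ∞ Q) (hQN : ∀ z ∈ N, Q z = tangentProj N z)
    (hvt : ∀ y ∈ U, tangentProj N (u y) (v y) = v y) {y : Plane} (hy : y ∈ U) (X : Plane) :
    fderiv ℝ v y X = fderiv ℝ Q (u y) (fderiv ℝ u y X) (v y)
      + tangentProj N (u y) (fderiv ℝ v y X) := by
  have hud := (hu.differentiableOn one_ne_zero).differentiableAt (hU.mem_nhds hy)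
  have hvd := (hv.differentiableOn one_ne_zero).differentiableAt (hU.mem_nhds hy)
  have hQd : DifferentiableAt ℝ Q (u y) := hQ.differentiable (by simp) _
  have h1 : HasFDerivAt (fun z => Q (u z)) ((fderiv ℝ Q (u y)).comp (fderiv ℝ u y)) y :=
    hQd.hasFDerivAt.comp y hud.hasFDerivAt
  have h2 := h1.clm_apply hvd.hasFDerivAt
  have h3 : (fun z => Q (u z) (v z)) =ᶠ[𝓝 y] v := by
    filter_upwards [hU.mem_nhds hy] with z hz
    rw [hQN _ (huN z hz), hvt z hz]
  have h4 := (h2.congr_of_eventuallyEq h3.symm).fderiv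
  conv_lhs => rw [h4]
  simp [hQN _ (huN y hy), add_comm]

theorem norm_fderiv_tangent_le (hU : IsOpen U) (hu : ContDiffOn ℝ 1 u U) (hv : ContDiffOn ℝ 1 v U)
    (huN : ∀ y ∈ U, u y ∈ N) (hQ : ContDiff ℝ ∞ Q) (hQN : ∀ z ∈ N, Q z = tangentProj N z)
    (hvt : ∀ y ∈ U, tangentProj N (u y) (v y) = v y) (hl : 0 < lam)
    (hM : ∀ z ∈ N, ‖fderiv ℝ Q z‖ ≤ M) {y : Plane} (hy : y ∈ U) (hg : GramBound lam Lam u y)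
    (hB0 : 0 ≤ B) (hB : covNormSq N u v y ≤ B ^ 2) :
    ‖fderiv ℝ v y‖ ≤ √Lam * (M * ‖v y‖ + B) := by
  have hM0 : 0 ≤ M := (norm_nonneg (fderiv ℝ Q (u y))).trans (hM _ (huN y hy))
  refine ContinuousLinearMap.opNorm_le_bound _ (by positivity) fun X => ?_
  have hX : ‖fderiv ℝ u y X‖ ≤ √Lam * ‖X‖ := by
    refine abs_le_of_sq_le_sq' ?_ (by positivity) |>.2
    rw [mul_pow, Real.sq_sqrt hg.nonneg_right]
    exact (hg X).2
  have h1 : ‖tangentProj N (u y) (fderiv ℝ v y X)‖ ≤ ‖fderiv ℝ u y X‖ * B := by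
    refine abs_le_of_sq_le_sq' ?_ (by positivity) |>.2
    rw [mul_pow]
    exact (norm_tangentProj_fderiv_sq_le N hg hl X).trans (by gcongr)
  rw [fderiv_tangent hU hu hv huN hQ hQN hvt hy X]
  calc _ ≤ ‖fderiv ℝ Q (u y) (fderiv ℝ u y X) (v y)‖
        + ‖tangentProj N (u y) (fderiv ℝ v y X)‖ := norm_add_le _ _
    _ ≤ M * (√Lam * ‖X‖) * ‖v y‖ + √Lam * ‖X‖ * B := by
      refine add_le_add ?_ (h1.trans (by gcongr))
      refine (ContinuousLinearMap.le_opNorm _ _).trans ?_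
      gcongr
      refine (ContinuousLinearMap.le_opNorm _ _).trans ?_
      gcongr
      exact hM _ (huN y hy)
    _ = _ := by ring

/-- The sum of the norms of a family of second partial derivatives. -/
noncomputable def sumNorm₂ (w : Fin 2 → Fin 2 → Plane → Euc m) (y : Plane) : ℝ :=
  ∑ k, ∑ j, ‖w k j y‖

theorem le_sumNorm₂ (w : Fin 2 → Fin 2 → Plane → Euc m) (y : Plane) (k j : Fin 2) :
    ‖w k j y‖ ≤ sumNorm₂ w y := by
  refine le_trans ?_ (Finset.single_le_sum (f := fun k => ∑ j, ‖w k j y‖)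
    (fun _ _ => by positivity) (Finset.mem_univ k))
  exact Finset.single_le_sum (f := fun j => ‖w k j y‖) (fun _ _ => by positivity)
    (Finset.mem_univ j)

theorem sumNorm₂_nonneg (w : Fin 2 → Fin 2 → Plane → Euc m) (y : Plane) : 0 ≤ sumNorm₂ w y := by
  unfold sumNorm₂; positivity

theorem abs_weakPartial_gram_le (hU : IsOpen U) (hu : ContDiffOn ℝ 1 u U)
    {u₂ : Fin 2 → Fin 2 → Plane → Euc m} (hu₂ : ∀ k j, IsWeakPartial U k (pd j u) (u₂ k j))
    (hg : ∀ y ∈ U, GramBound lam Lam u y) : ∀ᵐ y ∂volume.restrict U, ∀ l i j,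
      |weakPartial U l (fun z => gram u z i j) y| ≤ 2 * √Lam * sumNorm₂ u₂ y := by
  have hc : ∀ j, ContinuousOn (pd j u) U := fun j =>
    (hu.continuousOn_fderiv_of_isOpen hU le_rfl).clm_apply continuousOn_const
  have key : ∀ l i j, ∀ᵐ y ∂volume.restrict U,
      |weakPartial U l (fun z => gram u z i j) y| ≤ 2 * √Lam * sumNorm₂ u₂ y := by
    intro l i j
    have h1 : IsWeakPartial U l (fun z => gram u z i j)
        (fun z => ⟪pd i u z, u₂ l j z⟫_ℝ + ⟪u₂ l i z, pd j u z⟫_ℝ) :=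
      IsWeakPartial.bilin hU (innerSL ℝ) (hc i) (hu₂ l i) (hc j) (hu₂ l j)
    filter_upwards [h1.ae_eq hU, ae_restrict_mem hU.measurableSet] with y hy hyU
    rw [hy]
    have a1 := abs_real_inner_le_norm (pd i u y) (u₂ l j y)
    have a2 := abs_real_inner_le_norm (u₂ l i y) (pd j u y)
    have b1 : ‖pd i u y‖ * ‖u₂ l j y‖ ≤ √Lam * sumNorm₂ u₂ y :=
      mul_le_mul ((hg y hyU).norm_pd_le i) (le_sumNorm₂ _ _ _ _) (norm_nonneg _) (Real.sqrt_nonneg _)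
    have b2 : ‖u₂ l i y‖ * ‖pd j u y‖ ≤ sumNorm₂ u₂ y * √Lam :=
      mul_le_mul (le_sumNorm₂ _ _ _ _) ((hg y hyU).norm_pd_le j) (norm_nonneg _)
        (sumNorm₂_nonneg _ _)
    refine (abs_add_le _ _).trans ?_
    linarith
  rw [ae_all_iff]; intro l
  rw [ae_all_iff]; intro i
  rw [ae_all_iff]; intro j
  exact key l i j

theorem abs_christoffel_le (hU : IsOpen U) (hu : ContDiffOn ℝ 1 u U)
    {u₂ : Fin 2 → Fin 2 → Plane → Euc m} (hu₂ : ∀ k j, IsWeakPartial U k (pd j u) (u₂ k j))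
    (hl : 0 < lam) (hg : ∀ y ∈ U, GramBound lam Lam u y) : ∀ᵐ y ∂volume.restrict U, ∀ k i j,
      |christoffel U u k i j y| ≤ 6 * (Lam / lam ^ 2) * √Lam * sumNorm₂ u₂ y := by
  filter_upwards [abs_weakPartial_gram_le hU hu hu₂ hg, ae_restrict_mem hU.measurableSet]
    with y hy hyU k i j
  have hL := (hg y hyU).nonneg_right
  have hs := sumNorm₂_nonneg u₂ y
  have term : ∀ l, |(gram u y)⁻¹ k l *
      (weakPartial U i (fun z => gram u z j l) y + weakPartial U j (fun z => gram u z i l) y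
        - weakPartial U l (fun z => gram u z i j) y)|
        ≤ Lam / lam ^ 2 * (6 * √Lam * sumNorm₂ u₂ y) := fun l => by
    rw [abs_mul]
    refine mul_le_mul ((hg y hyU).abs_inv_le hl k l) ?_ (abs_nonneg _) (by positivity)
    have a1 := abs_le.1 (hy i j l)
    have a2 := abs_le.1 (hy j i l)
    have a3 := abs_le.1 (hy l i j)
    rw [abs_le]
    constructor <;> linarith [a1.1, a1.2, a2.1, a2.2, a3.1, a3.2]
  rw [christoffel, Fin.sum_univ_two, abs_mul]
  have := abs_add_le ((gram u y)⁻¹ k 0 *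
      (weakPartial U i (fun z => gram u z j 0) y + weakPartial U j (fun z => gram u z i 0) y
        - weakPartial U 0 (fun z => gram u z i j) y)) ((gram u y)⁻¹ k 1 *
      (weakPartial U i (fun z => gram u z j 1) y + weakPartial U j (fun z => gram u z i 1) y
        - weakPartial U 1 (fun z => gram u z i j) y))
  have t0 := term 0
  have t1 := term 1
  rw [abs_of_nonneg (by norm_num : (0 : ℝ) ≤ 1 / 2)]
  linarith

/-- The weak second derivatives of a tangent field `v`: their normal part is of lower order in `v`,
since `Q v = v` can be differentiated twice, and their tangential part is `∇²v` up to terms of lower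
order. -/
theorem second_derivative_eq (hU : IsOpen U) (hu : ContDiffOn ℝ 1 u U) (hv : ContDiffOn ℝ 1 v U)
    (huN : ∀ y ∈ U, u y ∈ N) (hQ : ContDiff ℝ ∞ Q) (hQN : ∀ z ∈ N, Q z = tangentProj N z)
    (hvt : ∀ y ∈ U, tangentProj N (u y) (v y) = v y)
    {u₂ v₂ : Fin 2 → Fin 2 → Plane → Euc m} (hu₂ : ∀ k j, IsWeakPartial U k (pd j u) (u₂ k j))
    (hv₂ : ∀ k j, IsWeakPartial U k (pd j v) (v₂ k j)) (k j : Fin 2) :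
    ∀ᵐ y ∂volume.restrict U, v₂ k j y
      = (fderiv ℝ (fderiv ℝ Q) (u y) (pd k u y) (pd j u y) + fderiv ℝ Q (u y) (u₂ k j y)) (v y)
        + fderiv ℝ Q (u y) (pd j u y) (pd k v y)
        + (fderiv ℝ Q (u y) (pd k u y) (pd j v y)
          - tangentProj N (u y) (fderiv ℝ Q (u y) (pd k u y) (pd j v y)))
        + cov2 N U u v k j y + ∑ l, christoffel U u l k j y • cov N u v l y := by
  have hcu : ∀ j, ContinuousOn (pd j u) U := fun j =>
    (hu.continuousOn_fderiv_of_isOpen hU le_rfl).clm_apply continuousOn_const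
  have hcv : ∀ j, ContinuousOn (pd j v) U := fun j =>
    (hv.continuousOn_fderiv_of_isOpen hU le_rfl).clm_apply continuousOn_const
  have hQ1 : ContDiff ℝ 1 Q := hQ.of_le (by simp)
  have hQ2 : ContDiff ℝ 1 (fderiv ℝ Q) := (contDiff_infty_iff_fderiv.1 hQ).2.of_le (by simp)
  have wu : IsWeakPartial U k u (pd k u) := isWeakPartial_of_contDiffOn hU hu k
  have wv : IsWeakPartial U k v (pd k v) := isWeakPartial_of_contDiffOn hU hv k
  have wQ := wu.comp_left hU hu.continuousOn hQ1
  have wDQ := wu.comp_left hU hu.continuousOn hQ2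
  have cQ : ContinuousOn (fun y => Q (u y)) U := hQ1.continuous.comp_continuousOn hu.continuousOn
  have cDQ : ContinuousOn (fun y => fderiv ℝ Q (u y)) U :=
    hQ2.continuous.comp_continuousOn hu.continuousOn
  -- the weak derivative of `DQ(u)[∂_j u] v`
  have wA := wDQ.bilin hU (ContinuousLinearMap.id ℝ (Euc m →L[ℝ] Euc m →L[ℝ] Euc m)) cDQ
    (hcu j) (hu₂ k j)
  have cA : ContinuousOn (fun y => fderiv ℝ Q (u y) (pd j u y)) U := cDQ.clm_apply (hcu j)
  have wAv := wA.bilin hU (ContinuousLinearMap.id ℝ (Euc m →L[ℝ] Euc m)) cA hv.continuousOn wv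
  -- the weak derivative of `∇_j v`
  have wc := wQ.bilin hU (ContinuousLinearMap.id ℝ (Euc m →L[ℝ] Euc m)) cQ (hcv j) (hv₂ k j)
  have wc' : IsWeakPartial U k (cov N u v j) _ := wc.congr hU (by
    filter_upwards [ae_restrict_mem hU.measurableSet] with y hyU
    simp [cov, hQN _ (huN y hyU)])
  have wsum := (wAv.add wc').congr hU (f' := pd j v) (by
    filter_upwards [ae_restrict_mem hU.measurableSet] with y hyU
    exact (fderiv_tangent hU hu hv huN hQ hQN hvt hyU (e j)).symm)
  filter_upwards [wsum.unique hU (hv₂ k j), wc'.ae_eq hU, ae_restrict_mem hU.measurableSet]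
    with y h1 h2 hyU
  have h3 : fderiv ℝ Q (u y) (pd j u y) (pd k v y)
      + (fderiv ℝ Q (u y) (u₂ k j y) + fderiv ℝ (fderiv ℝ Q) (u y) (pd k u y) (pd j u y)) (v y)
      + (tangentProj N (u y) (v₂ k j y) + fderiv ℝ Q (u y) (pd k u y) (pd j v y)) = v₂ k j y := by
    rw [← hQN _ (huN y hyU)]
    exact h1
  have h4 : weakPartial U k (cov N u v j) y
      = tangentProj N (u y) (v₂ k j y) + fderiv ℝ Q (u y) (pd k u y) (pd j v y) := by
    rw [← hQN _ (huN y hyU)]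
    exact h2
  rw [cov2, h4, map_add, tangentProj_idem]
  conv_lhs => rw [← h3]
  rw [add_comm (fderiv ℝ Q (u y) (u₂ k j y))]
  abel

set_option maxSynthPendingDepth 3 in
theorem norm_second_derivative_le (hU : IsOpen U) (hu : ContDiffOn ℝ 1 u U)
    (hv : ContDiffOn ℝ 1 v U)
    (huN : ∀ y ∈ U, u y ∈ N) (hQ : ContDiff ℝ ∞ Q) (hQN : ∀ z ∈ N, Q z = tangentProj N z)
    (hvt : ∀ y ∈ U, tangentProj N (u y) (v y) = v y)
    {u₂ v₂ : Fin 2 → Fin 2 → Plane → Euc m} (hu₂ : ∀ k j, IsWeakPartial U k (pd j u) (u₂ k j))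
    (hv₂ : ∀ k j, IsWeakPartial U k (pd j v) (v₂ k j)) (hl : 0 < lam)
    (hM : ∀ z ∈ N, ‖fderiv ℝ Q z‖ ≤ M) (hM₂ : ∀ z ∈ N, ‖fderiv ℝ (fderiv ℝ Q) z‖ ≤ M)
    (hg : ∀ y ∈ U, GramBound lam Lam u y) (hB0 : 0 ≤ B) (hB : ∀ y ∈ U, covNormSq N u v y ≤ B ^ 2)
    (hBv : ∀ y ∈ U, ‖v y‖ ≤ B) (hBd : ∀ y ∈ U, ‖fderiv ℝ v y‖ ≤ B) :
    ∀ᵐ y ∂volume.restrict U, ∀ k j, ‖v₂ k j y‖ ≤ ‖cov2 N U u v k j y‖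
      + (M * Lam + 3 * (M * √Lam) + M + 12 * (Lam ^ 2 / lam ^ 2)) * (1 + sumNorm₂ u₂ y) * B := by
  have h0 := ae_all_iff.2 fun k => ae_all_iff.2 fun j =>
    second_derivative_eq hU hu hv huN hQ hQN hvt hu₂ hv₂ k j
  filter_upwards [h0, abs_christoffel_le hU hu hu₂ hl hg, ae_restrict_mem hU.measurableSet]
    with y h1 h2 hyU k j
  have hN := huN y hyU
  have hM0 : 0 ≤ M := (norm_nonneg (fderiv ℝ Q (u y))).trans (hM _ hN)
  have hL := (hg y hyU).nonneg_right
  have hs := sumNorm₂_nonneg u₂ y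
  have hsq : √Lam * √Lam = Lam := Real.mul_self_sqrt hL
  have hpu := (hg y hyU).norm_pd_le
  have hpv : ∀ j, ‖pd j v y‖ ≤ B := fun j => by
    refine ((fderiv ℝ v y).le_opNorm (e j)).trans ?_
    rw [norm_e, mul_one]
    exact hBd y hyU
  have t1 : ‖fderiv ℝ (fderiv ℝ Q) (u y) (pd k u y) (pd j u y) (v y)‖ ≤ M * √Lam * √Lam * B := by
    refine (ContinuousLinearMap.le_opNorm _ _).trans ?_
    refine mul_le_mul ?_ (hBv y hyU) (norm_nonneg _) (by positivity)
    refine (ContinuousLinearMap.le_opNorm _ _).trans ?_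
    refine mul_le_mul ?_ (hpu j) (norm_nonneg _) (by positivity)
    refine (ContinuousLinearMap.le_opNorm _ _).trans ?_
    exact mul_le_mul (hM₂ _ hN) (hpu k) (norm_nonneg _) hM0
  have dq : ∀ w a : Euc m, ‖fderiv ℝ Q (u y) w a‖ ≤ M * ‖w‖ * ‖a‖ := fun w a => by
    refine (ContinuousLinearMap.le_opNorm _ _).trans ?_
    gcongr
    refine (ContinuousLinearMap.le_opNorm _ _).trans ?_
    gcongr
    exact hM _ hN
  have t2 : ‖fderiv ℝ Q (u y) (u₂ k j y) (v y)‖ ≤ M * sumNorm₂ u₂ y * B := by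
    refine (dq _ _).trans ?_
    gcongr
    · exact le_sumNorm₂ _ _ _ _
    · exact hBv y hyU
  have t3 : ∀ i l, ‖fderiv ℝ Q (u y) (pd i u y) (pd l v y)‖ ≤ M * √Lam * B := fun i l => by
    refine (dq _ _).trans ?_
    gcongr
    · exact hpu i
    · exact hpv l
  have t4 : ‖tangentProj N (u y) (fderiv ℝ Q (u y) (pd k u y) (pd j v y))‖ ≤ M * √Lam * B :=
    (norm_tangentProj_le _ _ _).trans (t3 k j)
  have hc : ∀ l, ‖cov N u v l y‖ ≤ √Lam * B := fun l => by
    refine abs_le_of_sq_le_sq' ?_ (by positivity) |>.2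
    rw [mul_pow, Real.sq_sqrt hL]
    exact (norm_cov_sq_le N (hg y hyU) hl l).trans (mul_le_mul_of_nonneg_left (hB y hyU) hL)
  have t5 : ∀ l, ‖christoffel U u l k j y • cov N u v l y‖
      ≤ 6 * (Lam / lam ^ 2) * √Lam * sumNorm₂ u₂ y * (√Lam * B) := fun l => by
    rw [norm_smul, Real.norm_eq_abs]
    exact mul_le_mul (h2 l k j) (hc l) (norm_nonneg _) (by positivity)
  rw [h1 k j, Fin.sum_univ_two, ContinuousLinearMap.add_apply]
  refine (norm_add_le _ _).trans ?_
  have n1 := norm_add_le (christoffel U u 0 k j y • cov N u v 0 y)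
    (christoffel U u 1 k j y • cov N u v 1 y)
  refine (add_le_add ((norm_add_le _ _).trans (add_le_add_left ((norm_add_le _ _).trans (add_le_add
    ((norm_add_le _ _).trans (add_le_add (norm_add_le _ _) (t3 j k)))
    ((norm_sub_le _ _).trans (add_le_add (t3 k j) t4)))) _)) n1).trans ?_
  have e1 : M * √Lam * √Lam * B = M * Lam * B := by rw [mul_assoc M, hsq]
  have e2 : 6 * (Lam / lam ^ 2) * √Lam * sumNorm₂ u₂ y * (√Lam * B)
      = 6 * (Lam ^ 2 / lam ^ 2) * sumNorm₂ u₂ y * B := by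
    calc _ = 6 * (Lam / lam ^ 2) * (√Lam * √Lam) * sumNorm₂ u₂ y * B := by ring
      _ = _ := by rw [hsq]; ring
  have t50 := t5 0
  have t51 := t5 1
  rw [e2] at t50 t51
  rw [e1] at t1
  have p1 : 0 ≤ M * Lam * sumNorm₂ u₂ y * B := by positivity
  have p2 : 0 ≤ M * √Lam * sumNorm₂ u₂ y * B := by positivity
  have p3 : 0 ≤ M * B := by positivity
  have p4 : 0 ≤ (Lam ^ 2 / lam ^ 2) * B := by positivity
  nlinarith

end CovEstimate


/-! ### Changes of charts -/

section Transition

variable {S : Type*} [TopologicalSpace S] [ChartedSpace Plane S] [IsManifold (𝓡 2) ∞ S]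
  (𝔄 : DiscCover S)

/-- The change of charts from the `i`-th to the `j`-th chart. -/
noncomputable def trans (i j : Fin 𝔄.card) : OpenPartialHomeomorph Plane Plane :=
  (𝔄.chart i).symm.trans (𝔄.chart j)

/-- The part of the `i`-th disc that lies in the `j`-th one. -/
def overlap (i j : Fin 𝔄.card) : Set Plane := {y ∈ 𝔄.disc i | (𝔄.chart i).symm y ∈ 𝔄.nbhd j}

/-- The part of the `i`-th disc that lies in the `j`-th piece. -/
def part (i j : Fin 𝔄.card) : Set Plane :=
  {y ∈ overlap 𝔄 i j | ∀ j' < j, (𝔄.chart i).symm y ∉ 𝔄.nbhd j'}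

theorem isOpen_nbhd (j : Fin 𝔄.card) : IsOpen (𝔄.nbhd j) :=
  (𝔄.chart j).isOpen_inter_preimage (𝔄.isOpen_disc j)

theorem isOpen_overlap (i j : Fin 𝔄.card) : IsOpen (overlap 𝔄 i j) :=
  ((𝔄.chart i).continuousOn_symm.mono (𝔄.disc_subset i)).isOpen_inter_preimage
    (𝔄.isOpen_disc i) (isOpen_nbhd 𝔄 j)

theorem measurableSet_part (i j : Fin 𝔄.card) : MeasurableSet (part 𝔄 i j) := by
  have : part 𝔄 i j = overlap 𝔄 i j \ ⋃ j' : Fin 𝔄.card, ⋃ _ : j' < j, overlap 𝔄 i j' := by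
    ext y
    simp only [part, overlap, mem_ofPred_eq, Set.mem_sdiff, mem_iUnion, not_exists, not_and]
    exact ⟨fun h => ⟨h.1, fun j' hj _ => h.2 j' hj⟩, fun h => ⟨h.1, fun j' hj => h.2 j' hj h.1.1⟩⟩
  rw [this]
  exact (isOpen_overlap 𝔄 i j).measurableSet.diff (MeasurableSet.iUnion fun j' =>
    MeasurableSet.iUnion fun _ => (isOpen_overlap 𝔄 i j').measurableSet)

theorem disc_subset_iUnion_part (i : Fin 𝔄.card) : 𝔄.disc i ⊆ ⋃ j, part 𝔄 i j := by
  intro y hy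
  have hne : ∃ j, (𝔄.chart i).symm y ∈ 𝔄.nbhd j := 𝔄.covers _
  obtain ⟨j, hj, hmin⟩ := WellFounded.has_min (wellFounded_lt (α := Fin 𝔄.card))
    {j | (𝔄.chart i).symm y ∈ 𝔄.nbhd j} hne
  exact mem_iUnion.2 ⟨j, ⟨hy, hj⟩, fun j' hlt hj' => hmin j' hj' hlt⟩

theorem overlap_subset_disc (i j : Fin 𝔄.card) : overlap 𝔄 i j ⊆ 𝔄.disc i := fun _ h => h.1

theorem piece_subset_disc (i : Fin 𝔄.card) : 𝔄.piece i ⊆ 𝔄.disc i := fun _ h => h.1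

theorem overlap_subset_source (i j : Fin 𝔄.card) : overlap 𝔄 i j ⊆ (trans 𝔄 i j).source :=
  fun _ h => ⟨𝔄.disc_subset i h.1, h.2.1⟩

theorem mapsTo_trans_disc (i j : Fin 𝔄.card) :
    MapsTo (trans 𝔄 i j) (overlap 𝔄 i j) (𝔄.disc j) := fun _ h => h.2.2

theorem symm_trans_apply {i j : Fin 𝔄.card} {y : Plane} (h : y ∈ (trans 𝔄 i j).source) :
    (𝔄.chart j).symm (trans 𝔄 i j y) = (𝔄.chart i).symm y :=
  (𝔄.chart j).left_inv h.2

theorem mapsTo_trans_piece (i j : Fin 𝔄.card) :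
    MapsTo (trans 𝔄 i j) (part 𝔄 i j) (𝔄.piece j) := fun y h =>
  ⟨mapsTo_trans_disc 𝔄 i j h.1, fun j' hlt => by
    rw [symm_trans_apply 𝔄 (overlap_subset_source 𝔄 i j h.1)]
    exact h.2 j' hlt⟩

theorem contDiffOn_trans (i j : Fin 𝔄.card) :
    ContDiffOn ℝ ∞ (trans 𝔄 i j) (trans 𝔄 i j).source := by
  have h := (contDiffGroupoid ∞ (𝓡 2)).compatible_of_mem_maximalAtlas (𝔄.chart_mem i)
    (𝔄.chart_mem j)
  exact (contMDiffOn_of_mem_contDiffGroupoid h).contDiffOn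

theorem det_fderiv_trans_ne_zero {i j : Fin 𝔄.card} {y : Plane} (hy : y ∈ (trans 𝔄 i j).source) :
    (fderiv ℝ (trans 𝔄 i j) y).det ≠ 0 := by
  have hsymm : (trans 𝔄 i j).symm = trans 𝔄 j i := by
    rw [trans, OpenPartialHomeomorph.trans_symm_eq_symm_trans_symm]; rfl
  have hy' : trans 𝔄 i j y ∈ (trans 𝔄 j i).source := by
    rw [← hsymm]; exact (trans 𝔄 i j).map_source hy
  have d1 := ((contDiffOn_trans 𝔄 i j).differentiableOn (by simp)).differentiableAt
    ((trans 𝔄 i j).open_source.mem_nhds hy)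
  have d2 := ((contDiffOn_trans 𝔄 j i).differentiableOn (by simp)).differentiableAt
    ((trans 𝔄 j i).open_source.mem_nhds hy')
  have h1 := d2.hasFDerivAt.comp y d1.hasFDerivAt
  have h2 : (trans 𝔄 j i ∘ trans 𝔄 i j) =ᶠ[𝓝 y] id := by
    filter_upwards [(trans 𝔄 i j).open_source.mem_nhds hy] with z hz
    rw [← hsymm]
    exact (trans 𝔄 i j).left_inv hz
  have h3 := (h1.congr_of_eventuallyEq h2.symm).unique (hasFDerivAt_id y)
  intro h0
  have h4 := congrArg ContinuousLinearMap.det h3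
  rw [ContinuousLinearMap.det, ContinuousLinearMap.toLinearMap_comp, LinearMap.det_comp] at h4
  rw [ContinuousLinearMap.det] at h0
  rw [h0] at h4
  simp [ContinuousLinearMap.det] at h4

theorem exists_transition_bound [CompactSpace S] [T2Space S] : ∃ C, 0 ≤ C ∧ ∀ i j, ∀ y ∈ overlap 𝔄 i j,
    ‖fderiv ℝ (trans 𝔄 i j) y‖ ≤ C ∧ ‖fderiv ℝ (fderiv ℝ (trans 𝔄 i j)) y‖ ≤ C ∧
      1 ≤ C * |(fderiv ℝ (trans 𝔄 i j) y).det| := by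
  have key : ∀ i j, ∃ C, ∀ y ∈ overlap 𝔄 i j,
    ‖fderiv ℝ (trans 𝔄 i j) y‖ ≤ C ∧ ‖fderiv ℝ (fderiv ℝ (trans 𝔄 i j)) y‖ ≤ C ∧
      |(fderiv ℝ (trans 𝔄 i j) y).det|⁻¹ ≤ C := by
    intro i j
    -- the closure of the overlap is compact in the domain of the change of charts
    set T : Set S := (𝔄.chart j).symm '' Metric.closedBall (𝔄.center j) (𝔄.radius j)
    have hT : IsClosed T := ((isCompact_closedBall _ _).image_of_continuousOn
      ((𝔄.chart j).continuousOn_symm.mono (𝔄.closedBall_subset j))).isClosed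
    set K := Metric.closedBall (𝔄.center i) (𝔄.radius i) ∩ (𝔄.chart i).symm ⁻¹' T
    have hK : IsCompact K := (isCompact_closedBall _ _).of_isClosed_subset
      (((𝔄.chart i).continuousOn_symm.mono (𝔄.closedBall_subset i)).preimage_isClosed_of_isClosed
        Metric.isClosed_closedBall hT) inter_subset_left
    have hKs : K ⊆ (trans 𝔄 i j).source := by
      rintro y ⟨h1, z, hz, h2⟩
      refine ⟨𝔄.closedBall_subset i h1, ?_⟩
      show (𝔄.chart i).symm y ∈ (𝔄.chart j).source
      rw [← h2]
      exact (𝔄.chart j).map_target (𝔄.closedBall_subset j hz)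
    have hoK : overlap 𝔄 i j ⊆ K := fun y hy => ⟨Metric.ball_subset_closedBall hy.1,
      ⟨_, Metric.ball_subset_closedBall hy.2.2, (𝔄.chart j).left_inv hy.2.1⟩⟩
    have ho := (trans 𝔄 i j).open_source
    have c1 := (contDiffOn_trans 𝔄 i j).fderiv_of_isOpen (m := ∞) ho (by simp)
    have c2 := c1.fderiv_of_isOpen (m := ∞) ho (by simp)
    have c3 : ContinuousOn (fun y => |(fderiv ℝ (trans 𝔄 i j) y).det|⁻¹) K :=
      ContinuousOn.inv₀ (ContinuousLinearMap.continuous_det.comp_continuousOn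
        (c1.continuousOn.mono hKs)).abs fun y hy =>
          abs_ne_zero.2 (det_fderiv_trans_ne_zero 𝔄 (hKs hy))
    obtain ⟨C₁, h1⟩ := hK.exists_bound_of_continuousOn (c1.continuousOn.mono hKs)
    obtain ⟨C₂, h2⟩ := hK.exists_bound_of_continuousOn (c2.continuousOn.mono hKs)
    obtain ⟨C₃, h3⟩ := hK.exists_bound_of_continuousOn c3
    refine ⟨max C₁ (max C₂ C₃), fun y hy => ⟨(h1 y (hoK hy)).trans (le_max_left _ _),
      (h2 y (hoK hy)).trans ((le_max_left _ _).trans (le_max_right _ _)), ?_⟩⟩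
    exact (le_abs_self _).trans ((h3 y (hoK hy)).trans ((le_max_right _ _).trans (le_max_right _ _)))
  choose C hC using key
  have hle : ∀ i j, C i j ≤ ∑ i, ∑ j, |C i j| := fun i j => (le_abs_self _).trans
    ((Finset.single_le_sum (f := fun j => |C i j|) (fun _ _ => abs_nonneg _)
      (Finset.mem_univ j)).trans (Finset.single_le_sum (f := fun i => ∑ j, |C i j|)
        (fun _ _ => by positivity) (Finset.mem_univ i)))
  refine ⟨∑ i, ∑ j, |C i j|, by positivity, fun i j y hy => ?_⟩
  obtain ⟨h1, h2, h3⟩ := hC i j y hy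
  refine ⟨h1.trans (hle i j), h2.trans (hle i j), ?_⟩
  have hpos := abs_pos.2 (det_fderiv_trans_ne_zero 𝔄 (overlap_subset_source 𝔄 i j hy))
  rw [inv_eq_one_div, div_le_iff₀ hpos] at h3
  exact h3.trans (by gcongr; exact hle i j)

theorem loc_eq_comp_trans {F : Type*} (f : S → F) {i j : Fin 𝔄.card} {y : Plane}
    (hy : y ∈ overlap 𝔄 i j) : 𝔄.loc i f y = 𝔄.loc j f (trans 𝔄 i j y) := by
  rw [DiscCover.loc, DiscCover.loc, Function.comp_apply, Function.comp_apply,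
    symm_trans_apply 𝔄 (overlap_subset_source 𝔄 i j hy)]

/-- Integrals over the parts of the discs are controlled by integrals over the pieces. -/
theorem setLIntegral_part_le {C : ℝ} (hC0 : 0 ≤ C) {i j : Fin 𝔄.card} (hC : ∀ y ∈ overlap 𝔄 i j,
    1 ≤ C * |(fderiv ℝ (trans 𝔄 i j) y).det|) (g : Plane → ℝ≥0∞) :
    ∫⁻ y in part 𝔄 i j, g (trans 𝔄 i j y) ≤ ENNReal.ofReal C * ∫⁻ z in 𝔄.piece j, g z := by
  have hps : part 𝔄 i j ⊆ (trans 𝔄 i j).source := fun y hy => overlap_subset_source 𝔄 i j hy.1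
  have h1 := lintegral_image_eq_lintegral_abs_det_fderiv_mul volume (measurableSet_part 𝔄 i j)
    (f := trans 𝔄 i j) (f' := fderiv ℝ (trans 𝔄 i j)) (fun y hy =>
      ((((contDiffOn_trans 𝔄 i j).differentiableOn (by simp)).differentiableAt
        ((trans 𝔄 i j).open_source.mem_nhds (hps hy))).hasFDerivAt).hasFDerivWithinAt)
    ((trans 𝔄 i j).injOn.mono hps) g
  calc ∫⁻ y in part 𝔄 i j, g (trans 𝔄 i j y)
      ≤ ∫⁻ y in part 𝔄 i j, ENNReal.ofReal C *
        (ENNReal.ofReal |(fderiv ℝ (trans 𝔄 i j) y).det| * g (trans 𝔄 i j y)) := by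
        refine setLIntegral_mono' (measurableSet_part 𝔄 i j) fun y hy => ?_
        rw [← mul_assoc, ← ENNReal.ofReal_mul hC0]
        exact le_mul_of_one_le_left zero_le (ENNReal.one_le_ofReal.2 (hC y hy.1))
    _ = ENNReal.ofReal C * ∫⁻ z in trans 𝔄 i j '' part 𝔄 i j, g z := by
        rw [lintegral_const_mul' _ _ ENNReal.ofReal_ne_top, h1]
    _ ≤ ENNReal.ofReal C * ∫⁻ z in 𝔄.piece j, g z := by
        gcongr
        exact image_subset_iff.2 (mapsTo_trans_piece 𝔄 i j)

end Transition


section TransitionDerivatives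

variable {S : Type*} [TopologicalSpace S] [ChartedSpace Plane S] [IsManifold (𝓡 2) ∞ S]
  {𝔄 : DiscCover S} {m : ℕ} {p : ℝ}

theorem pd_trans (f : Sobolev 𝔄 m p) {i j : Fin 𝔄.card} {y : Plane} (hy : y ∈ overlap 𝔄 i j)
    (k : Fin 2) : pd k (𝔄.loc i f.1) y
      = ∑ l, (fderiv ℝ (trans 𝔄 i j) y (e k)) l • pd l (𝔄.loc j f.1) (trans 𝔄 i j y) := by
  have h1 : 𝔄.loc i f.1 =ᶠ[𝓝 y] 𝔄.loc j f.1 ∘ trans 𝔄 i j := by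
    filter_upwards [(isOpen_overlap 𝔄 i j).mem_nhds hy] with z hz
    exact loc_eq_comp_trans 𝔄 f.1 hz
  have d1 := ((contDiffOn_trans 𝔄 i j).differentiableOn (by simp)).differentiableAt
    ((trans 𝔄 i j).open_source.mem_nhds (overlap_subset_source 𝔄 i j hy))
  have d2 := differentiableAt_loc f (mapsTo_trans_disc 𝔄 i j hy)
  rw [pd, h1.fderiv_eq, (d2.hasFDerivAt.comp y d1.hasFDerivAt).fderiv,
    ContinuousLinearMap.comp_apply]
  conv_lhs => rw [plane_eq_sum (fderiv ℝ (trans 𝔄 i j) y (e k)), map_sum]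
  simp [pd]

theorem norm_weak2_trans_le (f : Sobolev 𝔄 m p) {i j : Fin 𝔄.card} {C B : ℝ} (hC0 : 0 ≤ C)
    (hC : ∀ y ∈ overlap 𝔄 i j, ‖fderiv ℝ (trans 𝔄 i j) y‖ ≤ C ∧
      ‖fderiv ℝ (fderiv ℝ (trans 𝔄 i j)) y‖ ≤ C)
    (hB : ∀ y ∈ 𝔄.disc j, ‖fderiv ℝ (𝔄.loc j f.1) y‖ ≤ B) :
    ∀ᵐ y ∂volume.restrict (overlap 𝔄 i j), ∀ a k, ‖weak2 i a k f y‖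
      ≤ C ^ 2 * sumNorm₂ (fun r l => weak2 j r l f) (trans 𝔄 i j y) + 2 * C * B := by
  have hW := isOpen_overlap 𝔄 i j
  have hτ : ContDiffOn ℝ ∞ (trans 𝔄 i j) (overlap 𝔄 i j) :=
    (contDiffOn_trans 𝔄 i j).mono (overlap_subset_source 𝔄 i j)
  have hDτ : ContDiffOn ℝ ∞ (fderiv ℝ (trans 𝔄 i j)) (overlap 𝔄 i j) :=
    hτ.fderiv_of_isOpen (m := ∞) hW (by simp)
  have hcoord : ∀ k l, ContDiffOn ℝ 1 (fun y => (fderiv ℝ (trans 𝔄 i j) y (e k)) l)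
      (overlap 𝔄 i j) := fun k l =>
    (EuclideanSpace.proj l : Plane →L[ℝ] ℝ).contDiff.comp_contDiffOn
      ((hDτ.of_le (by simp)).clm_apply contDiffOn_const)
  have key : ∀ a k, ∀ᵐ y ∂volume.restrict (overlap 𝔄 i j), ‖weak2 i a k f y‖
      ≤ C ^ 2 * sumNorm₂ (fun r l => weak2 j r l f) (trans 𝔄 i j y) + 2 * C * B := by
    intro a k
    have w1 : ∀ l, IsWeakPartial (overlap 𝔄 i j) a
        (fun y => (fderiv ℝ (trans 𝔄 i j) y (e k)) l • pd l (𝔄.loc j f.1) (trans 𝔄 i j y)) _ :=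
      fun l => IsWeakPartial.bilin hW (ContinuousLinearMap.lsmul ℝ ℝ) (hcoord k l).continuousOn
        (isWeakPartial_of_contDiffOn hW (hcoord k l) a)
        ((continuousOn_pd_loc f j l).comp hτ.continuousOn (mapsTo_trans_disc 𝔄 i j))
        (isWeakPartial_comp_right (𝔄.isOpen_disc j) hW (continuousOn_pd_loc f j l)
          (fun r => isWeakPartial_pd f j r l) (hτ.of_le (by simp)) (mapsTo_trans_disc 𝔄 i j)
          ((trans 𝔄 i j).injOn.mono (overlap_subset_source 𝔄 i j))
          (fun y hy => det_fderiv_trans_ne_zero 𝔄 (overlap_subset_source 𝔄 i j hy)) a)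
    have w2 := ((w1 0).add (w1 1)).congr hW (f' := pd k (𝔄.loc i f.1)) (by
      filter_upwards [ae_restrict_mem hW.measurableSet] with y hy
      rw [pd_trans f hy, Fin.sum_univ_two]; rfl)
    have w3 := (isWeakPartial_pd f i a k).mono (overlap_subset_disc 𝔄 i j)
    filter_upwards [w2.unique hW w3, ae_restrict_mem hW.measurableSet] with y hy hyW
    obtain ⟨h1, h2⟩ := hC y hyW
    have c1 : ∀ k l, |(fderiv ℝ (trans 𝔄 i j) y (e k)) l| ≤ C := fun k l => by
      refine (PiLp.norm_apply_le _ l).trans (((fderiv ℝ (trans 𝔄 i j) y).le_opNorm _).trans ?_)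
      rwa [norm_e, mul_one]
    have c2 : ∀ l, |fderiv ℝ (fun y => (fderiv ℝ (trans 𝔄 i j) y (e k)) l) y (e a)| ≤ C := fun l => by
      have hd : DifferentiableAt ℝ (fderiv ℝ (trans 𝔄 i j)) y :=
        (hDτ.differentiableOn (by simp)).differentiableAt (hW.mem_nhds hyW)
      have hd' := (EuclideanSpace.proj l : Plane →L[ℝ] ℝ).hasFDerivAt.comp y
        (hd.hasFDerivAt.clm_apply (hasFDerivAt_const (e k) y))
      have hd'' : fderiv ℝ (fun y => (fderiv ℝ (trans 𝔄 i j) y (e k)) l) y (e a)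
          = (fderiv ℝ (fderiv ℝ (trans 𝔄 i j)) y (e a) (e k)) l := by
        rw [show (fun y => (fderiv ℝ (trans 𝔄 i j) y (e k)) l)
          = (EuclideanSpace.proj l : Plane →L[ℝ] ℝ) ∘ fun y => fderiv ℝ (trans 𝔄 i j) y (e k) from rfl,
          hd'.fderiv]
        simp
      rw [hd'']
      refine (PiLp.norm_apply_le _ l).trans
        (((fderiv ℝ (fderiv ℝ (trans 𝔄 i j)) y (e a)).le_opNorm (e k)).trans ?_)
      rw [norm_e, mul_one]
      refine (ContinuousLinearMap.le_opNorm _ _).trans ?_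
      rwa [norm_e, mul_one]
    have c3 : ∀ l, ‖pd l (𝔄.loc j f.1) (trans 𝔄 i j y)‖ ≤ B := fun l => by
      refine (ContinuousLinearMap.le_opNorm _ _).trans ?_
      rw [norm_e, mul_one]
      exact hB _ (mapsTo_trans_disc 𝔄 i j hyW)
    have term : ∀ l, ‖(fderiv ℝ (trans 𝔄 i j) y (e k)) l •
        (∑ r, (fderiv ℝ (trans 𝔄 i j) y (e a)) r • weak2 j r l f (trans 𝔄 i j y))
        + fderiv ℝ (fun y => (fderiv ℝ (trans 𝔄 i j) y (e k)) l) y (e a) •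
          pd l (𝔄.loc j f.1) (trans 𝔄 i j y)‖
        ≤ C * (C * ‖weak2 j 0 l f (trans 𝔄 i j y)‖ + C * ‖weak2 j 1 l f (trans 𝔄 i j y)‖)
          + C * B := fun l => by
      refine (norm_add_le _ _).trans ?_
      rw [norm_smul, norm_smul, Fin.sum_univ_two, Real.norm_eq_abs, Real.norm_eq_abs]
      gcongr
      · exact c1 k l
      · refine (norm_add_le _ _).trans ?_
        rw [norm_smul, norm_smul, Real.norm_eq_abs, Real.norm_eq_abs]
        gcongr
        · exact c1 a 0
        · exact c1 a 1
      · exact c2 l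
      · exact c3 l
    rw [← hy]
    refine (norm_add_le _ _).trans ((add_le_add (term 0) (term 1)).trans (le_of_eq ?_))
    simp only [sumNorm₂, Fin.sum_univ_two]
    ring
  exact ae_all_iff.2 fun a => ae_all_iff.2 fun k => key a k

end TransitionDerivatives


/-! ### The Finsler norm controls the Sobolev norm -/

section FinslerControl

variable {S : Type*} [TopologicalSpace S] [ChartedSpace Plane S] [IsManifold (𝓡 2) ∞ S]
  {𝔄 : DiscCover S} {m n : ℕ} {p : ℝ} {N : Set (Euc m)} {lam Lam B : ℝ} {Φ v : Sobolev 𝔄 m p}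

/-- `v` is a vector field along the map `Φ` to `N`, whose first fundamental form lies between the
bounds `lam` and `Lam`, and the Finsler norm of `v` is at most `B`. -/
structure BoundedField (N : Set (Euc m)) (lam Lam : ℝ) (Φ v : Sobolev 𝔄 m p) (B : ℝ) : Prop where
  lam_pos : 0 < lam
  mem : ∀ x, Φ.1 x ∈ N
  gram : ∀ i, ∀ y ∈ 𝔄.disc i, GramBound lam Lam (𝔄.loc i Φ.1) y
  tangent : ∀ x, v.1 x ∈ tangentAt N (Φ.1 x)
  pos : 0 < B
  le : finslerNorm 𝔄 N Φ v ≤ ENNReal.ofReal B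

namespace BoundedField

theorem covNormSq_le (h : BoundedField N lam Lam Φ v B) (i : Fin 𝔄.card) {y : Plane}
    (hy : y ∈ 𝔄.disc i) : covNormSq N (𝔄.loc i Φ.1) (𝔄.loc i v.1) y ≤ B ^ 2 := by
  have h1 : ENNReal.ofReal √(covNormSq N (𝔄.loc i Φ.1) (𝔄.loc i v.1) y) ≤ ENNReal.ofReal B := by
    refine le_trans ?_ (le_add_self.trans h.le)
    exact le_iSup_of_le i (le_iSup₂_of_le (f := fun y (_ : y ∈ 𝔄.disc i) =>
      ENNReal.ofReal √(covNormSq N (𝔄.loc i Φ.1) (𝔄.loc i v.1) y)) y hy le_rfl)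
  exact (Real.sqrt_le_left h.pos.le).1 ((ENNReal.ofReal_le_ofReal_iff h.pos.le).1 h1)

theorem setLIntegral_le (h : BoundedField N lam Lam Φ v B) (hp : 1 < p) (i : Fin 𝔄.card) :
    ∫⁻ y in 𝔄.piece i, ENNReal.ofReal
      ((cov2NormSq N (𝔄.disc i) (𝔄.loc i Φ.1) (𝔄.loc i v.1) y
          + covNormSq N (𝔄.loc i Φ.1) (𝔄.loc i v.1) y + ‖𝔄.loc i v.1 y‖ ^ 2) ^ p
        * volDensity (𝔄.loc i Φ.1) y) ≤ ENNReal.ofReal B ^ (2 * p) := by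
  have h1 := le_self_add.trans h.le
  rw [one_div, ENNReal.rpow_inv_le_iff (by linarith)] at h1
  exact le_trans (Finset.single_le_sum (f := fun i => ∫⁻ y in 𝔄.piece i, ENNReal.ofReal
      ((cov2NormSq N (𝔄.disc i) (𝔄.loc i Φ.1) (𝔄.loc i v.1) y
          + covNormSq N (𝔄.loc i Φ.1) (𝔄.loc i v.1) y + ‖𝔄.loc i v.1 y‖ ^ 2) ^ p
        * volDensity (𝔄.loc i Φ.1) y)) (fun _ _ => zero_le) (Finset.mem_univ i)) h1

theorem tangentProj_eq (h : BoundedField N lam Lam Φ v B) (i : Fin 𝔄.card) (y : Plane) :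
    tangentProj N (𝔄.loc i Φ.1 y) (𝔄.loc i v.1 y) = 𝔄.loc i v.1 y :=
  tangentProj_of_mem (h.tangent _)

end BoundedField

/-- Every disc meets the interior of one of the pieces. -/
theorem exists_isOpen_subset_piece {i : Fin 𝔄.card} (hi : (𝔄.disc i).Nonempty) :
    ∃ j, ∃ P ⊆ 𝔄.piece j, IsOpen P ∧ P.Nonempty ∧ ∀ y ∈ P, (𝔄.chart j).symm y ∈ 𝔄.nbhd i := by
  have hne : (𝔄.nbhd i).Nonempty := by
    obtain ⟨y, hy⟩ := hi
    have hyt := 𝔄.disc_subset i hy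
    refine ⟨(𝔄.chart i).symm y, (𝔄.chart i).map_target hyt, ?_⟩
    show 𝔄.chart i ((𝔄.chart i).symm y) ∈ 𝔄.disc i
    rwa [(𝔄.chart i).right_inv hyt]
  obtain ⟨j, hj, hmin⟩ := WellFounded.has_min (wellFounded_lt (α := Fin 𝔄.card))
    {j | (𝔄.nbhd j ∩ 𝔄.nbhd i).Nonempty} ⟨i, by rwa [mem_ofPred_eq, inter_self]⟩
  refine ⟨j, overlap 𝔄 j i, fun y hy => ⟨hy.1, fun j' hlt hj' => hmin j' ⟨_, hj', hy.2⟩ hlt⟩,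
    isOpen_overlap 𝔄 j i, ?_, fun y hy => hy.2⟩
  obtain ⟨x, hxj, hxi⟩ := hj
  refine ⟨𝔄.chart j x, hxj.2, ?_⟩
  show (𝔄.chart j).symm (𝔄.chart j x) ∈ 𝔄.nbhd i
  rwa [(𝔄.chart j).left_inv hxj.1]

/-- On an open part of a piece, a vector field of Finsler norm at most `B` takes somewhere a value
of order `B`. -/
theorem exists_point_norm_le (hp : 1 < p) {j : Fin 𝔄.card} {P : Set Plane} (hPj : P ⊆ 𝔄.piece j)
    (hPo : IsOpen P) (hPne : P.Nonempty) (hl : 0 < lam) : ∃ K, 0 ≤ K ∧ ∀ (Φ v : Sobolev 𝔄 m p) (B : ℝ),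
      BoundedField N lam Lam Φ v B → ∃ y ∈ P, ‖𝔄.loc j v.1 y‖ ≤ K * B := by
  have hfin : volume P ≠ ⊤ := ((measure_mono (hPj.trans (piece_subset_disc 𝔄 j))).trans_lt
    measure_ball_lt_top).ne
  have hμ : 0 < (volume P).toReal := ENNReal.toReal_pos (hPo.measure_pos _ hPne).ne' hfin
  obtain ⟨K, hK1, hK0⟩ := (((tendsto_rpow_atTop (show 0 < 2 * p by linarith)).eventually_gt_atTop
    (1 / (lam * (volume P).toReal))).and (eventually_ge_atTop 0)).exists
  refine ⟨K, hK0, fun Φ v B h => ?_⟩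
  by_contra! hcon
  have hB := h.pos
  have h1 : ∫⁻ _ in P, ENNReal.ofReal ((K * B) ^ (2 * p) * lam) ≤ ENNReal.ofReal B ^ (2 * p) := by
    refine le_trans ?_ ((lintegral_mono_set hPj).trans (h.setLIntegral_le hp j))
    refine setLIntegral_mono' hPo.measurableSet fun y hy => ENNReal.ofReal_le_ofReal ?_
    have hyd := piece_subset_disc 𝔄 j (hPj hy)
    have hg := h.gram j y hyd
    have a1 := cov2NormSq_nonneg (v := 𝔄.loc j v.1) N (𝔄.disc j) hg hl
    have a2 := covNormSq_nonneg (v := 𝔄.loc j v.1) N hg hl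
    have a3 : (K * B) ^ 2 ≤ ‖𝔄.loc j v.1 y‖ ^ 2 := by
      gcongr
      exact (hcon y hy).le
    rw [Real.rpow_mul (by positivity), Real.rpow_two]
    refine mul_le_mul ?_ (hg.le_volDensity hl) hl.le (by positivity)
    refine Real.rpow_le_rpow (by positivity) ?_ (by linarith)
    linarith
  rw [setLIntegral_const, ENNReal.ofReal_rpow_of_pos hB, ← ENNReal.ofReal_toReal hfin,
    ← ENNReal.ofReal_mul (by positivity), ENNReal.ofReal_le_ofReal_iff (by positivity),
    Real.mul_rpow hK0 hB.le] at h1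
  rw [div_lt_iff₀ (by positivity)] at hK1
  have hBp : 0 < B ^ (2 * p) := by positivity
  nlinarith

/-- A vector field of Finsler norm at most `B` is bounded by a multiple of `B`, with its first
derivatives: on a segment from a point where it is small, the Gronwall inequality applies. -/
theorem exists_bound_C1 (hp : 1 < p) (hN : IsClosedSubmanifold n N) (hl : 0 < lam) :
    ∃ C, 0 ≤ C ∧ ∀ (Φ v : Sobolev 𝔄 m p) (B : ℝ), BoundedField N lam Lam Φ v B →
      ∀ i, ∀ y ∈ 𝔄.disc i, ‖𝔄.loc i v.1 y‖ ≤ C * B ∧ ‖fderiv ℝ (𝔄.loc i v.1) y‖ ≤ C * B := by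
  obtain ⟨Q, hQ, hQN⟩ := exists_smooth_tangentProj hN
  obtain ⟨M, hM⟩ := hN.1.exists_bound_of_continuousOn (f := fderiv ℝ Q)
    (hQ.continuous_fderiv (by simp)).continuousOn
  have key : ∀ i, ∃ C, 0 ≤ C ∧ ∀ (Φ v : Sobolev 𝔄 m p) (B : ℝ), BoundedField N lam Lam Φ v B →
      ∀ y ∈ 𝔄.disc i, ‖𝔄.loc i v.1 y‖ ≤ C * B ∧ ‖fderiv ℝ (𝔄.loc i v.1) y‖ ≤ C * B := by
    intro i
    rcases (𝔄.disc i).eq_empty_or_nonempty with hi | hi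
    · exact ⟨0, le_rfl, fun Φ v B _ y hy => by rw [hi] at hy; exact absurd hy (notMem_empty y)⟩
    obtain ⟨j, P, hPj, hPo, hPne, hPi⟩ := exists_isOpen_subset_piece hi
    obtain ⟨K, hK0, hK⟩ := exists_point_norm_le (N := N) (m := m) (Lam := Lam) hp hPj hPo hPne hl
    set r := 2 * 𝔄.radius i
    set G := gronwallBound K (r * (√Lam * M)) (r * √Lam) 1
    refine ⟨|G| + √Lam * (|M| * |G| + 1), by positivity, fun Φ v B h y hy => ?_⟩
    have hB := h.pos
    obtain ⟨z', hz', hz'K⟩ := hK Φ v B h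
    set z := 𝔄.chart i ((𝔄.chart j).symm z')
    have hz : z ∈ 𝔄.disc i := (hPi z' hz').2
    have hzv : 𝔄.loc i v.1 z = 𝔄.loc j v.1 z' := by
      simp only [DiscCover.loc, Function.comp_apply, z]
      rw [(𝔄.chart i).left_inv (hPi z' hz').1]
    have hM0 : 0 ≤ M := (norm_nonneg _).trans (hM _ (h.mem ((𝔄.chart i).symm y)))
    have hd : ∀ w ∈ 𝔄.disc i, ‖fderiv ℝ (𝔄.loc i v.1) w‖ ≤ √Lam * (M * ‖𝔄.loc i v.1 w‖ + B) :=
      fun w hw => norm_fderiv_tangent_le (𝔄.isOpen_disc i) (contDiffOn_loc_disc Φ i)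
        (contDiffOn_loc_disc v i) (fun _ _ => h.mem _) hQ hQN (fun y _ => h.tangentProj_eq i y) hl
        hM hw (h.gram i w hw) hB.le (h.covNormSq_le i hw)
    have hseg : ∀ t ∈ Icc (0 : ℝ) 1, z + t • (y - z) ∈ 𝔄.disc i := fun t ht =>
      (convex_ball _ _).add_smul_sub_mem hz hy ht
    have hyz : ‖y - z‖ ≤ r := by
      have h1 := Metric.mem_ball.1 hy
      have h2 := Metric.mem_ball.1 hz
      rw [← dist_eq_norm]
      linarith [dist_triangle_right y z (𝔄.center i)]
    have hr : 0 ≤ r := (norm_nonneg _).trans hyz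
    have hder : ∀ t ∈ Icc (0 : ℝ) 1, HasDerivAt (fun t : ℝ => 𝔄.loc i v.1 (z + t • (y - z)))
        (fderiv ℝ (𝔄.loc i v.1) (z + t • (y - z)) (y - z)) t := fun t ht => by
      have h1 : HasDerivAt (fun t : ℝ => z + t • (y - z)) (y - z) t := by
        simpa using ((hasDerivAt_id t).smul_const (y - z)).const_add z
      exact (differentiableAt_loc v (hseg t ht)).hasFDerivAt.comp_hasDerivAt t h1
    have hgr := norm_le_gronwallBound_of_norm_deriv_right_le (δ := K * B) (K := r * (√Lam * M))
      (ε := r * √Lam * B)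
      (fun t ht => (hder t ht).continuousAt.continuousWithinAt)
      (fun t ht => (hder t (Ico_subset_Icc_self ht)).hasDerivWithinAt) (by
        simpa [hzv] using hz'K)
      (fun t ht => by
        refine (ContinuousLinearMap.le_opNorm _ _).trans ?_
        calc _ ≤ √Lam * (M * ‖𝔄.loc i v.1 (z + t • (y - z))‖ + B) * r :=
              mul_le_mul (hd _ (hseg t (Ico_subset_Icc_self ht))) hyz (norm_nonneg _) (by positivity)
          _ = _ := by ring) 1 (right_mem_Icc.2 zero_le_one)
    have hG : gronwallBound (K * B) (r * (√Lam * M)) (r * √Lam * B) (1 - 0) = G * B := by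
      simp only [G, gronwallBound, sub_zero]
      split_ifs
      · ring
      · ring
    rw [hG] at hgr
    have hvy : ‖𝔄.loc i v.1 y‖ ≤ |G| * B := by
      refine le_trans ?_ (hgr.trans (by gcongr; exact le_abs_self G))
      simp
    rw [abs_of_nonneg hM0]
    constructor
    · refine hvy.trans ?_
      gcongr
      have : 0 ≤ √Lam * (M * |G| + 1) := by positivity
      linarith
    · refine (hd y hy).trans ?_
      have : √Lam * (M * ‖𝔄.loc i v.1 y‖ + B) ≤ √Lam * (M * (|G| * B) + B) := by gcongr
      nlinarith [mul_nonneg (abs_nonneg G) hB.le]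
  choose C hC0 hC using key
  refine ⟨∑ i, C i, Finset.sum_nonneg fun i _ => hC0 i, fun Φ v B h i y hy => ?_⟩
  have hle : C i * B ≤ (∑ i, C i) * B := by
    have hB := h.pos
    gcongr
    exact Finset.single_le_sum (f := C) (fun i _ => hC0 i) (Finset.mem_univ i)
  exact ⟨(hC i Φ v B h y hy).1.trans hle, (hC i Φ v B h y hy).2.trans hle⟩

end FinslerControl


section SecondOrder

variable {m : ℕ} {μ : Measure Plane} {q : ℝ≥0∞}

theorem eLpNorm_affine_sumNorm₂_le {w : Fin 2 → Fin 2 → Plane → Euc m} (hq : 1 ≤ q)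
    (hw : ∀ k j, AEStronglyMeasurable (w k j) μ) {a b D V : ℝ} (ha : 0 ≤ a) (hb : 0 ≤ b)
    (hD0 : 0 ≤ D) (hV0 : 0 ≤ V) (hD : ∀ k j, eLpNorm (w k j) q μ ≤ ENNReal.ofReal D)
    (hV : μ univ ^ q.toReal⁻¹ ≤ ENNReal.ofReal V) :
    eLpNorm (fun y => a * sumNorm₂ w y + b) q μ ≤ ENNReal.ofReal (a * (4 * D) + b * V) := by
  have hn : ∀ k j, eLpNorm (fun y => ‖w k j y‖) q μ ≤ ENNReal.ofReal D := fun k j => by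
    rw [eLpNorm_norm]; exact hD k j
  have hm : ∀ k, AEStronglyMeasurable ((fun y => ‖w k 0 y‖) + fun y => ‖w k 1 y‖) μ := fun k =>
    (hw k 0).norm.add (hw k 1).norm
  have h2 : ∀ k, eLpNorm ((fun y => ‖w k 0 y‖) + fun y => ‖w k 1 y‖) q μ ≤ ENNReal.ofReal (2 * D) :=
    fun k => by
    refine (eLpNorm_add_le (hw k 0).norm (hw k 1).norm hq).trans ((add_le_add (hn k 0) (hn k 1)).trans
      (le_of_eq ?_))
    rw [← ENNReal.ofReal_add hD0 hD0]; ring_nf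
  have h4 : eLpNorm (sumNorm₂ w) q μ ≤ ENNReal.ofReal (4 * D) := by
    have : sumNorm₂ w = ((fun y => ‖w 0 0 y‖) + fun y => ‖w 0 1 y‖)
        + ((fun y => ‖w 1 0 y‖) + fun y => ‖w 1 1 y‖) := by
      ext y; simp [sumNorm₂, Fin.sum_univ_two]
    rw [this]
    refine (eLpNorm_add_le (hm 0) (hm 1) hq).trans ((add_le_add (h2 0) (h2 1)).trans (le_of_eq ?_))
    rw [← ENNReal.ofReal_add (by positivity) (by positivity)]; ring_nf
  have hs : AEStronglyMeasurable (sumNorm₂ w) μ := by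
    have : sumNorm₂ w = ((fun y => ‖w 0 0 y‖) + fun y => ‖w 0 1 y‖)
        + ((fun y => ‖w 1 0 y‖) + fun y => ‖w 1 1 y‖) := by
      ext y; simp [sumNorm₂, Fin.sum_univ_two]
    rw [this]
    exact (hm 0).add (hm 1)
  have e1 : (fun y => a * sumNorm₂ w y + b) = a • sumNorm₂ w + fun _ => b := by
    ext y; simp
  rw [e1]
  refine (eLpNorm_add_le (hs.const_smul a) aestronglyMeasurable_const hq).trans ?_
  rw [ENNReal.ofReal_add (by positivity) (by positivity), eLpNorm_const_smul,
    ENNReal.ofReal_mul ha, Real.enorm_of_nonneg ha, mul_comm b, ENNReal.ofReal_mul hV0]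
  refine add_le_add (by gcongr) ?_
  refine (eLpNorm_le_of_ae_bound (C := b) (ae_of_all _ fun _ => ?_)).trans (by gcongr)
  rw [Real.norm_of_nonneg hb]

theorem eLpNorm_le_iff {α F : Type*} [MeasurableSpace α] {μ : Measure α} [NormedAddCommGroup F]
    {f : α → F} {q : ℝ} (hq : 0 < q) {A : ℝ≥0∞} : eLpNorm f (ENNReal.ofReal q) μ ≤ A ↔
      ∫⁻ x, ‖f x‖ₑ ^ q ∂μ ≤ A ^ q := by
  rw [eLpNorm_eq_lintegral_rpow_enorm_toReal (by simpa using hq) ENNReal.ofReal_ne_top,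
    ENNReal.toReal_ofReal hq.le, one_div, ENNReal.rpow_inv_le_iff hq]

end SecondOrder

section SecondOrderControl

variable {S : Type*} [TopologicalSpace S] [ChartedSpace Plane S] [IsManifold (𝓡 2) ∞ S]
  {𝔄 : DiscCover S} {m n : ℕ} {p : ℝ} {N : Set (Euc m)} {lam Lam : ℝ}

theorem exists_volume_disc_le (𝔄 : DiscCover S) (q : ℝ) : ∃ V, 0 ≤ V ∧ ∀ i, ∀ A ⊆ 𝔄.disc i, 0 < q →
    (volume.restrict A) univ ^ (ENNReal.ofReal q).toReal⁻¹ ≤ ENNReal.ofReal V := by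
  refine ⟨∑ i, (volume (𝔄.disc i) ^ q⁻¹).toReal, by positivity, fun i A hA hq => ?_⟩
  have hfin : volume (𝔄.disc i) ^ q⁻¹ ≠ ⊤ :=
    ENNReal.rpow_ne_top_of_nonneg (by positivity) measure_ball_lt_top.ne
  rw [ENNReal.toReal_ofReal hq.le, Measure.restrict_apply_univ]
  calc volume A ^ q⁻¹ ≤ volume (𝔄.disc i) ^ q⁻¹ := by gcongr
    _ = ENNReal.ofReal (volume (𝔄.disc i) ^ q⁻¹).toReal := (ENNReal.ofReal_toReal hfin).symm
    _ ≤ _ := ENNReal.ofReal_le_ofReal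
      (Finset.single_le_sum (f := fun i => (volume (𝔄.disc i) ^ q⁻¹).toReal)
        (fun _ _ => ENNReal.toReal_nonneg) (Finset.mem_univ i))

theorem eLpNorm_weak2_le_ofReal_norm (f : Sobolev 𝔄 m p) (i : Fin 𝔄.card) (k j : Fin 2) :
    eLpNorm (weak2 i k j f) (ENNReal.ofReal (2 * p)) (volume.restrict (𝔄.disc i))
      ≤ ENNReal.ofReal ‖f‖ := by
  rw [ENNReal.le_ofReal_iff_toReal_le (memLp_weak2 f i k j).2.ne f.zero_le_norm]
  exact eLpNorm_weak2_le_norm f i k j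

set_option maxSynthPendingDepth 3 in
set_option maxHeartbeats 1000000 in
/-- On the pieces, the second weak derivatives of a vector field are controlled by its Finsler
norm. -/
theorem exists_eLpNorm_piece_le (hp : 1 < p) (hN : IsClosedSubmanifold n N) (hl : 0 < lam) :
    ∃ C, 0 ≤ C ∧ ∀ (Φ v : Sobolev 𝔄 m p) (B : ℝ), BoundedField N lam Lam Φ v B → ∀ i k j,
      eLpNorm (weak2 i k j v) (ENNReal.ofReal (2 * p)) (volume.restrict (𝔄.piece i))
        ≤ ENNReal.ofReal (C * (1 + ‖Φ‖) * B) := by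
  obtain ⟨Q, hQ, hQN⟩ := exists_smooth_tangentProj hN
  obtain ⟨M₁, hM₁⟩ := hN.1.exists_bound_of_continuousOn (f := fderiv ℝ Q)
    (hQ.continuous_fderiv (by simp)).continuousOn
  obtain ⟨M₂, hM₂⟩ := hN.1.exists_bound_of_continuousOn (f := fderiv ℝ (fderiv ℝ Q))
    ((contDiff_infty_iff_fderiv.1 hQ).2.continuous_fderiv (by simp)).continuousOn
  obtain ⟨C₁, hC₁0, hC₁⟩ := exists_bound_C1 (𝔄 := 𝔄) (Lam := Lam) hp hN hl
  obtain ⟨V, hV0, hV⟩ := exists_volume_disc_le 𝔄 (2 * p)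
  set M := max M₁ M₂
  set K := |M * Lam + 3 * (M * √Lam) + M + 12 * (Lam ^ 2 / lam ^ 2)|
  set c := ((Lam ^ 2) ^ p / lam) with hc
  have hc0 : 0 ≤ c := by positivity
  refine ⟨c ^ (2 * p)⁻¹ + K * (C₁ + 1) * (4 + V), by positivity, fun Φ v B h i k j => ?_⟩
  have hB := h.pos
  have hq : 0 < 2 * p := by linarith
  have hq1 := one_le_ofReal hp
  set B₁ := (C₁ + 1) * B
  have hBB₁ : B ≤ B₁ := le_mul_of_one_le_left hB.le (by linarith)
  have hC₁B : C₁ * B ≤ B₁ := mul_le_mul_of_nonneg_right (by linarith) hB.le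
  set g : Plane → ℝ := fun y => K * B₁ * sumNorm₂ (fun k j => weak2 i k j Φ) y + K * B₁
  have hpd := piece_subset_disc 𝔄 i
  have hms : ∀ k j, AEStronglyMeasurable (weak2 i k j Φ) (volume.restrict (𝔄.piece i)) :=
    fun k j => (memLp_weak2 Φ i k j).1.mono_measure (Measure.restrict_mono hpd le_rfl)
  have hg : eLpNorm g (ENNReal.ofReal (2 * p)) (volume.restrict (𝔄.piece i))
      ≤ ENNReal.ofReal (K * B₁ * (4 * ‖Φ‖) + K * B₁ * V) :=
    eLpNorm_affine_sumNorm₂_le hq1 hms (by positivity) (by positivity) Φ.zero_le_norm hV0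
      (fun k j => (eLpNorm_mono_measure _ (Measure.restrict_mono hpd le_rfl)).trans
        (eLpNorm_weak2_le_ofReal_norm Φ i k j)) (hV i _ hpd hq)
  have hgm : AEStronglyMeasurable g (volume.restrict (𝔄.piece i)) := by
    have : AEStronglyMeasurable (sumNorm₂ fun k j => weak2 i k j Φ)
        (volume.restrict (𝔄.piece i)) := by
      have e1 : (sumNorm₂ fun k j => weak2 i k j Φ) = fun y => ∑ k, ∑ j, ‖weak2 i k j Φ y‖ := rfl
      rw [e1]
      exact Finset.aestronglyMeasurable_fun_sum _ fun k _ =>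
        Finset.aestronglyMeasurable_fun_sum _ fun j _ => (hms k j).norm
    exact (this.const_mul _).add aestronglyMeasurable_const
  -- the part of the second derivative that is not dominated by `g` is dominated by `|∇²v|`
  set f : Plane → ℝ := fun y => max (‖weak2 i k j v y‖ - g y) 0
  have hfm : AEStronglyMeasurable f (volume.restrict (𝔄.piece i)) :=
    ((((memLp_weak2 v i k j).1.mono_measure (Measure.restrict_mono hpd le_rfl)).norm.sub hgm).sup
      aestronglyMeasurable_const)
  have hf : eLpNorm f (ENNReal.ofReal (2 * p)) (volume.restrict (𝔄.piece i))
      ≤ ENNReal.ofReal (c ^ (2 * p)⁻¹ * B) := by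
    rw [eLpNorm_le_iff hq, ENNReal.ofReal_mul (by positivity),
      ENNReal.mul_rpow_of_nonneg _ _ hq.le, ENNReal.ofReal_rpow_of_nonneg (by positivity) hq.le,
      Real.rpow_inv_rpow hc0 hq.ne']
    refine le_trans ?_ (mul_le_mul_right (h.setLIntegral_le hp i) _)
    rw [← lintegral_const_mul' _ _ ENNReal.ofReal_ne_top]
    refine lintegral_mono_ae ?_
    have hsd := norm_second_derivative_le (𝔄.isOpen_disc i) (contDiffOn_loc_disc Φ i)
      (contDiffOn_loc_disc v i) (fun _ _ => h.mem _) hQ hQN (fun y _ => h.tangentProj_eq i y)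
      (fun k j => isWeakPartial_pd Φ i k j) (fun k j => isWeakPartial_pd v i k j) hl
      (fun z hz => (hM₁ z hz).trans (le_max_left M₁ M₂))
      (fun z hz => (hM₂ z hz).trans (le_max_right M₁ M₂)) (h.gram i) (hB.le.trans hBB₁)
      (fun y hy => (h.covNormSq_le i hy).trans (by gcongr))
      (fun y hy => (hC₁ Φ v B h i y hy).1.trans hC₁B)
      (fun y hy => (hC₁ Φ v B h i y hy).2.trans hC₁B)
    have hmem : ∀ᵐ y ∂volume.restrict (𝔄.disc i), y ∈ 𝔄.disc i :=
      ae_restrict_mem (𝔄.isOpen_disc i).measurableSet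
    filter_upwards [ae_mono (Measure.restrict_mono hpd le_rfl) hsd,
      ae_mono (Measure.restrict_mono hpd le_rfl) hmem] with y hy hyd
    have hgb := h.gram i y hyd
    have a1 := cov2NormSq_nonneg (v := 𝔄.loc i v.1) N (𝔄.disc i) hgb hl
    have a2 := covNormSq_nonneg (v := 𝔄.loc i v.1) N hgb hl
    have a3 := norm_cov2_sq_le (v := 𝔄.loc i v.1) N (𝔄.disc i) hgb hl k j
    have a4 := hgb.le_volDensity hl
    set T := cov2NormSq N (𝔄.disc i) (𝔄.loc i Φ.1) (𝔄.loc i v.1) y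
          + covNormSq N (𝔄.loc i Φ.1) (𝔄.loc i v.1) y + ‖𝔄.loc i v.1 y‖ ^ 2 with hT
    have hT0 : 0 ≤ T := by positivity
    have hfy : f y ≤ ‖cov2 N (𝔄.disc i) (𝔄.loc i Φ.1) (𝔄.loc i v.1) k j y‖ := by
      refine max_le ?_ (norm_nonneg _)
      have h1 := hy k j
      have h2 : (M * Lam + 3 * (M * √Lam) + M + 12 * (Lam ^ 2 / lam ^ 2))
          * (1 + sumNorm₂ (fun k j => weak2 i k j Φ) y) * B₁
          ≤ K * (1 + sumNorm₂ (fun k j => weak2 i k j Φ) y) * B₁ := by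
        have := sumNorm₂_nonneg (fun k j => weak2 i k j Φ) y
        have hB₁0 := hB.le.trans hBB₁
        gcongr
        exact le_abs_self _
      have h3 : g y = K * (1 + sumNorm₂ (fun k j => weak2 i k j Φ) y) * B₁ := by
        simp only [g]; ring
      rw [h3]
      linarith
    have hfy0 : 0 ≤ f y := le_max_right _ _
    rw [Real.enorm_of_nonneg hfy0, ENNReal.ofReal_rpow_of_nonneg hfy0 hq.le,
      ← ENNReal.ofReal_mul hc0]
    refine ENNReal.ofReal_le_ofReal ?_
    calc f y ^ (2 * p) = (f y ^ 2) ^ p := by rw [Real.rpow_mul hfy0, Real.rpow_two]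
      _ ≤ (Lam ^ 2 * T) ^ p := by
        refine Real.rpow_le_rpow (by positivity) ?_ (by linarith)
        refine (pow_le_pow_left₀ hfy0 hfy 2).trans (a3.trans ?_)
        refine mul_le_mul_of_nonneg_left ?_ (by positivity)
        rw [hT]
        linarith [sq_nonneg ‖𝔄.loc i v.1 y‖]
      _ = (Lam ^ 2) ^ p / lam * (T ^ p * lam) := by
        rw [Real.mul_rpow (by positivity) hT0]
        field_simp
      _ ≤ _ := by gcongr
  calc eLpNorm (weak2 i k j v) (ENNReal.ofReal (2 * p)) (volume.restrict (𝔄.piece i))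
      ≤ eLpNorm (f + g) (ENNReal.ofReal (2 * p)) (volume.restrict (𝔄.piece i)) := by
        refine eLpNorm_mono_ae_real (ae_of_all _ fun y => ?_)
        have := le_max_left (‖weak2 i k j v y‖ - g y) 0
        simp only [Pi.add_apply, f]
        linarith
    _ ≤ ENNReal.ofReal (c ^ (2 * p)⁻¹ * B) + ENNReal.ofReal (K * B₁ * (4 * ‖Φ‖) + K * B₁ * V) :=
        (eLpNorm_add_le hfm hgm hq1).trans (add_le_add hf hg)
    _ ≤ _ := by
        have hn := Φ.zero_le_norm
        rw [← ENNReal.ofReal_add (by positivity) (by positivity)]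
        refine ENNReal.ofReal_le_ofReal ?_
        have hc' : 0 ≤ c ^ (2 * p)⁻¹ := by positivity
        have hK : 0 ≤ K := abs_nonneg _
        clear_value c K
        generalize ‖Φ‖ = A at hn
        generalize c ^ (2 * p)⁻¹ = c' at hc'
        have h1 : 0 ≤ c' * A * B := by positivity
        have h2 : 0 ≤ K * (C₁ + 1) * B := by positivity
        have h3 : 0 ≤ K * (C₁ + 1) * B * (V * A) := by positivity
        simp only [B₁]
        linarith

end SecondOrderControl


section NormControl

variable {S : Type*} [TopologicalSpace S] [ChartedSpace Plane S] [IsManifold (𝓡 2) ∞ S]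
  [CompactSpace S] [T2Space S] {𝔄 : DiscCover S} {m n : ℕ} {p : ℝ} {N : Set (Euc m)} {lam Lam : ℝ}

/-- The second weak derivatives on a whole disc: its parts are transported to the pieces by changes
of charts. -/
theorem exists_eLpNorm_disc_le (hp : 1 < p) (hN : IsClosedSubmanifold n N) (hl : 0 < lam) :
    ∃ C, 0 ≤ C ∧ ∀ (Φ v : Sobolev 𝔄 m p) (B : ℝ), BoundedField N lam Lam Φ v B → ∀ i a k,
      eLpNorm (weak2 i a k v) (ENNReal.ofReal (2 * p)) (volume.restrict (𝔄.disc i))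
        ≤ ENNReal.ofReal (C * (1 + ‖Φ‖) * B) := by
  obtain ⟨C₁, hC₁0, hC₁⟩ := exists_bound_C1 (𝔄 := 𝔄) (Lam := Lam) hp hN hl
  obtain ⟨C₂, hC₂0, hC₂⟩ := exists_eLpNorm_piece_le (𝔄 := 𝔄) (Lam := Lam) hp hN hl
  obtain ⟨V, hV0, hV⟩ := exists_volume_disc_le 𝔄 (2 * p)
  obtain ⟨C₃, hC₃0, hC₃⟩ := exists_transition_bound 𝔄
  set κ := (𝔄.card * C₃) ^ (2 * p)⁻¹
  have hκ : 0 ≤ κ := by positivity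
  refine ⟨κ * (C₃ ^ 2 * (4 * C₂) + 2 * C₃ * C₁ * V), by positivity, fun Φ v B h i a k => ?_⟩
  have hB := h.pos
  have hn := Φ.zero_le_norm
  have hq : 0 < 2 * p := by linarith
  set D := (C₃ ^ 2 * (4 * C₂) + 2 * C₃ * C₁ * V) * (1 + ‖Φ‖) * B with hD
  set G : Fin 𝔄.card → Plane → ℝ := fun j z =>
    C₃ ^ 2 * sumNorm₂ (fun r l => weak2 j r l v) z + 2 * C₃ * (C₁ * B)
  have hG0 : ∀ j z, 0 ≤ G j z := fun j z => by
    have := sumNorm₂_nonneg (fun r l => weak2 j r l v) z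
    positivity
  have hGj : ∀ j, eLpNorm (G j) (ENNReal.ofReal (2 * p)) (volume.restrict (𝔄.piece j))
      ≤ ENNReal.ofReal D := fun j => by
    refine (eLpNorm_affine_sumNorm₂_le (one_le_ofReal hp) (fun r l =>
      (memLp_weak2 v j r l).1.mono_measure (Measure.restrict_mono (piece_subset_disc 𝔄 j) le_rfl))
      (by positivity) (by positivity) (by positivity) hV0 (hC₂ Φ v B h j)
      (hV j _ (piece_subset_disc 𝔄 j) hq)).trans (ENNReal.ofReal_le_ofReal ?_)
    have h1 : 0 ≤ C₃ * C₁ * V * B * ‖Φ‖ := by positivity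
    rw [hD]
    linarith
  rw [show κ * (C₃ ^ 2 * (4 * C₂) + 2 * C₃ * C₁ * V) * (1 + ‖Φ‖) * B = κ * D by rw [hD]; ring,
    eLpNorm_le_iff hq]
  calc ∫⁻ y in 𝔄.disc i, ‖weak2 i a k v y‖ₑ ^ (2 * p)
      ≤ ∫⁻ y in ⋃ j, part 𝔄 i j, ‖weak2 i a k v y‖ₑ ^ (2 * p) :=
        lintegral_mono_set (disc_subset_iUnion_part 𝔄 i)
    _ ≤ ∑' j, ∫⁻ y in part 𝔄 i j, ‖weak2 i a k v y‖ₑ ^ (2 * p) := lintegral_iUnion_le _ _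
    _ = ∑ j, ∫⁻ y in part 𝔄 i j, ‖weak2 i a k v y‖ₑ ^ (2 * p) := tsum_fintype _
    _ ≤ ∑ j : Fin 𝔄.card, ENNReal.ofReal C₃ * ENNReal.ofReal D ^ (2 * p) := by
        refine Finset.sum_le_sum fun j _ => ?_
        have h1 := norm_weak2_trans_le v hC₃0 (fun y hy => ⟨(hC₃ i j y hy).1, (hC₃ i j y hy).2.1⟩)
          (fun y hy => (hC₁ Φ v B h j y hy).2)
        have h2 : ∫⁻ y in part 𝔄 i j, ‖weak2 i a k v y‖ₑ ^ (2 * p)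
            ≤ ∫⁻ y in part 𝔄 i j, ‖G j (trans 𝔄 i j y)‖ₑ ^ (2 * p) := by
          refine lintegral_mono_ae ?_
          filter_upwards [ae_mono (Measure.restrict_mono (fun y hy => hy.1) le_rfl) h1] with y hy
          refine ENNReal.rpow_le_rpow ?_ hq.le
          rw [Real.enorm_of_nonneg (hG0 j _), ← ofReal_norm]
          exact ENNReal.ofReal_le_ofReal (hy a k)
        refine h2.trans ((setLIntegral_part_le 𝔄 hC₃0 (fun y hy => (hC₃ i j y hy).2.2)
          fun z => ‖G j z‖ₑ ^ (2 * p)).trans ?_)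
        gcongr
        exact (eLpNorm_le_iff hq).1 (hGj j)
    _ = ENNReal.ofReal (κ * D) ^ (2 * p) := by
        rw [Finset.sum_const, Finset.card_univ, Fintype.card_fin, nsmul_eq_mul, ← mul_assoc,
          ENNReal.ofReal_mul hκ, ENNReal.mul_rpow_of_nonneg _ _ hq.le,
          ENNReal.ofReal_rpow_of_nonneg hκ hq.le, Real.rpow_inv_rpow (by positivity) hq.ne',
          ENNReal.ofReal_mul (Nat.cast_nonneg 𝔄.card), ENNReal.ofReal_natCast]

theorem exists_norm_le (hp : 1 < p) (hN : IsClosedSubmanifold n N) (hl : 0 < lam) :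
    ∃ C, 0 ≤ C ∧ ∀ (Φ v : Sobolev 𝔄 m p) (B : ℝ), BoundedField N lam Lam Φ v B →
      ‖v‖ ≤ C * (1 + ‖Φ‖) * B := by
  obtain ⟨C₁, hC₁0, hC₁⟩ := exists_bound_C1 (𝔄 := 𝔄) (Lam := Lam) hp hN hl
  obtain ⟨C₂, hC₂0, hC₂⟩ := exists_eLpNorm_disc_le (𝔄 := 𝔄) (Lam := Lam) hp hN hl
  obtain ⟨V, hV0, hV⟩ := exists_volume_disc_le 𝔄 (2 * p)
  refine ⟨𝔄.card * (3 * (V * C₁) + 4 * C₂), by positivity, fun Φ v B h => ?_⟩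
  have hB := h.pos
  have hn := Φ.zero_le_norm
  have hq : 0 < 2 * p := by linarith
  have hVC : V * (C₁ * B) ≤ V * C₁ * (1 + ‖Φ‖) * B := by
    have : 0 ≤ V * C₁ * B * ‖Φ‖ := by positivity
    linarith
  have hbd : ∀ i (f : Plane → Euc m), (∀ y ∈ 𝔄.disc i, ‖f y‖ ≤ C₁ * B) →
      (eLpNorm f (ENNReal.ofReal (2 * p)) (volume.restrict (𝔄.disc i))).toReal
        ≤ V * C₁ * (1 + ‖Φ‖) * B := fun i f hf => by
    refine le_trans (ENNReal.toReal_le_of_le_ofReal (by positivity) ?_) hVC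
    refine (eLpNorm_le_of_ae_bound (C := C₁ * B)
      ((ae_restrict_iff' (𝔄.isOpen_disc i).measurableSet).2 (ae_of_all _ hf))).trans ?_
    rw [ENNReal.ofReal_mul hV0]
    gcongr
    exact hV i _ subset_rfl hq
  have h0 : ∀ i, _ := fun i => hbd i (𝔄.loc i v.1) fun y hy => (hC₁ Φ v B h i y hy).1
  have h1 : ∀ i j, _ := fun i j => hbd i (pd j (𝔄.loc i v.1)) fun y hy => by
    refine (ContinuousLinearMap.le_opNorm _ _).trans ?_
    rw [norm_e, mul_one]
    exact (hC₁ Φ v B h i y hy).2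
  have h2 : ∀ i j k, (eLpNorm (weak2 i k j v) (ENNReal.ofReal (2 * p))
      (volume.restrict (𝔄.disc i))).toReal ≤ C₂ * (1 + ‖Φ‖) * B := fun i j k =>
    ENNReal.toReal_le_of_le_ofReal (by positivity) (hC₂ Φ v B h i k j)
  rw [norm_eq_sum]
  refine (Finset.sum_le_sum fun i _ => add_le_add (add_le_add (h0 i) (Finset.sum_le_sum fun j _ =>
    h1 i j)) (Finset.sum_le_sum fun j _ => Finset.sum_le_sum fun k _ => h2 i j k)).trans
    (le_of_eq ?_)
  simp only [Finset.sum_const, Finset.card_univ, Fintype.card_fin, nsmul_eq_mul]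
  push_cast
  ring

/-- Along maps to `N` whose first fundamental form is bounded between fixed positive bounds, the
Sobolev norm of a vector field is controlled by its Finsler norm. -/
theorem exists_ofReal_norm_le (hp : 1 < p) (hN : IsClosedSubmanifold n N) (hl : 0 < lam)
    (Lam : ℝ) : ∃ C, 0 < C ∧ ∀ Φ v : Sobolev 𝔄 m p, (∀ x, Φ.1 x ∈ N) →
      (∀ i, ∀ y ∈ 𝔄.disc i, GramBound lam Lam (𝔄.loc i Φ.1) y) →
      (∀ x, v.1 x ∈ tangentAt N (Φ.1 x)) →
      ENNReal.ofReal ‖v‖ ≤ ENNReal.ofReal (C * (1 + ‖Φ‖)) * finslerNorm 𝔄 N Φ v := by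
  obtain ⟨C, hC0, hC⟩ := exists_norm_le (𝔄 := 𝔄) (Lam := Lam) hp hN hl
  refine ⟨C + 1, by positivity, fun Φ v h1 h2 h3 => ?_⟩
  have hn := Φ.zero_le_norm
  have hpos : 0 < (C + 1) * (1 + ‖Φ‖) := by positivity
  by_cases htop : finslerNorm 𝔄 N Φ v = ⊤
  · rw [htop, ENNReal.mul_top (by simpa using hpos)]
    exact le_top
  set F := (finslerNorm 𝔄 N Φ v).toReal with hF
  have hF0 : 0 ≤ F := ENNReal.toReal_nonneg
  have hFe : finslerNorm 𝔄 N Φ v = ENNReal.ofReal F := (ENNReal.ofReal_toReal htop).symm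
  rw [hFe, ← ENNReal.ofReal_mul hpos.le]
  refine ENNReal.ofReal_le_ofReal (le_of_forall_pos_le_add fun ε hε => ?_)
  have hδ : 0 < ε / ((C + 1) * (1 + ‖Φ‖)) := by positivity
  have h4 := hC Φ v (F + ε / ((C + 1) * (1 + ‖Φ‖)))
    ⟨hl, h1, h2, h3, by positivity, by rw [hFe]; exact ENNReal.ofReal_le_ofReal (by linarith)⟩
  refine h4.trans ?_
  calc C * (1 + ‖Φ‖) * (F + ε / ((C + 1) * (1 + ‖Φ‖)))
      ≤ (C + 1) * (1 + ‖Φ‖) * (F + ε / ((C + 1) * (1 + ‖Φ‖))) := by gcongr; linarith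
    _ = _ := by
      rw [mul_add, mul_div_cancel₀ _ hpos.ne']

end NormControl


/-! ### Propagation of bounds along curves of finite length -/

section LogBound

/-- A positive function whose logarithmic derivative is bounded by `c F` varies by a factor of at
most `exp (c ∫ F)`. No measurability of `F` is required. -/
theorem abs_log_sub_log_le {w w' : ℝ → ℝ} {F : ℝ → ℝ≥0∞} {c L : ℝ} (hc : 0 ≤ c) (hL : 0 ≤ L)
    (hw : ContinuousOn w (Icc 0 1)) (hw0 : ∀ t ∈ Icc (0 : ℝ) 1, 0 < w t)
    (hd : ∀ t ∈ Ioo (0 : ℝ) 1, HasDerivAt w (w' t) t) (hw' : ContinuousOn w' (Icc 0 1))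
    (hF : ∀ t ∈ Ioo (0 : ℝ) 1, ENNReal.ofReal (|w' t| / w t) ≤ ENNReal.ofReal c * F t)
    (hFL : ∫⁻ t in Icc (0 : ℝ) 1, F t ≤ ENNReal.ofReal L) {t : ℝ} (ht : t ∈ Icc (0 : ℝ) 1) :
    |Real.log (w t) - Real.log (w 0)| ≤ c * L := by
  have hsub : Icc 0 t ⊆ Icc (0 : ℝ) 1 := Icc_subset_Icc_right ht.2
  have hψ : ContinuousOn (fun s => w' s / w s) (Icc 0 t) :=
    (hw'.mono hsub).div (hw.mono hsub) fun s hs => (hw0 s (hsub hs)).ne'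
  have hint : IntervalIntegrable (fun s => w' s / w s) volume 0 t :=
    (hψ.mono (by rw [uIcc_of_le ht.1])).intervalIntegrable
  have h1 := intervalIntegral.integral_eq_sub_of_hasDerivAt_of_le ht.1
    (f := fun s => Real.log (w s))
    ((hw.mono hsub).log fun s hs => (hw0 s (hsub hs)).ne')
    (fun s hs => (hd s ⟨hs.1, hs.2.trans_le ht.2⟩).log
      (hw0 s (hsub (Ioo_subset_Icc_self hs))).ne') hint
  rw [← h1]
  refine (intervalIntegral.abs_integral_le_integral_abs ht.1).trans ?_
  rw [intervalIntegral.integral_of_le ht.1, integral_Ioc_eq_integral_Ioo]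
  rw [← ENNReal.ofReal_le_ofReal_iff (by positivity), ofReal_integral_eq_lintegral_ofReal
    ((hint.abs.1).mono_set Ioo_subset_Ioc_self) (ae_of_all _ fun _ => abs_nonneg _)]
  calc ∫⁻ s in Ioo 0 t, ENNReal.ofReal |w' s / w s|
      ≤ ∫⁻ s in Ioo 0 t, ENNReal.ofReal c * F s := by
        refine setLIntegral_mono' measurableSet_Ioo fun s hs => ?_
        rw [abs_div, abs_of_pos (hw0 s (hsub (Ioo_subset_Icc_self hs)))]
        exact hF s ⟨hs.1, hs.2.trans_le ht.2⟩
    _ = ENNReal.ofReal c * ∫⁻ s in Ioo 0 t, F s := lintegral_const_mul' _ _ ENNReal.ofReal_ne_top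
    _ ≤ ENNReal.ofReal c * ∫⁻ s in Icc 0 1, F s := by
        gcongr
        exact Ioo_subset_Icc_self.trans hsub
    _ ≤ ENNReal.ofReal (c * L) := by
        rw [ENNReal.ofReal_mul hc]
        gcongr

end LogBound

section Immersion

variable {S : Type*} [TopologicalSpace S] [ChartedSpace Plane S] [IsManifold (𝓡 2) ∞ S]
  {𝔄 : DiscCover S} {m n : ℕ} {p : ℝ} {N : Set (Euc m)} {lam Lam : ℝ}

theorem mdifferentiable_chart (𝔄 : DiscCover S) (i : Fin 𝔄.card) :
    (𝔄.chart i).MDifferentiable (𝓡 2) (𝓡 2) :=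
  ⟨(contMDiffOn_of_mem_maximalAtlas (𝔄.chart_mem i)).mdifferentiableOn (by simp),
    (contMDiffOn_symm_of_mem_maximalAtlas (𝔄.chart_mem i)).mdifferentiableOn (by simp)⟩

theorem injective_mfderiv_iff (f : Sobolev 𝔄 m p) {i : Fin 𝔄.card} {y : Plane}
    (hy : y ∈ (𝔄.chart i).target) :
    Function.Injective (mfderiv (𝓡 2) 𝓘(ℝ, Euc m) f.1 ((𝔄.chart i).symm y)) ↔
      Function.Injective (fderiv ℝ (𝔄.loc i f.1) y) := by
  have h1 := (mdifferentiable_chart 𝔄 i).symm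
  have h2 : MDifferentiableAt (𝓡 2) (𝓡 2) (𝔄.chart i).symm y := h1.mdifferentiableAt hy
  have h3 : MDifferentiableAt (𝓡 2) 𝓘(ℝ, Euc m) f.1 ((𝔄.chart i).symm y) :=
    f.2.1.mdifferentiable one_ne_zero _
  have h4 := mfderiv_comp y h3 h2
  have h5 : Function.Bijective (mfderiv (𝓡 2) (𝓡 2) (𝔄.chart i).symm y) := h1.mfderiv_bijective hy
  have h6 : fderiv ℝ (𝔄.loc i f.1) y = (mfderiv (𝓡 2) 𝓘(ℝ, Euc m) f.1 ((𝔄.chart i).symm y)).comp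
      (mfderiv (𝓡 2) (𝓡 2) (𝔄.chart i).symm y) := by
    rw [← h4, ← mfderiv_eq_fderiv]; rfl
  have h7 : (fderiv ℝ (𝔄.loc i f.1) y : Plane → Euc m)
      = (mfderiv (𝓡 2) 𝓘(ℝ, Euc m) f.1 ((𝔄.chart i).symm y)) ∘
        (mfderiv (𝓡 2) (𝓡 2) (𝔄.chart i).symm y) := by
    rw [h6]; rfl
  rw [h7]
  exact (Function.Injective.of_comp_iff' _ h5).symm

theorem GramBound.of_sphere {u : Plane → Euc m} {y : Plane} (hl : ∀ X : Plane, ‖X‖ = 1 →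
    lam ≤ ‖fderiv ℝ u y X‖ ^ 2 ∧ ‖fderiv ℝ u y X‖ ^ 2 ≤ Lam) : GramBound lam Lam u y := by
  intro X
  rcases eq_or_ne X 0 with rfl | hX
  · simp
  have hX' : 0 < ‖X‖ := norm_pos_iff.2 hX
  have h1 := hl (‖X‖⁻¹ • X) (by rw [norm_smul, norm_inv, norm_norm, inv_mul_cancel₀ hX'.ne'])
  rw [map_smul, norm_smul, norm_inv, norm_norm, mul_pow, inv_pow, inv_mul_eq_div,
    le_div_iff₀ (by positivity), div_le_iff₀ (by positivity)] at h1
  exact h1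

theorem GramBound.injective {u : Plane → Euc m} {y : Plane} (h : GramBound lam Lam u y)
    (hl : 0 < lam) : Function.Injective (fderiv ℝ u y) := by
  rw [injective_iff_map_eq_zero]
  intro X hX
  have h1 := (h X).1
  rw [hX, norm_zero] at h1
  by_contra h0
  have := norm_pos_iff.2 h0
  have : 0 < lam * ‖X‖ ^ 2 := by positivity
  linarith [zero_pow (M₀ := ℝ) (two_ne_zero)]

/-- The first fundamental form of an immersion is uniformly positive and bounded on the discs. -/
theorem exists_gramBound {Φ : Sobolev 𝔄 m p} (hΦ : Φ ∈ immersions 𝔄 p N) :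
    ∃ lam Lam, 0 < lam ∧ ∀ i, ∀ y ∈ 𝔄.disc i, GramBound lam Lam (𝔄.loc i Φ.1) y := by
  have key : ∀ i, ∃ C, 0 < C ∧ ∀ y ∈ 𝔄.disc i, ∀ X : Plane, ‖X‖ = 1 →
      C⁻¹ ≤ ‖fderiv ℝ (𝔄.loc i Φ.1) y X‖ ^ 2 ∧ ‖fderiv ℝ (𝔄.loc i Φ.1) y X‖ ^ 2 ≤ C := by
    intro i
    have hK : IsCompact (Metric.closedBall (𝔄.center i) (𝔄.radius i) ×ˢ Metric.sphere (0 : Plane) 1) :=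
      (isCompact_closedBall _ _).prod (isCompact_sphere _ _)
    have hc : ContinuousOn (fun z : Plane × Plane => ‖fderiv ℝ (𝔄.loc i Φ.1) z.1 z.2‖ ^ 2)
        (Metric.closedBall (𝔄.center i) (𝔄.radius i) ×ˢ Metric.sphere (0 : Plane) 1) := by
      have h1 : ContinuousOn (fderiv ℝ (𝔄.loc i Φ.1)) (𝔄.chart i).target :=
        (contDiffOn_loc Φ i).continuousOn_fderiv_of_isOpen (𝔄.chart i).open_target le_rfl
      have h2 : ContinuousOn (fun z : Plane × Plane => fderiv ℝ (𝔄.loc i Φ.1) z.1)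
          (Metric.closedBall (𝔄.center i) (𝔄.radius i) ×ˢ Metric.sphere (0 : Plane) 1) :=
        h1.comp continuousOn_fst fun z hz => 𝔄.closedBall_subset i hz.1
      exact (h2.clm_apply continuousOn_snd).norm.pow 2
    have hne : ∀ z ∈ Metric.closedBall (𝔄.center i) (𝔄.radius i) ×ˢ Metric.sphere (0 : Plane) 1,
        ‖fderiv ℝ (𝔄.loc i Φ.1) z.1 z.2‖ ^ 2 ≠ 0 := by
      rintro ⟨y, X⟩ ⟨hy, hX⟩
      have h1 := (injective_mfderiv_iff Φ (𝔄.closedBall_subset i hy)).1 (hΦ.2 _)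
      have h2 : X ≠ 0 := by
        rintro rfl
        simp at hX
      exact pow_ne_zero 2 (norm_ne_zero_iff.2 fun h => h2 (h1 (h.trans (map_zero _).symm)))
    obtain ⟨C₁, h1⟩ := hK.exists_bound_of_continuousOn hc
    obtain ⟨C₂, h2⟩ := hK.exists_bound_of_continuousOn (hc.inv₀ hne)
    refine ⟨max 1 (max C₁ C₂), lt_max_of_lt_left one_pos, fun y hy X hX => ?_⟩
    have hmem : (y, X) ∈ Metric.closedBall (𝔄.center i) (𝔄.radius i) ×ˢ Metric.sphere (0 : Plane) 1 :=
      ⟨Metric.ball_subset_closedBall hy, by simpa using hX⟩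
    have hpos : 0 < ‖fderiv ℝ (𝔄.loc i Φ.1) y X‖ ^ 2 :=
      lt_of_le_of_ne (by positivity) (hne _ hmem).symm
    refine ⟨inv_le_of_inv_le₀ hpos ?_, ?_⟩
    · exact (le_abs_self _).trans ((h2 _ hmem).trans ((le_max_right _ _).trans (le_max_right _ _)))
    · exact (le_abs_self _).trans ((h1 _ hmem).trans ((le_max_left _ _).trans (le_max_right _ _)))
  choose C hC0 hC using key
  have hle : ∀ i, C i ≤ 1 + ∑ i, C i := fun i => by
    have := Finset.single_le_sum (f := C) (fun i _ => (hC0 i).le) (Finset.mem_univ i)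
    linarith
  have hpos : 0 < 1 + ∑ i, C i := by
    have := Finset.sum_nonneg (s := Finset.univ) fun i _ => (hC0 i).le
    linarith
  refine ⟨(1 + ∑ i, C i)⁻¹, 1 + ∑ i, C i, by positivity, fun i y hy => GramBound.of_sphere
    fun X hX => ⟨?_, (hC i y hy X hX).2.trans (hle i)⟩⟩
  exact (inv_anti₀ (hC0 i) (hle i)).trans (hC i y hy X hX).1

/-- The differential of a map to `N` takes its values in the tangent spaces of `N`. -/
theorem fderiv_mem_tangentAt {Φ : Sobolev 𝔄 m p} (hΦ : ∀ x, Φ.1 x ∈ N) {i : Fin 𝔄.card} {y : Plane}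
    (hy : y ∈ 𝔄.disc i) (X : Plane) :
    fderiv ℝ (𝔄.loc i Φ.1) y X ∈ tangentAt N (𝔄.loc i Φ.1 y) := by
  refine Submodule.subset_span ⟨fun s => 𝔄.loc i Φ.1 (y + s • X), by simp,
    Eventually.of_forall fun s => hΦ _, ?_⟩
  have h1 : HasDerivAt (fun s : ℝ => y + s • X) X 0 := by
    simpa using ((hasDerivAt_id (0 : ℝ)).smul_const X).const_add y
  have h2 : HasFDerivAt (𝔄.loc i Φ.1) (fderiv ℝ (𝔄.loc i Φ.1) y) (y + (0 : ℝ) • X) := by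
    simpa using (differentiableAt_loc Φ hy).hasFDerivAt
  exact h2.comp_hasDerivAt (0 : ℝ) h1

end Immersion


section CurveBound

/-- A `C¹` curve on `[0,1]` is the integral of a continuous function on the whole line. -/
theorem exists_continuous_derivative {E : Type*} [NormedAddCommGroup E] [NormedSpace ℝ E]
    [CompleteSpace E] {c : ℝ → E} (hc : ContDiffOn ℝ 1 c (Icc 0 1)) :
    ∃ c' : ℝ → E, Continuous c' ∧ (∀ t ∈ Icc (0 : ℝ) 1, derivWithin c (Icc 0 1) t = c' t) ∧
      ∀ t ∈ Icc (0 : ℝ) 1, c t = c 0 + ∫ s in (0 : ℝ)..t, c' s := by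
  have h1 : ContinuousOn (derivWithin c (Icc 0 1)) (Icc 0 1) :=
    hc.continuousOn_derivWithin (uniqueDiffOn_Icc zero_lt_one) le_rfl
  have heq : ∀ t ∈ Icc (0 : ℝ) 1, derivWithin c (Icc 0 1) t
      = IccExtend zero_le_one (domRestrict (Icc 0 1) (derivWithin c (Icc 0 1))) t := fun t ht => by
    rw [IccExtend_of_mem _ _ ht]; rfl
  have hcont : Continuous (IccExtend zero_le_one (domRestrict (Icc 0 1) (derivWithin c (Icc 0 1)))) :=
    (continuousOn_iff_continuous_domRestrict.1 h1).Icc_extend'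
  refine ⟨_, hcont, heq, fun t ht => ?_⟩
  have hsub : Icc 0 t ⊆ Icc (0 : ℝ) 1 := Icc_subset_Icc_right ht.2
  rw [intervalIntegral.integral_eq_sub_of_hasDerivAt_of_le ht.1 (hc.continuousOn.mono hsub)
    (fun s hs => ?_) (hcont.intervalIntegrable _ _)]
  · abel
  · have hs' : s ∈ Icc (0 : ℝ) 1 := hsub (Ioo_subset_Icc_self hs)
    rw [← heq s hs']
    exact ((hc.differentiableOn one_ne_zero) s hs').hasDerivWithinAt.hasDerivAt
      (Icc_mem_nhds hs.1 (hs.2.trans_le ht.2))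

variable {S : Type*} [TopologicalSpace S] [ChartedSpace Plane S] [IsManifold (𝓡 2) ∞ S]
  {𝔄 : DiscCover S} {m n : ℕ} {p : ℝ} {N : Set (Euc m)} {lam Lam : ℝ}

theorem ofReal_sqrt_covNormSq_le (Φ v : Sobolev 𝔄 m p) {i : Fin 𝔄.card} {y : Plane}
    (hy : y ∈ 𝔄.disc i) : ENNReal.ofReal √(covNormSq N (𝔄.loc i Φ.1) (𝔄.loc i v.1) y)
      ≤ finslerNorm 𝔄 N Φ v := by
  refine le_trans ?_ le_add_self
  exact le_iSup_of_le i (le_iSup₂_of_le (f := fun y (_ : y ∈ 𝔄.disc i) =>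
    ENNReal.ofReal √(covNormSq N (𝔄.loc i Φ.1) (𝔄.loc i v.1) y)) y hy le_rfl)

variable [Fact (1 < p)] {γ : ℝ → Sobolev 𝔄 m p}

theorem hasDerivAt_curve (hγ : ContDiffOn ℝ 1 γ (Icc 0 1)) {t : ℝ} (ht : t ∈ Ioo (0 : ℝ) 1) :
    HasDerivAt γ (derivWithin γ (Icc 0 1) t) t :=
  ((hγ.differentiableOn one_ne_zero) t (Ioo_subset_Icc_self ht)).hasDerivWithinAt.hasDerivAt
    (Icc_mem_nhds ht.1 ht.2)

/-- The velocity of a curve of maps to `N` is tangent to `N`. -/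
theorem velocity_mem_tangentAt (hγ : ContDiffOn ℝ 1 γ (Icc 0 1))
    (hN : ∀ t ∈ Icc (0 : ℝ) 1, ∀ x, (γ t).1 x ∈ N) {t : ℝ} (ht : t ∈ Ioo (0 : ℝ) 1) (x : S) :
    (derivWithin γ (Icc 0 1) t).1 x ∈ tangentAt N ((γ t).1 x) := by
  obtain ⟨i, hx, hxi⟩ := 𝔄.covers x
  have hev : ∀ f : Sobolev 𝔄 m p, evalCLM 𝔄 m p (show 𝔄.chart i x ∈ 𝔄.disc i from hxi) f = f.1 x :=
    fun f => by
      rw [evalCLM_apply, DiscCover.loc, Function.comp_apply, (𝔄.chart i).left_inv hx]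
  have h1 := (evalCLM 𝔄 m p (show 𝔄.chart i x ∈ 𝔄.disc i from hxi)).hasFDerivAt.comp_hasDerivAt t
    (hasDerivAt_curve hγ ht)
  rw [hev] at h1
  have h2 : HasDerivAt (fun s => (γ s).1 x) ((derivWithin γ (Icc 0 1) t).1 x) (t + 0) := by
    rw [add_zero]
    refine h1.congr_of_eventuallyEq (Eventually.of_forall fun s => ?_)
    exact (hev (γ s)).symm
  refine Submodule.subset_span ⟨fun s => (γ (t + s)).1 x, by simp, ?_, h2.comp_const_add t 0⟩
  have h3 : ∀ᶠ s in 𝓝 (0 : ℝ), t + s ∈ Icc (0 : ℝ) 1 := by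
    have : Tendsto (fun s : ℝ => t + s) (𝓝 0) (𝓝 t) := by
      simpa using (continuous_const_add t).tendsto' (0 : ℝ) (t + 0) rfl
    exact this.eventually (Icc_mem_nhds ht.1 ht.2)
  exact h3.mono fun s hs => hN _ hs x

/-- Along a curve of immersions of length at most one, the lengths of tangent vectors vary at most by
a fixed factor: their logarithmic derivatives are bounded by the Finsler norm of the velocity. -/
theorem gramBound_of_finslerLength_le (hγ : ContDiffOn ℝ 1 γ (Icc 0 1))
    (him : ∀ t ∈ Icc (0 : ℝ) 1, γ t ∈ immersions 𝔄 p N) (hlen : finslerLength 𝔄 N γ ≤ 1)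
    {i : Fin 𝔄.card} {y : Plane} (hy : y ∈ 𝔄.disc i) (h0 : GramBound lam Lam (𝔄.loc i (γ 0).1) y)
    {t : ℝ} (ht : t ∈ Icc (0 : ℝ) 1) :
    GramBound (lam * Real.exp (-2)) (Lam * Real.exp 2) (𝔄.loc i (γ t).1) y := by
  intro X
  rcases eq_or_ne X 0 with rfl | hX
  · simp
  have hinj : ∀ t ∈ Icc (0 : ℝ) 1, Function.Injective (fderiv ℝ (𝔄.loc i (γ t).1) y) := fun t ht =>
    (injective_mfderiv_iff (γ t) (𝔄.disc_subset i hy)).1 ((him t ht).2 _)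
  have hpos : ∀ t ∈ Icc (0 : ℝ) 1, 0 < ‖fderiv ℝ (𝔄.loc i (γ t).1) y X‖ ^ 2 := fun t ht =>
    pow_pos (norm_pos_iff.2 fun h => hX (hinj t ht (h.trans (map_zero _).symm))) 2
  set D : Sobolev 𝔄 m p →L[ℝ] Euc m :=
    (ContinuousLinearMap.apply ℝ (Euc m) X).comp (fderivCLM 𝔄 m p hy)
  have hD : ∀ f, D f = fderiv ℝ (𝔄.loc i f.1) y X := fun f => rfl
  have hlog := abs_log_sub_log_le (w := fun t => ‖D (γ t)‖ ^ 2)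
    (w' := fun t => 2 * ⟪D (γ t), D (derivWithin γ (Icc 0 1) t)⟫_ℝ)
    (F := fun t => finslerNorm 𝔄 N (γ t) (derivWithin γ (Icc 0 1) t)) (c := 2) (L := 1)
    zero_le_two zero_le_one ((D.continuous.comp_continuousOn hγ.continuousOn).norm.pow 2) hpos
    (fun t ht => (D.hasFDerivAt.comp_hasDerivAt t (hasDerivAt_curve hγ ht)).norm_sq)
    (continuousOn_const.mul ((D.continuous.comp_continuousOn hγ.continuousOn).inner
      (D.continuous.comp_continuousOn
        (hγ.continuousOn_derivWithin (uniqueDiffOn_Icc zero_lt_one) le_rfl)))) ?_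
    (by rw [ENNReal.ofReal_one]; exact hlen) ht
  · have p0 := hpos 0 (left_mem_Icc.2 zero_le_one)
    have pt := hpos t ht
    have hb := h0 X
    simp only [hD] at hlog
    rw [mul_one, ← Real.log_div pt.ne' p0.ne', abs_le] at hlog
    have e1 := (Real.le_log_iff_exp_le (div_pos pt p0)).1 hlog.1
    have e2 := (Real.log_le_iff_le_exp (div_pos pt p0)).1 hlog.2
    rw [le_div_iff₀ p0] at e1
    rw [div_le_iff₀ p0] at e2
    constructor
    · refine le_trans ?_ e1
      calc lam * Real.exp (-2) * ‖X‖ ^ 2 = Real.exp (-2) * (lam * ‖X‖ ^ 2) := by ring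
        _ ≤ _ := mul_le_mul_of_nonneg_left hb.1 (Real.exp_pos _).le
    · refine e2.trans ?_
      calc _ ≤ Real.exp 2 * (Lam * ‖X‖ ^ 2) := mul_le_mul_of_nonneg_left hb.2 (Real.exp_pos _).le
        _ = _ := by ring
  · intro s hs
    have hs' := Ioo_subset_Icc_self hs
    have ps : 0 < ‖D (γ s)‖ ^ 2 := hpos s hs'
    obtain ⟨l, L, hl, hg⟩ := exists_gramBound (him s hs')
    set v := derivWithin γ (Icc 0 1) s
    have hc := norm_tangentProj_fderiv_sq_le (v := 𝔄.loc i v.1) N (hg i y hy) hl X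
    have hc0 := covNormSq_nonneg (v := 𝔄.loc i v.1) N (hg i y hy) hl
    have hP : ‖tangentProj N (𝔄.loc i (γ s).1 y) (D v)‖
        ≤ ‖D (γ s)‖ * √(covNormSq N (𝔄.loc i (γ s).1) (𝔄.loc i v.1) y) := by
      refine abs_le_of_sq_le_sq' ?_ (by positivity) |>.2
      rw [mul_pow, Real.sq_sqrt hc0]
      exact hc
    have hin : ⟪D (γ s), D v⟫_ℝ = ⟪D (γ s), tangentProj N (𝔄.loc i (γ s).1 y) (D v)⟫_ℝ := by
      have h1 : tangentProj N (𝔄.loc i (γ s).1 y) (D (γ s)) = D (γ s) :=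
        tangentProj_of_mem (fderiv_mem_tangentAt (him s hs').1 hy X)
      conv_lhs => rw [← h1]
      exact Submodule.inner_starProjection_left_eq_right _ _ _
    have hw : |2 * ⟪D (γ s), D v⟫_ℝ| / ‖D (γ s)‖ ^ 2
        ≤ 2 * √(covNormSq N (𝔄.loc i (γ s).1) (𝔄.loc i v.1) y) := by
      rw [div_le_iff₀ ps, hin, abs_mul, abs_two]
      have h2 := (abs_real_inner_le_norm (D (γ s)) (tangentProj N (𝔄.loc i (γ s).1 y) (D v))).trans
        (mul_le_mul_of_nonneg_left hP (norm_nonneg _))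
      linarith
    refine (ENNReal.ofReal_le_ofReal hw).trans ?_
    rw [ENNReal.ofReal_mul zero_le_two]
    gcongr
    exact ofReal_sqrt_covNormSq_le (γ s) v hy

/-- Along the curves of length at most one that start in a set where the first fundamental form and
the Sobolev norm are controlled, the Sobolev length is controlled by the Finsler length. -/
theorem exists_curve_bound [CompactSpace S] [T2Space S] (hN : IsClosedSubmanifold n N)
    (hl : 0 < lam) (Lam R : ℝ) : ∃ C, 0 < C ∧ ∀ γ : ℝ → Sobolev 𝔄 m p, ContDiffOn ℝ 1 γ (Icc 0 1) →
      (∀ t ∈ Icc (0 : ℝ) 1, γ t ∈ immersions 𝔄 p N) → finslerLength 𝔄 N γ ≤ 1 →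
      (∀ i, ∀ y ∈ 𝔄.disc i, GramBound lam Lam (𝔄.loc i (γ 0).1) y) → ‖γ 0‖ ≤ R →
      (∀ t ∈ Icc (0 : ℝ) 1, ‖γ t‖ ≤ C) ∧ ∀ t ∈ Ioo (0 : ℝ) 1,
        ENNReal.ofReal ‖derivWithin γ (Icc 0 1) t‖
          ≤ ENNReal.ofReal C * finslerNorm 𝔄 N (γ t) (derivWithin γ (Icc 0 1) t) := by
  obtain ⟨C, hC0, hC⟩ := exists_ofReal_norm_le (𝔄 := 𝔄) (Fact.out : 1 < p) hN
    (show 0 < lam * Real.exp (-2) by positivity) (Lam * Real.exp 2)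
  set C' := (1 + |R|) * Real.exp C
  refine ⟨C' + C * (1 + C'), by positivity, fun γ hγ him hlen hg hR => ?_⟩
  have hF : ∀ t ∈ Ioo (0 : ℝ) 1, ENNReal.ofReal ‖derivWithin γ (Icc 0 1) t‖
      ≤ ENNReal.ofReal (C * (1 + ‖γ t‖)) * finslerNorm 𝔄 N (γ t) (derivWithin γ (Icc 0 1) t) :=
    fun t ht => hC _ _ (him t (Ioo_subset_Icc_self ht)).1
      (fun i y hy => gramBound_of_finslerLength_le hγ him hlen hy (hg i y hy)
        (Ioo_subset_Icc_self ht))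
      (velocity_mem_tangentAt hγ (fun t ht => (him t ht).1) ht)
  obtain ⟨c', hc'1, hc'2, hc'3⟩ := exists_continuous_derivative hγ
  set a : ℝ → ℝ := fun t => 1 + ‖γ 0‖ + ∫ s in (0 : ℝ)..t, ‖c' s‖
  have ha : ∀ t, HasDerivAt a ‖c' t‖ t := fun t =>
    (hc'1.norm.integral_hasStrictDerivAt 0 t).hasDerivAt.const_add _
  have hγa : ∀ t ∈ Icc (0 : ℝ) 1, 1 + ‖γ t‖ ≤ a t := fun t ht => by
    rw [hc'3 t ht]
    have h1 := norm_add_le (γ 0) (∫ s in (0 : ℝ)..t, c' s)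
    have h2 := intervalIntegral.norm_integral_le_integral_norm (f := c') (μ := volume) ht.1
    simp only [a]
    linarith
  have ha0 : ∀ t ∈ Icc (0 : ℝ) 1, 0 < a t := fun t ht =>
    lt_of_lt_of_le (by positivity) (hγa t ht)
  have hbound : ∀ t ∈ Icc (0 : ℝ) 1, 1 + ‖γ t‖ ≤ C' := fun t ht => by
    have hlog := abs_log_sub_log_le (w := a) (w' := fun t => ‖c' t‖)
      (F := fun t => finslerNorm 𝔄 N (γ t) (derivWithin γ (Icc 0 1) t)) (c := C) (L := 1)
      hC0.le zero_le_one (fun t _ => (ha t).continuousAt.continuousWithinAt) ha0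
      (fun t _ => ha t) hc'1.norm.continuousOn (fun s hs => ?_) (by rw [ENNReal.ofReal_one]; exact hlen) ht
    · have e0 : a 0 = 1 + ‖γ 0‖ := by simp [a]
      rw [mul_one] at hlog
      have h1 := (abs_le.1 hlog).2
      have hp0 : 0 < a 0 := ha0 0 (left_mem_Icc.2 zero_le_one)
      have h2 : Real.log (a t) ≤ Real.log (a 0) + C := by linarith
      rw [Real.log_le_iff_le_exp (ha0 t ht), Real.exp_add, Real.exp_log hp0, e0] at h2
      refine (hγa t ht).trans (h2.trans ?_)
      simp only [C']
      gcongr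
      exact hR.trans (le_abs_self R)
    · have hs' := Ioo_subset_Icc_self hs
      rw [abs_norm, ENNReal.ofReal_div_of_pos (ha0 s hs')]
      refine ENNReal.div_le_of_le_mul ?_
      rw [← hc'2 s hs']
      refine (hF s hs).trans ?_
      rw [mul_right_comm, ← ENNReal.ofReal_mul hC0.le]
      gcongr
      exact hγa s hs'
  have hC'0 : 0 ≤ C' := by positivity
  refine ⟨fun t ht => ?_, fun t ht => (hF t ht).trans ?_⟩
  · have := hbound t ht
    have : 0 ≤ C * (1 + C') := by positivity
    linarith
  · gcongr
    have h1 : C * (1 + ‖γ t‖) ≤ C * (1 + C') := by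
      gcongr
      linarith [hbound t (Ioo_subset_Icc_self ht)]
    linarith

end CurveBound


/-! ### Concatenation of infinitely many curves -/

section Concatenation

/-- A bound `C` such that every continuous velocity field `g` on `[0,1]` with `∫ ‖g‖ ≤ b` admits
a `C¹` reparametrisation `φ : ℝ → [0,1]`, constant outside `[0,1]`, of speed at most `C b`. -/
theorem exists_reparametrisation {E : Type*} [NormedAddCommGroup E] :
    ∃ C, 0 < C ∧ ∀ {g : ℝ → E} (_ : Continuous g) {b : ℝ} (_ : 0 < b)
    (_ : ∫ t in (0 : ℝ)..1, ‖g t‖ ≤ b), ∃ φ φ' : ℝ → ℝ, Continuous φ' ∧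
      (∀ t, HasDerivAt φ (φ' t) t) ∧ (∀ t, φ t ∈ Icc (0 : ℝ) 1) ∧ (∀ t ≤ 0, φ t = 0) ∧
      (∀ t, 1 ≤ t → φ t = 1) ∧ (∀ t, 0 ≤ φ' t) ∧ ∀ t, ‖g (φ t)‖ * φ' t ≤ C * b := by
  have hS : ContDiff ℝ 1 Real.smoothTransition := Real.smoothTransition.contDiff (n := 1)
  have hSc : Continuous (deriv Real.smoothTransition) := hS.continuous_deriv le_rfl
  have hSd : ∀ t, HasDerivAt Real.smoothTransition (deriv Real.smoothTransition t) t := fun t =>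
    ((hS.differentiable one_ne_zero) t).hasDerivAt
  have hS0 : ∀ t, 0 ≤ deriv Real.smoothTransition t := fun t =>
    Real.smoothTransition.monotone.deriv_nonneg
  obtain ⟨C₀, hC₀⟩ := (isCompact_Icc (a := (0 : ℝ)) (b := 1)).exists_bound_of_continuousOn
    hSc.continuousOn
  have hSb : ∀ t, deriv Real.smoothTransition t ≤ max C₀ 1 := fun t => by
    by_cases ht : t ∈ Icc (0 : ℝ) 1
    · exact (le_abs_self _).trans ((hC₀ t ht).trans (le_max_left _ _))
    · have : deriv Real.smoothTransition t = 0 := by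
        rw [mem_Icc, not_and_or, not_le, not_le] at ht
        rcases ht with ht | ht
        · have h1 : Real.smoothTransition =ᶠ[𝓝 t] fun _ => 0 := by
            filter_upwards [Iio_mem_nhds ht] with s hs
            exact Real.smoothTransition.zero_of_nonpos hs.le
          rw [h1.deriv_eq, deriv_const]
        · have h1 : Real.smoothTransition =ᶠ[𝓝 t] fun _ => 1 := by
            filter_upwards [Ioi_mem_nhds ht] with s hs
            exact Real.smoothTransition.one_of_one_le hs.le
          rw [h1.deriv_eq, deriv_const]
      rw [this]
      exact zero_le_one.trans (le_max_right _ _)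
  refine ⟨2 * max C₀ 1, by positivity, fun {g} hg {b} hb hgb => ?_⟩
  -- the arc length parameter of `g`, regularised by `b`, and its inverse function
  set T := b + ∫ t in (0 : ℝ)..1, ‖g t‖
  have hI0 : 0 ≤ ∫ t in (0 : ℝ)..1, ‖g t‖ :=
    intervalIntegral.integral_nonneg zero_le_one fun _ _ => norm_nonneg _
  have hT0 : 0 < T := by positivity
  have hT : T ≤ 2 * b := by
    show b + ∫ t in (0 : ℝ)..1, ‖g t‖ ≤ 2 * b
    linarith
  set σ : ℝ → ℝ := fun t => (b * t + ∫ s in (0 : ℝ)..t, ‖g s‖) / T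
  have hσ : ∀ t, HasDerivAt σ ((b + ‖g t‖) / T) t := fun t => by
    have h1 : HasDerivAt (fun t => b * t) b t := by simpa using (hasDerivAt_id t).const_mul b
    exact (h1.add (hg.norm.integral_hasStrictDerivAt 0 t).hasDerivAt).div_const T
  have hσmono : StrictMono σ := strictMono_of_hasDerivAt_pos hσ fun t => by positivity
  have hσc : Continuous σ := continuous_iff_continuousAt.2 fun t => (hσ t).continuousAt
  have htop : Tendsto σ atTop atTop := by
    refine tendsto_atTop_mono' _ ?_ ((tendsto_id.const_mul_atTop hb).atTop_div_const hT0)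
    filter_upwards [eventually_ge_atTop 0] with t ht
    have : 0 ≤ ∫ s in (0 : ℝ)..t, ‖g s‖ :=
      intervalIntegral.integral_nonneg ht fun _ _ => norm_nonneg _
    simp only [σ, id]
    gcongr
    linarith
  have hbot : Tendsto σ atBot atBot := by
    refine tendsto_atBot_mono' _ ?_ ((tendsto_id.const_mul_atBot hb).atBot_div_const hT0)
    filter_upwards [eventually_le_atBot 0] with t ht
    have : 0 ≤ ∫ s in t..(0 : ℝ), ‖g s‖ :=
      intervalIntegral.integral_nonneg ht fun _ _ => norm_nonneg _
    simp only [σ, id]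
    rw [intervalIntegral.integral_symm]
    gcongr
    linarith
  set O := hσmono.orderIsoOfSurjective σ (hσc.surjective htop hbot)
  have hO : ∀ t, σ (O.symm t) = t := fun t => O.apply_symm_apply t
  have hO' : ∀ t, O.symm (σ t) = t := fun t => O.symm_apply_apply t
  have hτ : ∀ t, HasDerivAt O.symm ((b + ‖g (O.symm t)‖) / T)⁻¹ t := fun t =>
    HasDerivAt.of_local_left_inverse O.symm.continuous.continuousAt (hσ _)
      (by positivity) (Eventually.of_forall hO)
  have hσ0 : σ 0 = 0 := by simp [σ]
  have hσ1 : σ 1 = 1 := by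
    simp only [σ, mul_one]
    exact div_self hT0.ne'
  have hτ0 : O.symm 0 = 0 := by conv_lhs => rw [← hσ0, hO']
  have hτ1 : O.symm 1 = 1 := by conv_lhs => rw [← hσ1, hO']
  have hpos : ∀ t, 0 ≤ ((b + ‖g t‖) / T)⁻¹ := fun t => by positivity
  refine ⟨fun t => O.symm (Real.smoothTransition t),
    fun t => ((b + ‖g (O.symm (Real.smoothTransition t))‖) / T)⁻¹ * deriv Real.smoothTransition t,
    ?_, fun t => (hτ _).comp t (hSd t), fun t => ⟨?_, ?_⟩, fun t ht => ?_, fun t ht => ?_,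
    fun t => mul_nonneg (hpos _) (hS0 t), fun t => ?_⟩
  · refine Continuous.mul (Continuous.inv₀ ?_ fun t => ?_) hSc
    · exact (continuous_const.add (hg.comp (O.symm.continuous.comp
        Real.smoothTransition.continuous)).norm).div_const T
    · positivity
  · rw [← hτ0]
    exact O.symm.monotone (Real.smoothTransition.nonneg t)
  · rw [← hτ1]
    exact O.symm.monotone (Real.smoothTransition.le_one t)
  · simp only [Real.smoothTransition.zero_of_nonpos ht, hτ0]
  · simp only [Real.smoothTransition.one_of_one_le ht, hτ1]
  · have h1 : ‖g (O.symm (Real.smoothTransition t))‖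
        * ((b + ‖g (O.symm (Real.smoothTransition t))‖) / T)⁻¹ ≤ T := by
      rw [inv_div, mul_div_assoc', div_le_iff₀ (by positivity)]
      nlinarith [norm_nonneg (g (O.symm (Real.smoothTransition t)))]
    calc _ = ‖g (O.symm (Real.smoothTransition t))‖
          * ((b + ‖g (O.symm (Real.smoothTransition t))‖) / T)⁻¹
            * deriv Real.smoothTransition t := by ring
      _ ≤ (2 * b) * max C₀ 1 := mul_le_mul (h1.trans hT) (hSb t) (hS0 t) (by positivity)
      _ = _ := by ring

/-- The times `1 - 2⁻ⁱ` at which the successive curves are joined. -/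
noncomputable def joinTime (i : ℕ) : ℝ := 1 - (1 / 2) ^ i

theorem joinTime_zero : joinTime 0 = 0 := by simp [joinTime]

theorem joinTime_mono : Monotone joinTime := fun i j h => by
  unfold joinTime
  have := pow_le_pow_of_le_one (by norm_num : (0 : ℝ) ≤ 1 / 2) (by norm_num) h
  linarith

theorem tendsto_joinTime : Tendsto joinTime atTop (𝓝 1) := by
  have := (tendsto_pow_atTop_nhds_zero_of_lt_one (by norm_num : (0 : ℝ) ≤ 1 / 2)
    (by norm_num)).const_sub 1
  rw [sub_zero] at this
  exact this

theorem exists_mem_Ico_joinTime {t : ℝ} (ht : t ∈ Ico (0 : ℝ) 1) :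
    ∃ i, t ∈ Ico (joinTime i) (joinTime (i + 1)) := by
  classical
  have hex : ∃ i, t < joinTime i := (tendsto_joinTime.eventually (lt_mem_nhds ht.2)).exists
  have hne : Nat.find hex ≠ 0 := fun h0 => by
    have := Nat.find_spec hex
    rw [h0, joinTime_zero] at this
    exact absurd ht.1 (not_le.2 this)
  obtain ⟨i, hi⟩ := Nat.exists_eq_succ_of_ne_zero hne
  refine ⟨i, not_lt.1 (Nat.find_min hex (by omega)), ?_⟩
  have := Nat.find_spec hex
  rwa [hi] at this

theorem rescale_joinTime_succ (i : ℕ) (t : ℝ) :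
    2 ^ (i + 1) * (t - joinTime i) = 1 + 2 ^ (i + 1) * (t - joinTime (i + 1)) := by
  have h : (2 : ℝ) ^ (i + 1) * (1 / 2) ^ (i + 1) = 1 := by
    rw [← mul_pow]; norm_num
  have h' : (2 : ℝ) ^ (i + 1) * (1 / 2) ^ i = 2 := by
    rw [pow_succ, mul_right_comm, ← mul_pow]; norm_num
  simp only [joinTime, mul_sub, mul_one, h, h']
  ring

/-- Concatenation of a sequence of curves that converges rapidly: the curves, reparametrised by arc
length and slowed down at their ends, are run through one after the other in the intervals
`[1 - 2⁻ⁱ, 1 - 2⁻ⁱ⁻¹]`. Their speeds then tend to zero, so that the resulting curve is of class `C¹` up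
to its end. -/
theorem exists_concatenation {E : Type*} [NormedAddCommGroup E] [NormedSpace ℝ E] [CompleteSpace E]
    {F : E → E → ℝ≥0∞}
    {I : Set E}
    (hF : ∀ x ∈ I, ∀ v (r : ℝ), 0 ≤ r → F x (r • v) = ENNReal.ofReal r * F x v)
    {c : ℕ → ℝ → E} (hc : ∀ i, ContDiffOn ℝ 1 (c i) (Icc 0 1))
    (hI : ∀ i, ∀ t ∈ Icc (0 : ℝ) 1, c i t ∈ I) (hjoin : ∀ i, c i 1 = c (i + 1) 0) {K : ℝ} (hK : 0 < K)
    (hlen : ∀ i, ∫ t in (0 : ℝ)..1, ‖derivWithin (c i) (Icc 0 1) t‖ ≤ K * (1 / 4) ^ i) {Ψ : E}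
    (hΨ : Tendsto (fun i => c i 0) atTop (𝓝 Ψ)) (hΨI : Ψ ∈ I) :
    ∃ γ : ℝ → E, ContDiffOn ℝ 1 γ (Icc 0 1) ∧ (∀ t ∈ Icc (0 : ℝ) 1, γ t ∈ I) ∧ γ 0 = c 0 0 ∧ γ 1 = Ψ ∧
      ∫⁻ t in Icc (0 : ℝ) 1, F (γ t) (derivWithin γ (Icc 0 1) t)
        ≤ ∑' i, ∫⁻ t in Icc (0 : ℝ) 1, F (c i t) (derivWithin (c i) (Icc 0 1) t) := by
  obtain ⟨C, hC0, hC⟩ := exists_reparametrisation (E := E)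
  choose g hgc hgd hg using fun i => exists_continuous_derivative (hc i)
  have hglen : ∀ i, ∫ t in (0 : ℝ)..1, ‖g i t‖ ≤ K * (1 / 4) ^ i := fun i => by
    refine le_trans (le_of_eq ?_) (hlen i)
    refine intervalIntegral.integral_congr fun t ht => ?_
    rw [uIcc_of_le zero_le_one] at ht
    simp only [hgd i t ht]
  choose φ φ' hφ'c hφd hφm hφ0 hφ1 hφ'0 hφb using fun i => hC (hgc i) (b := K * (1 / 4) ^ i)
    (by positivity) (hglen i)
  -- the clocks of the successive curves
  set ψ : ℕ → ℝ → ℝ := fun i t => φ i (2 ^ (i + 1) * (t - joinTime i)) with hψ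
  set ψ' : ℕ → ℝ → ℝ := fun i t => φ' i (2 ^ (i + 1) * (t - joinTime i)) * 2 ^ (i + 1)
  have hψd : ∀ i t, HasDerivAt (ψ i) (ψ' i t) t := fun i t => by
    have h1 : HasDerivAt (fun t : ℝ => 2 ^ (i + 1) * (t - joinTime i)) (2 ^ (i + 1)) t := by
      simpa using ((hasDerivAt_id t).sub_const (joinTime i)).const_mul ((2 : ℝ) ^ (i + 1))
    exact (hφd i _).comp t h1
  have hψ0 : ∀ i t, t ≤ joinTime i → ψ i t = 0 := fun i t ht =>
    hφ0 i _ (mul_nonpos_of_nonneg_of_nonpos (by positivity) (by linarith))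
  have hψ1 : ∀ i t, joinTime (i + 1) ≤ t → ψ i t = 1 := fun i t ht => by
    refine hφ1 i _ ?_
    rw [rescale_joinTime_succ]
    have : 0 ≤ (2 : ℝ) ^ (i + 1) * (t - joinTime (i + 1)) :=
      mul_nonneg (by positivity) (by linarith)
    linarith
  have hψ'0 : ∀ i t, 0 ≤ ψ' i t := fun i t => mul_nonneg (hφ'0 i _) (by positivity)
  -- the increments of the successive curves
  set f : ℕ → ℝ → E := fun i t => ∫ s in (0 : ℝ)..ψ i t, g i s with hf
  have hfc : ∀ i t, f i t = c i (ψ i t) - c i 0 := fun i t => by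
    rw [hg i _ (hφm i _)]; simp [hf, hψ]
  have hfd : ∀ i t, HasDerivAt (f i) (ψ' i t • g i (ψ i t)) t := fun i t =>
    HasDerivAt.scomp t ((hgc i).integral_hasStrictDerivAt 0 _).hasDerivAt (hψd i t)
  have hfb : ∀ i t, ‖ψ' i t • g i (ψ i t)‖ ≤ 2 * C * K * (1 / 2) ^ i := fun i t => by
    rw [norm_smul, Real.norm_of_nonneg (hψ'0 i t)]
    have h1 := hφb i (2 ^ (i + 1) * (t - joinTime i))
    calc ψ' i t * ‖g i (ψ i t)‖
        = ‖g i (ψ i t)‖ * φ' i (2 ^ (i + 1) * (t - joinTime i)) * 2 ^ (i + 1) := by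
          simp only [ψ']; ring
      _ ≤ C * (K * (1 / 4) ^ i) * 2 ^ (i + 1) := by gcongr
      _ = 2 * C * K * ((1 / 4) ^ i * 2 ^ i) := by ring
      _ = 2 * C * K * (1 / 2) ^ i := by rw [← mul_pow]; norm_num
  have hsum : Summable fun i : ℕ => 2 * C * K * (1 / 2 : ℝ) ^ i :=
    (summable_geometric_of_lt_one (by norm_num) (by norm_num)).mul_left _
  have hf0 : ∀ i t, t ≤ joinTime i → f i t = 0 := fun i t ht => by
    rw [hfc, hψ0 i t ht, sub_self]
  have hf1 : ∀ i t, joinTime (i + 1) ≤ t → f i t = c (i + 1) 0 - c i 0 := fun i t ht => by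
    rw [hfc, hψ1 i t ht, hjoin]
  have hfsum0 : Summable fun i => f i 0 := by
    have : (fun i => f i 0) = fun _ => 0 := funext fun i =>
      hf0 i 0 (by rw [← joinTime_zero]; exact joinTime_mono (Nat.zero_le i))
    rw [this]
    exact summable_zero
  set γ : ℝ → E := fun t => c 0 0 + ∑' i, f i t with hγ
  have hγd : ∀ t, HasDerivAt γ (∑' i, ψ' i t • g i (ψ i t)) t := fun t =>
    (hasDerivAt_tsum hsum hfd hfb hfsum0 t).const_add _
  have hψc : ∀ i, Continuous (ψ i) := fun i =>
    continuous_iff_continuousAt.2 fun t => (hψd i t).continuousAt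
  have hγ'c : Continuous fun t => ∑' i, ψ' i t • g i (ψ i t) := by
    refine continuous_tsum (fun i => ?_) hsum hfb
    refine Continuous.smul (Continuous.mul ((hφ'c i).comp ?_) continuous_const)
      ((hgc i).comp (hψc i))
    fun_prop
  have hγC : ContDiff ℝ 1 γ := contDiff_one_iff_deriv.2 ⟨fun t => (hγd t).differentiableAt, by
    rwa [show deriv γ = fun t => ∑' i, ψ' i t • g i (ψ i t) from funext fun t => (hγd t).deriv]⟩
  -- in the `i`-th interval, the curve runs along `c i`
  have hγi : ∀ i, ∀ t ∈ Icc (joinTime i) (joinTime (i + 1)), γ t = c i (ψ i t) := by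
    intro i t ht
    have h1 : ∑' j, f j t = ∑ j ∈ Finset.range (i + 1), f j t := tsum_eq_sum fun j hj => by
      rw [Finset.mem_range, not_lt] at hj
      exact hf0 j t (ht.2.trans (joinTime_mono hj))
    have h2 : ∑ j ∈ Finset.range i, f j t = ∑ j ∈ Finset.range i, (c (j + 1) 0 - c j 0) :=
      Finset.sum_congr rfl fun j hj => by
        rw [Finset.mem_range] at hj
        exact hf1 j t ((joinTime_mono hj).trans ht.1)
    simp only [hγ]
    rw [h1, Finset.sum_range_succ, h2, Finset.sum_range_sub (fun j => c j 0), hfc]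
    abel
  have hγ1 : γ 1 = Ψ := by
    have h1 : Tendsto (fun i => γ (joinTime i)) atTop (𝓝 (γ 1)) :=
      (hγC.continuous.tendsto 1).comp tendsto_joinTime
    refine tendsto_nhds_unique h1 (hΨ.congr fun i => ?_)
    rw [hγi i _ ⟨le_rfl, joinTime_mono (Nat.le_succ i)⟩, hψ0 i _ le_rfl]
  refine ⟨γ, hγC.contDiffOn, fun t ht => ?_, ?_, hγ1, ?_⟩
  · rcases ht.2.eq_or_lt with rfl | hlt
    · rwa [hγ1]
    · obtain ⟨i, hi⟩ := exists_mem_Ico_joinTime ⟨ht.1, hlt⟩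
      rw [hγi i t (Ico_subset_Icc_self hi)]
      exact hI i _ (hφm i _)
  · rw [hγi 0 0 ⟨joinTime_zero.le, by rw [← joinTime_zero]; exact joinTime_mono zero_le_one⟩,
      hψ0 0 0 joinTime_zero.ge]
  have hFi : ∀ i, ∫⁻ t in Ico (joinTime i) (joinTime (i + 1)), F (γ t) (derivWithin γ (Icc 0 1) t)
      ≤ ∫⁻ t in Icc (0 : ℝ) 1, F (c i t) (derivWithin (c i) (Icc 0 1) t) := by
    intro i
    rw [← setLIntegral_congr (Ioo_ae_eq_Ico (μ := volume))]
    have h1 := lintegral_image_eq_lintegral_deriv_mul_of_monotoneOn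
      (measurableSet_Ioo (a := joinTime i) (b := joinTime (i + 1)))
      (fun t _ => (hψd i t).hasDerivWithinAt)
      ((monotone_of_hasDerivAt_nonneg (hψd i) (hψ'0 i)).monotoneOn _)
      (fun s => F (c i s) (derivWithin (c i) (Icc 0 1) s))
    calc _ = ∫⁻ t in Ioo (joinTime i) (joinTime (i + 1)), ENNReal.ofReal (ψ' i t) *
          F (c i (ψ i t)) (derivWithin (c i) (Icc 0 1) (ψ i t)) := by
          refine setLIntegral_congr_fun measurableSet_Ioo fun t ht => ?_
          have ht01 : t ∈ Icc (0 : ℝ) 1 :=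
            ⟨(by rw [← joinTime_zero]; exact joinTime_mono (Nat.zero_le i) : 0 ≤ joinTime i).trans
              ht.1.le, ht.2.le.trans (joinTime_mono.ge_of_tendsto tendsto_joinTime _)⟩
          have h2 : HasDerivAt γ (ψ' i t • g i (ψ i t)) t := by
            refine ((hfd i t).const_add (c i 0)).congr_of_eventuallyEq ?_
            filter_upwards [Icc_mem_nhds ht.1 ht.2] with s hs
            rw [hγi i s hs, hfc]
            abel
          have h3 : derivWithin γ (Icc 0 1) t = ψ' i t • derivWithin (c i) (Icc 0 1) (ψ i t) := by
            rw [hgd i _ (hφm i _)]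
            exact h2.hasDerivWithinAt.derivWithin (uniqueDiffOn_Icc zero_lt_one t ht01)
          simp only [h3, hγi i t (Ioo_subset_Icc_self ht)]
          exact hF _ (hI i _ (hφm i _)) _ _ (hψ'0 i t)
      _ = _ := h1.symm
      _ ≤ _ := lintegral_mono_set (by
          rintro _ ⟨t, -, rfl⟩
          exact hφm i _)
  calc ∫⁻ t in Icc (0 : ℝ) 1, F (γ t) (derivWithin γ (Icc 0 1) t)
      = ∫⁻ t in Ico (0 : ℝ) 1, F (γ t) (derivWithin γ (Icc 0 1) t) :=
        (setLIntegral_congr Ico_ae_eq_Icc).symm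
    _ ≤ ∫⁻ t in ⋃ i, Ico (joinTime i) (joinTime (i + 1)), F (γ t) (derivWithin γ (Icc 0 1) t) :=
        lintegral_mono_set fun t ht => mem_iUnion.2 (exists_mem_Ico_joinTime ht)
    _ ≤ ∑' i, ∫⁻ t in Ico (joinTime i) (joinTime (i + 1)), F (γ t) (derivWithin γ (Icc 0 1) t) :=
        lintegral_iUnion_le _ _
    _ ≤ _ := ENNReal.tsum_le_tsum hFi

end Concatenation


/-! ### Completeness -/

section Homogeneity

theorem weakPartial_smul_ae {F : Type*} [NormedAddCommGroup F] [NormedSpace ℝ F] [CompleteSpace F]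
    {U : Set Plane} (hU : IsOpen U) (j : Fin 2) (r : ℝ) (f : Plane → F) :
    weakPartial U j (r • f) =ᵐ[volume.restrict U] r • weakPartial U j f := by
  by_cases hex : ∃ g, IsWeakPartial U j f g
  · obtain ⟨g, hg⟩ := hex
    exact (hg.weakPartial.smul r).ae_eq hU
  rcases eq_or_ne r 0 with rfl | hr
  · have h0 : IsWeakPartial U j (0 : Plane → F) 0 :=
      ⟨locallyIntegrableOn_zero, locallyIntegrableOn_zero, fun η _ _ _ => by simp⟩
    rw [zero_smul, zero_smul]
    exact h0.ae_eq hU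
  · have hex' : ¬ ∃ g, IsWeakPartial U j (r • f) g := by
      rintro ⟨g, hg⟩
      refine hex ⟨r⁻¹ • g, ?_⟩
      have := hg.smul r⁻¹
      rwa [smul_smul, inv_mul_cancel₀ hr, one_smul] at this
    rw [weakPartial, weakPartial, dif_neg hex, dif_neg hex', smul_zero]

variable {m : ℕ} (N : Set (Euc m)) (u v : Plane → Euc m) (r : ℝ)

theorem cov_smul (j : Fin 2) : cov N u (r • v) j = r • cov N u v j := by
  ext1 y
  rw [cov, pd, fderiv_const_smul_field]
  simp [cov, pd]

theorem covNormSq_smul (y : Plane) : covNormSq N u (r • v) y = r ^ 2 * covNormSq N u v y := by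
  simp only [covNormSq, cov_smul, Pi.smul_apply, inner_smul_left, inner_smul_right, conj_trivial,
    Finset.mul_sum]
  refine Finset.sum_congr rfl fun i _ => Finset.sum_congr rfl fun j _ => ?_
  ring

theorem cov2NormSq_smul_ae {U : Set Plane} (hU : IsOpen U) : ∀ᵐ y ∂volume.restrict U,
    cov2NormSq N U u (r • v) y = r ^ 2 * cov2NormSq N U u v y := by
  have h1 := ae_all_iff.2 fun i : Fin 2 => ae_all_iff.2 fun j : Fin 2 =>
    weakPartial_smul_ae hU i r (cov N u v j)
  filter_upwards [h1] with y hy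
  have h2 : ∀ i j, cov2 N U u (r • v) i j y = r • cov2 N U u v i j y := fun i j => by
    simp only [cov2, cov_smul, hy i j, Pi.smul_apply, map_smul, smul_sub, Finset.smul_sum]
    congr 1
    exact Finset.sum_congr rfl fun k _ => smul_comm _ _ _
  simp only [cov2NormSq, h2, inner_smul_left, inner_smul_right, conj_trivial, Finset.mul_sum]
  refine Finset.sum_congr rfl fun i _ => Finset.sum_congr rfl fun j _ =>
    Finset.sum_congr rfl fun k _ => Finset.sum_congr rfl fun l _ => ?_
  ring

end Homogeneity

section Completeness

variable {S : Type*} [TopologicalSpace S] [ChartedSpace Plane S] [IsManifold (𝓡 2) ∞ S]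
  {𝔄 : DiscCover S} {m n : ℕ} {p : ℝ} {N : Set (Euc m)}

theorem finslerNorm_smul (hp : 1 < p) {Φ : Sobolev 𝔄 m p} (hΦ : Φ ∈ immersions 𝔄 p N)
    (v : Sobolev 𝔄 m p) {r : ℝ} (hr : 0 ≤ r) :
    finslerNorm 𝔄 N Φ (r • v) = ENNReal.ofReal r * finslerNorm 𝔄 N Φ v := by
  have hloc : ∀ i, 𝔄.loc i (r • v).1 = r • 𝔄.loc i v.1 := fun i => rfl
  obtain ⟨lam, Lam, hl, hg⟩ := exists_gramBound hΦ
  have hq : 0 < 2 * p := by linarith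
  have hpow : ∀ a b c d : ℝ, 0 ≤ a → 0 ≤ b → 0 ≤ c →
      (r ^ 2 * a + r ^ 2 * b + r ^ 2 * c) ^ p * d = r ^ (2 * p) * ((a + b + c) ^ p * d) :=
    fun a b c d ha hb hc => by
      rw [← mul_add, ← mul_add, Real.mul_rpow (by positivity) (by positivity), Real.rpow_mul hr,
        Real.rpow_two, mul_assoc]
  have hint : ∀ i, ∫⁻ y in 𝔄.piece i, ENNReal.ofReal
      ((cov2NormSq N (𝔄.disc i) (𝔄.loc i Φ.1) (r • 𝔄.loc i v.1) y
          + covNormSq N (𝔄.loc i Φ.1) (r • 𝔄.loc i v.1) y + ‖(r • 𝔄.loc i v.1) y‖ ^ 2) ^ p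
        * volDensity (𝔄.loc i Φ.1) y) = ENNReal.ofReal r ^ (2 * p) * ∫⁻ y in 𝔄.piece i,
      ENNReal.ofReal ((cov2NormSq N (𝔄.disc i) (𝔄.loc i Φ.1) (𝔄.loc i v.1) y
          + covNormSq N (𝔄.loc i Φ.1) (𝔄.loc i v.1) y + ‖𝔄.loc i v.1 y‖ ^ 2) ^ p
        * volDensity (𝔄.loc i Φ.1) y) := by
    intro i
    rw [← lintegral_const_mul' _ _ (ENNReal.rpow_ne_top_of_nonneg hq.le ENNReal.ofReal_ne_top)]
    have hpd := piece_subset_disc 𝔄 i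
    have hmem : ∀ᵐ y ∂volume.restrict (𝔄.disc i), y ∈ 𝔄.disc i :=
      ae_restrict_mem (𝔄.isOpen_disc i).measurableSet
    refine lintegral_congr_ae ?_
    filter_upwards [ae_mono (Measure.restrict_mono hpd le_rfl) hmem,
      ae_mono (Measure.restrict_mono hpd le_rfl)
        (cov2NormSq_smul_ae N (𝔄.loc i Φ.1) (𝔄.loc i v.1) r (𝔄.isOpen_disc i))] with y hy hy2
    have a1 := cov2NormSq_nonneg (v := 𝔄.loc i v.1) N (𝔄.disc i) (hg i y hy) hl
    have a2 := covNormSq_nonneg (v := 𝔄.loc i v.1) N (hg i y hy) hl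
    rw [ENNReal.ofReal_rpow_of_nonneg hr hq.le, ← ENNReal.ofReal_mul (Real.rpow_nonneg hr _), hy2,
      covNormSq_smul, Pi.smul_apply, norm_smul, mul_pow, Real.norm_of_nonneg hr,
      hpow _ _ _ _ a1 a2 (sq_nonneg _)]
  have hsup : ∀ i y, ENNReal.ofReal √(covNormSq N (𝔄.loc i Φ.1) (r • 𝔄.loc i v.1) y)
      = ENNReal.ofReal r * ENNReal.ofReal √(covNormSq N (𝔄.loc i Φ.1) (𝔄.loc i v.1) y) :=
    fun i y => by
      rw [covNormSq_smul, Real.sqrt_mul (by positivity), Real.sqrt_sq hr, ENNReal.ofReal_mul hr]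
  simp only [finslerNorm, hloc, hint, hsup]
  rw [← Finset.mul_sum, ENNReal.mul_rpow_of_nonneg _ _ (by positivity), mul_add, one_div,
    ENNReal.rpow_rpow_inv hq.ne']
  simp only [ENNReal.mul_iSup]

variable [Fact (1 < p)]

theorem integral_norm_velocity_le {γ : ℝ → Sobolev 𝔄 m p} (hγ : ContDiffOn ℝ 1 γ (Icc 0 1))
    {C l : ℝ} (hC : 0 ≤ C) (hl : 0 ≤ l) (hF : ∀ t ∈ Ioo (0 : ℝ) 1,
      ENNReal.ofReal ‖derivWithin γ (Icc 0 1) t‖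
        ≤ ENNReal.ofReal C * finslerNorm 𝔄 N (γ t) (derivWithin γ (Icc 0 1) t))
    (hlen : finslerLength 𝔄 N γ ≤ ENNReal.ofReal l) :
    ∫ t in (0 : ℝ)..1, ‖derivWithin γ (Icc 0 1) t‖ ≤ C * l := by
  have hint : IntegrableOn (fun t => ‖derivWithin γ (Icc 0 1) t‖) (Ioo 0 1) :=
    (hγ.continuousOn_derivWithin (uniqueDiffOn_Icc zero_lt_one) le_rfl).norm.integrableOn_Icc.mono_set
      Ioo_subset_Icc_self
  rw [intervalIntegral.integral_of_le zero_le_one, integral_Ioc_eq_integral_Ioo,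
    ← ENNReal.ofReal_le_ofReal_iff (by positivity),
    ofReal_integral_eq_lintegral_ofReal hint (ae_of_all _ fun _ => norm_nonneg _)]
  calc _ ≤ ∫⁻ t in Ioo (0 : ℝ) 1,
        ENNReal.ofReal C * finslerNorm 𝔄 N (γ t) (derivWithin γ (Icc 0 1) t) :=
        setLIntegral_mono' measurableSet_Ioo hF
    _ = ENNReal.ofReal C * ∫⁻ t in Ioo (0 : ℝ) 1,
        finslerNorm 𝔄 N (γ t) (derivWithin γ (Icc 0 1) t) :=
        lintegral_const_mul' _ _ ENNReal.ofReal_ne_top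
    _ ≤ ENNReal.ofReal C * ENNReal.ofReal l :=
        mul_le_mul_right ((lintegral_mono_set Ioo_subset_Icc_self).trans hlen) _
    _ = ENNReal.ofReal (C * l) := (ENNReal.ofReal_mul hC).symm

theorem norm_sub_le_integral_norm_velocity [CompactSpace S] [T2Space S]
    {γ : ℝ → Sobolev 𝔄 m p} (hγ : ContDiffOn ℝ 1 γ (Icc 0 1)) :
    ‖γ 1 - γ 0‖ ≤ ∫ t in (0 : ℝ)..1, ‖derivWithin γ (Icc 0 1) t‖ := by
  obtain ⟨c', -, h2, h3⟩ := exists_continuous_derivative hγ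
  rw [h3 1 (right_mem_Icc.2 zero_le_one), add_sub_cancel_left]
  refine (intervalIntegral.norm_integral_le_integral_norm zero_le_one).trans (le_of_eq ?_)
  refine intervalIntegral.integral_congr fun t ht => ?_
  rw [uIcc_of_le zero_le_one] at ht
  simp only [h2 t ht]

theorem exists_curve_of_palaisDist_lt {Φ Ψ : Sobolev 𝔄 m p} {ε : ℝ≥0∞}
    (h : palaisDist 𝔄 N Φ Ψ < ε) : ∃ γ ∈ curves 𝔄 N Φ Ψ, finslerLength 𝔄 N γ < ε := by
  simpa only [palaisDist, iInf_lt_iff, exists_prop] using h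

/-- A limit in `W^{2,2p}` of immersions whose first fundamental forms are uniformly bounded below is an
immersion. -/
theorem mem_immersions_of_tendsto (hN : IsClosed N) {lam Lam : ℝ} (hl : 0 < lam)
    {Φ : ℕ → Sobolev 𝔄 m p} {Ψ : Sobolev 𝔄 m p} (hΨ : Tendsto Φ atTop (𝓝 Ψ))
    (hΦ : ∀ k, ∀ x, (Φ k).1 x ∈ N)
    (hg : ∀ᶠ k in atTop, ∀ i, ∀ y ∈ 𝔄.disc i, GramBound lam Lam (𝔄.loc i (Φ k).1) y) :
    Ψ ∈ immersions 𝔄 p N := by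
  constructor
  · intro x
    obtain ⟨i, hx, hxi⟩ := 𝔄.covers x
    have hev : ∀ f : Sobolev 𝔄 m p,
        evalCLM 𝔄 m p (show 𝔄.chart i x ∈ 𝔄.disc i from hxi) f = f.1 x := fun f => by
      rw [evalCLM_apply, DiscCover.loc, Function.comp_apply, (𝔄.chart i).left_inv hx]
    have h1 := ((evalCLM 𝔄 m p (show 𝔄.chart i x ∈ 𝔄.disc i from hxi)).continuous.tendsto Ψ).comp hΨ
    rw [hev] at h1
    refine hN.mem_of_tendsto h1 (Eventually.of_forall fun k => ?_)
    rw [Function.comp_apply, hev]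
    exact hΦ k x
  · intro x
    obtain ⟨i, hx, hxi⟩ := 𝔄.covers x
    have hy : 𝔄.chart i x ∈ 𝔄.disc i := hxi
    have h1 : GramBound lam Lam (𝔄.loc i Ψ.1) (𝔄.chart i x) := by
      intro X
      have h2 := ((((ContinuousLinearMap.apply ℝ (Euc m) X).comp
        (fderivCLM 𝔄 m p hy)).continuous.norm.pow 2).tendsto Ψ).comp hΨ
      exact ⟨ge_of_tendsto h2 (hg.mono fun k hk => (hk i _ hy X).1),
        le_of_tendsto h2 (hg.mono fun k hk => (hk i _ hy X).2)⟩
    have h2 := (injective_mfderiv_iff Ψ (𝔄.disc_subset i hy)).2 (h1.injective hl)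
    rwa [(𝔄.chart i).left_inv hx] at h2

/-- The conclusion of the completeness argument: a sequence of immersions that is rapidly Cauchy for
the Palais distance, with a common bound of Sobolev speeds by Finsler speeds, is at small distance
from its Sobolev limit. -/
theorem palaisDist_le_of_chain [CompactSpace S] [T2Space S] {Χ : ℕ → Sobolev 𝔄 m p}
    {Ψ : Sobolev 𝔄 m p} (hΨ : Tendsto Χ atTop (𝓝 Ψ)) (hΨi : Ψ ∈ immersions 𝔄 p N) {C δ : ℝ}
    (hC : 0 < C) (hδ : 0 < δ) (hδ1 : δ ≤ 1)
    (hd : ∀ i, palaisDist 𝔄 N (Χ i) (Χ (i + 1)) < ENNReal.ofReal (δ * (1 / 4) ^ i))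
    (hspeed : ∀ i Φ, ∀ γ ∈ curves 𝔄 N (Χ i) Φ, finslerLength 𝔄 N γ ≤ 1 → ∀ t ∈ Ioo (0 : ℝ) 1,
      ENNReal.ofReal ‖derivWithin γ (Icc 0 1) t‖
        ≤ ENNReal.ofReal C * finslerNorm 𝔄 N (γ t) (derivWithin γ (Icc 0 1) t)) :
    palaisDist 𝔄 N (Χ 0) Ψ ≤ ENNReal.ofReal (2 * δ) := by
  choose c hc hcl using fun i => exists_curve_of_palaisDist_lt (hd i)
  have hδi : ∀ i : ℕ, δ * (1 / 4) ^ i ≤ 1 := fun i =>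
    mul_le_one₀ hδ1 (by positivity) (pow_le_one₀ (by norm_num) (by norm_num))
  obtain ⟨γ, h1, h2, h3, h4, h5⟩ := exists_concatenation (F := finslerNorm 𝔄 N)
    (I := immersions 𝔄 p N) (c := c) (K := C * δ) (Ψ := Ψ)
    (fun x hx v r hr => finslerNorm_smul Fact.out hx v hr) (fun i => (hc i).1)
    (fun i => (hc i).2.1) (fun i => by rw [(hc i).2.2.2, (hc (i + 1)).2.2.1]) (by positivity)
    (fun i => by
      rw [mul_assoc]
      refine integral_norm_velocity_le (hc i).1 hC.le (by positivity)
        (hspeed i _ _ (hc i) ((hcl i).le.trans ?_)) (hcl i).le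
      rw [← ENNReal.ofReal_one]
      exact ENNReal.ofReal_le_ofReal (hδi i))
    (by simpa only [fun i => (hc i).2.2.1] using hΨ) hΨi
  refine (iInf₂_le γ ⟨h1, h2, h3.trans (hc 0).2.2.1, h4⟩).trans (h5.trans ?_)
  refine (ENNReal.tsum_le_tsum fun i => (hcl i).le).trans ?_
  have hs : Summable fun i : ℕ => (1 / 4 : ℝ) ^ i :=
    summable_geometric_of_lt_one (by norm_num) (by norm_num)
  rw [← ENNReal.ofReal_tsum_of_nonneg (fun i => by positivity) (hs.mul_left δ), tsum_mul_left,
    tsum_geometric_of_lt_one (by norm_num) (by norm_num)]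
  refine ENNReal.ofReal_le_ofReal ?_
  norm_num
  linarith

end Completeness

end PalaisImm

theorem mainTheorem8 {m n : ℕ} (N : Set (PalaisImm.Euc m))
    (hN : PalaisImm.IsClosedSubmanifold n N)
    {S : Type*} [TopologicalSpace S] [ChartedSpace PalaisImm.Plane S] [IsManifold (𝓡 2) ∞ S]
    [CompactSpace S] [T2Space S] (𝔄 : PalaisImm.DiscCover S) (p : ℝ) [Fact (1 < p)]
    (Φ : ℕ → PalaisImm.Sobolev 𝔄 m p) (hΦ : ∀ k, Φ k ∈ PalaisImm.immersions 𝔄 p N)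
    (hC : ∀ ε : ℝ≥0∞, 0 < ε → ∃ K, ∀ j ≥ K, ∀ k ≥ K,
      PalaisImm.palaisDist 𝔄 N (Φ j) (Φ k) < ε) :
    ∃ Ψ ∈ PalaisImm.immersions 𝔄 p N,
      Tendsto (fun k => PalaisImm.palaisDist 𝔄 N (Φ k) Ψ) atTop (𝓝 0) := by
  open PalaisImm in
  obtain ⟨K, hK⟩ := hC 1 one_pos
  obtain ⟨lam, Lam, hl, hg⟩ := exists_gramBound (hΦ K)
  obtain ⟨C₁, -, hC₁⟩ := exists_curve_bound (𝔄 := 𝔄) (p := p) hN hl Lam ‖Φ K‖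
  -- the terms of index at least `K` are reached from `Φ K`, hence satisfy common bounds
  have hend : ∀ j ≥ K, (∀ i, ∀ y ∈ 𝔄.disc i, GramBound (lam * Real.exp (-2)) (Lam * Real.exp 2)
      (𝔄.loc i (Φ j).1) y) ∧ ‖Φ j‖ ≤ C₁ := by
    intro j hj
    obtain ⟨γ, ⟨h1, h2, h3, h4⟩, hlen⟩ := exists_curve_of_palaisDist_lt (hK K le_rfl j hj)
    have hone : (1 : ℝ) ∈ Icc (0 : ℝ) 1 := right_mem_Icc.2 zero_le_one
    rw [← h3] at hg
    rw [← h4]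
    exact ⟨fun i y hy => gramBound_of_finslerLength_le h1 h2 hlen.le hy (hg i y hy) hone,
      (hC₁ γ h1 h2 hlen.le hg (by rw [h3])).1 1 hone⟩
  have hl' : 0 < lam * Real.exp (-2) := by positivity
  obtain ⟨C, hC0, hCb⟩ := exists_curve_bound (𝔄 := 𝔄) (p := p) hN hl' (Lam * Real.exp 2) C₁
  have hspeed : ∀ j ≥ K, ∀ Φ', ∀ γ ∈ curves 𝔄 N (Φ j) Φ', finslerLength 𝔄 N γ ≤ 1 →
      ∀ t ∈ Ioo (0 : ℝ) 1, ENNReal.ofReal ‖derivWithin γ (Icc 0 1) t‖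
        ≤ ENNReal.ofReal C * finslerNorm 𝔄 N (γ t) (derivWithin γ (Icc 0 1) t) := by
    rintro j hj Φ' γ ⟨h1, h2, h3, -⟩ hlen
    exact (hCb γ h1 h2 hlen (by rw [h3]; exact (hend j hj).1) (by rw [h3]; exact (hend j hj).2)).2
  have hnorm : ∀ j ≥ K, ∀ k, ∀ l : ℝ, 0 ≤ l → l ≤ 1 →
      palaisDist 𝔄 N (Φ j) (Φ k) < ENNReal.ofReal l → ‖Φ k - Φ j‖ ≤ C * l := by
    intro j hj k l hl0 hl1 hd
    obtain ⟨γ, hγ, hlen⟩ := exists_curve_of_palaisDist_lt hd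
    have hlen1 : finslerLength 𝔄 N γ ≤ 1 := by
      rw [← ENNReal.ofReal_one]
      exact hlen.le.trans (ENNReal.ofReal_le_ofReal hl1)
    have h1 := norm_sub_le_integral_norm_velocity hγ.1
    rw [hγ.2.2.1, hγ.2.2.2] at h1
    exact h1.trans (integral_norm_velocity_le hγ.1 hC0.le hl0 (hspeed j hj _ γ hγ hlen1) hlen.le)
  have hcau : CauchySeq Φ := by
    refine Metric.cauchySeq_iff'.2 fun ε hε => ?_
    have hlpos : 0 < min 1 (ε / (2 * C)) := by positivity
    obtain ⟨K', hK'⟩ := hC (ENNReal.ofReal (min 1 (ε / (2 * C)))) (ENNReal.ofReal_pos.2 hlpos)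
    refine ⟨max K K', fun k hk => ?_⟩
    rw [dist_eq_norm]
    refine (hnorm (max K K') (le_max_left _ _) k _ hlpos.le (min_le_left _ _)
      (hK' _ (le_max_right _ _) _ ((le_max_right _ _).trans hk))).trans_lt ?_
    calc C * min 1 (ε / (2 * C)) ≤ C * (ε / (2 * C)) := by
          gcongr
          exact min_le_right _ _
      _ = ε / 2 := by field_simp
      _ < ε := half_lt_self hε
  obtain ⟨Ψ, hΨ⟩ := cauchySeq_tendsto_of_complete hcau
  have hΨi : Ψ ∈ immersions 𝔄 p N := mem_immersions_of_tendsto hN.1.isClosed hl' hΨ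
    (fun k => (hΦ k).1) ((eventually_ge_atTop K).mono fun k hk => (hend k hk).1)
  refine ⟨Ψ, hΨi, ENNReal.tendsto_atTop_zero.2 fun ε hε => ?_⟩
  obtain ⟨δ, hδ0, hδ1, hδε⟩ : ∃ δ : ℝ, 0 < δ ∧ δ ≤ 1 ∧ ENNReal.ofReal (2 * δ) ≤ ε := by
    have hfin : min ε 1 ≠ ⊤ := ((min_le_right _ _).trans_lt ENNReal.one_lt_top).ne
    have hpos : 0 < (min ε 1).toReal := ENNReal.toReal_pos (lt_min hε one_pos).ne' hfin
    have hle : (min ε 1).toReal ≤ 1 := by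
      simpa using ENNReal.toReal_mono ENNReal.one_ne_top (min_le_right ε 1)
    refine ⟨(min ε 1).toReal / 2, by positivity, by linarith, ?_⟩
    rw [mul_div_cancel₀ _ two_ne_zero, ENNReal.ofReal_toReal hfin]
    exact min_le_left _ _
  choose κ hκ using fun i : ℕ => hC (ENNReal.ofReal (δ * (1 / 4) ^ i))
    (ENNReal.ofReal_pos.2 (by positivity))
  refine ⟨max K (κ 0), fun k hk => le_trans ?_ hδε⟩
  -- a subsequence that starts at `k` and is rapidly Cauchy
  set ν : ℕ → ℕ := fun i => k + ∑ l ∈ Finset.range i, (κ (l + 1) + 1)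
  have hνs : ∀ i, ν (i + 1) = ν i + (κ (i + 1) + 1) := fun i => by
    simp only [ν, Finset.sum_range_succ]
    ring
  have hνκ : ∀ i, κ i ≤ ν i := fun i => by
    cases i with
    | zero => exact (le_max_right _ _).trans (hk.trans (by simp [ν]))
    | succ i => rw [hνs]; omega
  have hνK : ∀ i, K ≤ ν i := fun i =>
    (le_max_left _ _).trans (hk.trans (Nat.le_add_right _ _))
  have hνmono : StrictMono ν := strictMono_nat_of_lt_succ fun i => by rw [hνs]; omega
  have hν0 : Φ (ν 0) = Φ k := by simp [ν]
  rw [← hν0]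
  exact palaisDist_le_of_chain (Χ := fun i => Φ (ν i)) (hΨ.comp hνmono.tendsto_atTop) hΨi hC0 hδ0 hδ1
    (fun i => hκ i _ (hνκ i) _ ((hνκ i).trans (hνmono (Nat.lt_succ_self i)).le))
    (fun i => hspeed _ (hνK i))
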